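/- \textbf{Setting.} Let $\Delta\subset\mathbb R^2$ be a two-dimensional convex lattice polygon and $\mathcal A=\Delta\cap\mathbb Z^2$, $m=\#\mathcal A$. Let $\mathbb K$ be the field of real Puiseux series in $t$, with the valuation $\mathrm{val}$ (lowest exponent) and the sign $s(a)\in\{\pm1\}$ of the lowest coefficient; put $\mathrm{trop}_{\mathbb R}(a)=(s(a),-\mathrm{val}(a))\in\{\pm1\}\times\mathbb R$. Let $S\subset(\{\pm1\}\times\mathbb R)^{\mathcal A}$ be the closure of the set of all $(\mathrm{trop}_{\mathbb R}(a_\alpha))_\alpha$, where $a\in(\mathbb K^*)^{\mathcal A}$ is such that $F_a=\sum_\alpha a_\alpha x^\alpha$ and both its partial derivatives vanish at $(1,1)$. A real tropical Laurent polynomial $f=\bigoplus_{\alpha\in\mathcal A}(s_\alpha,u_\alpha)w^\alpha$ with support $\mathcal A$ has signs $s_\alpha\in\{\pm1\}$ and moduli $u_\alpha\in\mathbb R$. For $w\in\mathbb R^2$ let $Q_w\subset\mathcal A$ be the set where $\max_\alpha(u_\alpha+\langle\alpha,w\rangle)$ is attained. For $v\in\{\pm1\}^2$ the $v$-chart $C_{f,v}\subset\mathbb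 R^2$ of the real tropical curve of $f$ is the set of $w$ such that $s_\alpha v^\alpha$ takes both signs on $Q_w$. The regular marked subdivision $T(u)$ consists of the marked polygons $(\mathrm{conv}\,Q_w,Q_w)$ that are two-dimensional. Polynomials $f,g$ lie in the same class $s\times\sigma_T$ of the signed secondary fan if their subdivisions coincide and their signs differ by a factor $(v^\alpha)_\alpha$ for some $v\in\{\pm1\}^2$. The class is of maximal dimensional type if every point of $\mathcal A$ is marked, i.e. lies in $Q$ for some $(\mathrm{conv}\,Q,Q)\in T$. The curve of $f$ is singular at $0^+$ (the origin of the $(+,+)$-chart) if $(s,u)\in S$. A vertex of $C_{f,v}$ is a point $w\in C_{f,v}$ with $\mathrm{conv}\,Q_w$ two-dimensional. An edge of $C_{f,v}$ is the set $e_E=\{w: E\subseteq Q_w\}$ for a set of the form $E=Q_{w_0}$ such that $\mathrm{conv}\,E$ is one-dimensional and $s_\alpha v^\alpha$ takes both signs on $E$; its weight is the lattice length of $\mathrm{conv}\,E$. A vertex is $k$-valent in $C_{f,v}$ if it lies on exactly $k$ edges of $C_{f,v}$. The multiplicity of a vertex dual to a triangle is the normalized area (twice the Euclidean area) of that triangle.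 \textbf{Theorem.} Let $s\times\sigma_T$ be a class of maximal dimensional type and $f$ a real tropical Laurent polynomial with coefficients $(s,u)\in s\times\sigma_T$. Assume that the real tropical curve of $f$ is singular at $0^+$ and that $u$ is generic with this property, in the sense that its cell is of smallest codimension: the set of all $u'\in\mathbb R^{\mathcal A}$ such that $T(u')=T(u)$ and such that, for every affine function $\ell$ on $\mathbb R^2$, the maxima of $u'$ and of $u$ over $\{\alpha\in\mathcal A:\ell(\alpha)\ne0\}$ are attained at the same points, spans a linear subspace of dimension $m-3$. Then one of the following holds in the chart $C=C_{f,(+,+)}$: \begin{enumerate} \item $0$ is a $4$-valent vertex of $C$, incident to $4$ edges of weight one; \item $0$ is an isolated point of $C$ and a vertex of multiplicity $3$; \item $0$ is the midpoint of a bounded edge of $C$ of weight $2$ whose end points are two $1$-valent vertices of $C$ or two $3$-valent vertices of $C$; \item $0$ lies on a bounded edge of $C$ of weight $2$ with end points $p,q$, where $p$ is a $3$-valent vertex of $C$ and $q$ is a $1$-valent or a $3$-valent vertex of $C$, and $0$ lies strictly between $p$ and the midpoint of the edge; \item $0$ lies in the interior of an unbounded edge (a ray) of $C$ of weight $2$ whose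 end point is a $3$-valent vertex of $C$. \end{enumerate} -/

import Mathlib

open Topology

noncomputable section

namespace RealTrop

/-! ### Real Puiseux series and real tropicalization -/

/-- A Hahn series over `ℝ` with rational exponents is a real Puiseux series if its exponents have a
common denominator (that they are bounded below holds for every Hahn series). -/
def IsPuiseux (a : HahnSeries ℚ ℝ) : Prop :=
  ∃ n : ℕ, 0 < n ∧ ∀ q ∈ a.support, ∃ k : ℤ, q = (k : ℚ) / (n : ℚ)

/-- The real tropical group `{±1} × ℝ`, with the product topology (discrete on `{±1}`). -/
abbrev RealTropicalGroup : Type := ℤˣ × ℝ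

/-- Real tropicalization `x ↦ (s(x), -val(x))` of a nonzero series; the sign is that of the
coefficient of the lowest exponent (the value at `0` is never used). -/
def realTrop (a : HahnSeries ℚ ℝ) : RealTropicalGroup :=
  (if 0 < a.leadingCoeff then 1 else -1, -(a.order : ℝ))

/-! ### Supports, Laurent polynomials, singular points -/

/-- The embedding of the lattice `ℤ²` in `ℝ²`. -/
def pt (α : ℤ × ℤ) : ℝ × ℝ := ((α.1 : ℝ), (α.2 : ℝ))

/-- `𝒜` is the set of all lattice points of a (two-dimensional) convex lattice polygon. -/
def IsPolygonSupport (𝒜 : Finset (ℤ × ℤ)) : Prop :=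
  ¬ Collinear ℝ (pt '' (𝒜 : Set (ℤ × ℤ))) ∧
    ∀ α : ℤ × ℤ, pt α ∈ convexHull ℝ (pt '' (𝒜 : Set (ℤ × ℤ))) → α ∈ 𝒜

variable {𝒜 : Finset (ℤ × ℤ)}

/-- The value at `p` of the Laurent polynomial `F_a = ∑ a_α x^α`. -/
def laurentEval (a : 𝒜 → HahnSeries ℚ ℝ) (p : HahnSeries ℚ ℝ × HahnSeries ℚ ℝ) :
    HahnSeries ℚ ℝ :=
  ∑ α : 𝒜, a α * (p.1 ^ α.1.1 * p.2 ^ α.1.2)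

/-- The value at `p` of `∂F_a/∂x₁`. -/
def laurentDeriv₁ (a : 𝒜 → HahnSeries ℚ ℝ) (p : HahnSeries ℚ ℝ × HahnSeries ℚ ℝ) :
    HahnSeries ℚ ℝ :=
  ∑ α : 𝒜, a α * ((α.1.1 : HahnSeries ℚ ℝ) * p.1 ^ (α.1.1 - 1) * p.2 ^ α.1.2)

/-- The value at `p` of `∂F_a/∂x₂`. -/
def laurentDeriv₂ (a : 𝒜 → HahnSeries ℚ ℝ) (p : HahnSeries ℚ ℝ × HahnSeries ℚ ℝ) :
    HahnSeries ℚ ℝ :=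
  ∑ α : 𝒜, a α * ((α.1.2 : HahnSeries ℚ ℝ) * p.1 ^ α.1.1 * p.2 ^ (α.1.2 - 1))

/-- The coefficient vectors `a` in the torus over the real Puiseux series for which the curve
`F_a = 0` is singular at `(1,1)`. -/
def singularAtOne (𝒜 : Finset (ℤ × ℤ)) : Set (𝒜 → HahnSeries ℚ ℝ) :=
  {a | (∀ α, IsPuiseux (a α) ∧ a α ≠ 0) ∧
    laurentEval a (1, 1) = 0 ∧ laurentDeriv₁ a (1, 1) = 0 ∧ laurentDeriv₂ a (1, 1) = 0}

/-- The real tropicalization of `singularAtOne 𝒜`: the closure of the set of the coordinatewise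
real tropicalizations of its elements. -/
def realTropSingularAtOne (𝒜 : Finset (ℤ × ℤ)) : Set (𝒜 → RealTropicalGroup) :=
  closure ((fun a α => realTrop (a α)) '' singularAtOne 𝒜)

/-! ### Real tropical Laurent polynomials and their curves -/

/-- A real tropical Laurent polynomial `⨁ (s_α, u_α) w^α` with support `𝒜`, given by its
coefficients. -/
abbrev RealTropicalPolynomial (𝒜 : Finset (ℤ × ℤ)) : Type := 𝒜 → RealTropicalGroup

/-- The moduli `u` of the coefficients. -/
def modulus (f : RealTropicalPolynomial 𝒜) : 𝒜 → ℝ := fun α => (f α).2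

/-- The real tropical curve of `f` has a singularity at the point `0⁺` of the `(+,+)`-chart. -/
def IsSingularAtZeroPlus (f : RealTropicalPolynomial 𝒜) : Prop :=
  f ∈ realTropSingularAtOne 𝒜

/-- The value `u_α + ⟨α, w⟩` of a tropical monomial. -/
def monomialValue (u : 𝒜 → ℝ) (w : ℝ × ℝ) (α : 𝒜) : ℝ :=
  u α + ((α.1.1 : ℝ) * w.1 + (α.1.2 : ℝ) * w.2)

/-- The sign `s_α v^α` of the monomial `α` of `f` in the `v`-chart. -/
def signAt (f : RealTropicalPolynomial 𝒜) (v : ℤˣ × ℤˣ) (α : 𝒜) : ℤˣ :=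
  (f α).1 * (v.1 ^ α.1.1 * v.2 ^ α.1.2)

/-- The real tropical curve `C_f`: the maximum is attained at two monomials of opposite signs. -/
def realTropicalCurve (f : RealTropicalPolynomial 𝒜) :
    Set (RealTropicalGroup × RealTropicalGroup) :=
  {y | ∃ i j : 𝒜, i ≠ j ∧
    monomialValue (modulus f) (y.1.2, y.2.2) i = monomialValue (modulus f) (y.1.2, y.2.2) j ∧
    (∀ k, monomialValue (modulus f) (y.1.2, y.2.2) k
      ≤ monomialValue (modulus f) (y.1.2, y.2.2) i) ∧
    signAt f (y.1.1, y.2.1) i ≠ signAt f (y.1.1, y.2.1) j}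

/-- The `v`-chart of `C_f`, as a subset of `ℝ²`. -/
def chart (f : RealTropicalPolynomial 𝒜) (v : ℤˣ × ℤˣ) : Set (ℝ × ℝ) :=
  {w | ((v.1, w.1), (v.2, w.2)) ∈ realTropicalCurve f}

/-! ### Regular marked subdivisions and the signed secondary fan -/

/-- The monomials at which `max_α (u_α + ⟨α, w⟩)` is attained: the marked points of the face of the
upper hull of the points `(α, u_α)` with normal direction `(w, 1)`. -/
def cell (u : 𝒜 → ℝ) (w : ℝ × ℝ) : Set 𝒜 :=
  {α | ∀ β, monomialValue u w β ≤ monomialValue u w α}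

/-- A set of points of the support as a subset of `ℝ²`. -/
def toPlane (Q : Set 𝒜) : Set (ℝ × ℝ) := (fun α : 𝒜 => pt α.1) '' Q

/-- The regular marked subdivision of the Newton polygon induced by the heights `u`: the marked
polygons `(conv Q, Q)` for the upper facets, recorded by their sets `Q` of marked points. -/
def subdivision (u : 𝒜 → ℝ) : Set (Set 𝒜) :=
  {Q | ¬ Collinear ℝ (toPlane Q) ∧ ∃ w, Q = cell u w}

/-- The equivalence class `s × σ_T` of `g` in the signed secondary fan: the signs agree up to the
action of `{±1}²` and the moduli induce the same marked subdivision. -/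
def signedSecondaryClass (g : RealTropicalPolynomial 𝒜) : Set (RealTropicalPolynomial 𝒜) :=
  {f | (∃ v : ℤˣ × ℤˣ, ∀ α, (f α).1 = signAt g v α) ∧
    subdivision (modulus f) = subdivision (modulus g)}

/-- The class of `g` is of maximal dimensional type: all points of the subdivision are marked. -/
def IsMaximalDimensionalType (g : RealTropicalPolynomial 𝒜) : Prop :=
  ∀ α : 𝒜, ∃ Q ∈ subdivision (modulus g), α ∈ Q

/-- For the affine function `ℓ(x,y) = c.1 + c.2.1 x + c.2.2 y`, that is for the linear form
`∑ ℓ(α) y_α` in the ideal of `singularAtOne 𝒜`, the monomials of its initial form with respect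
to `u`. -/
def initialSupport (c : ℝ × ℝ × ℝ) (u : 𝒜 → ℝ) : Set 𝒜 :=
  {α | c.1 + c.2.1 * (α.1.1 : ℝ) + c.2.2 * (α.1.2 : ℝ) ≠ 0 ∧
    ∀ β : 𝒜, c.1 + c.2.1 * (β.1.1 : ℝ) + c.2.2 * (β.1.2 : ℝ) ≠ 0 → u β ≤ u α}

/-- The cell of `u` in the common refinement of the secondary fan and of the fan structure of the
tropicalization of `singularAtOne 𝒜` by initial forms. -/
def refinedCell (u : 𝒜 → ℝ) : Set (𝒜 → ℝ) :=
  {u' | subdivision u' = subdivision u ∧ ∀ c, initialSupport c u' = initialSupport c u}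

/-- `u` lies in a cell of smallest codimension, namely `3`, the codimension of
`singularAtOne 𝒜`. -/
def HasSmallestCodimension (u : 𝒜 → ℝ) : Prop :=
  Module.finrank ℝ (Submodule.span ℝ (refinedCell u)) + 3 = 𝒜.card

/-! ### Vertices and edges of charts -/

/-- `Q` contains two points with different signs in the `v`-chart. -/
def HasBothSigns (f : RealTropicalPolynomial 𝒜) (v : ℤˣ × ℤˣ) (Q : Set 𝒜) : Prop :=
  ∃ α ∈ Q, ∃ β ∈ Q, signAt f v α ≠ signAt f v β

/-- The one-dimensional cells `E` of the subdivision whose dual edge belongs to the `v`-chart. -/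
def chartEdges (f : RealTropicalPolynomial 𝒜) (v : ℤˣ × ℤˣ) : Set (Set 𝒜) :=
  {E | E.Nontrivial ∧ Collinear ℝ (toPlane E) ∧ (∃ w, E = cell (modulus f) w) ∧
    HasBothSigns f v E}

/-- The closed edge of the tropical curve of `u` dual to `E`. -/
def dualEdge (u : 𝒜 → ℝ) (E : Set 𝒜) : Set (ℝ × ℝ) := {w | E ⊆ cell u w}

/-- The edge dual to `E` has weight `k`: the segment `conv E` has lattice length `k`. -/
def HasWeight (E : Set 𝒜) (k : ℕ) : Prop :=
  ∃ α ∈ E, ∃ β ∈ E, convexHull ℝ (toPlane E) = segment ℝ (pt α.1) (pt β.1) ∧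
    Int.gcd (β.1.1 - α.1.1) (β.1.2 - α.1.2) = k

/-- The edges of the `v`-chart incident to `w`. -/
def incidentEdges (f : RealTropicalPolynomial 𝒜) (v : ℤˣ × ℤˣ) (w : ℝ × ℝ) : Set (Set 𝒜) :=
  {E | E ∈ chartEdges f v ∧ w ∈ dualEdge (modulus f) E}

/-- `w` is a vertex of the `v`-chart: it is dual to a polygon of the subdivision with both signs. -/
def IsChartVertex (f : RealTropicalPolynomial 𝒜) (v : ℤˣ × ℤˣ) (w : ℝ × ℝ) : Prop :=
  ¬ Collinear ℝ (toPlane (cell (modulus f) w)) ∧ HasBothSigns f v (cell (modulus f) w)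

/-- `w` is a `k`-valent vertex of the `v`-chart. -/
def IsChartVertexOfValence (f : RealTropicalPolynomial 𝒜) (v : ℤˣ × ℤˣ) (w : ℝ × ℝ) (k : ℕ) :
    Prop :=
  IsChartVertex f v w ∧ (incidentEdges f v w).ncard = k

/-- `w` is an isolated point of the `v`-chart. -/
def IsIsolatedInChart (f : RealTropicalPolynomial 𝒜) (v : ℤˣ × ℤˣ) (w : ℝ × ℝ) : Prop :=
  w ∈ chart f v ∧ ∀ᶠ w' in 𝓝[≠] w, w' ∉ chart f v

/-- `w` is dual to a lattice triangle of normalized area (twice the Euclidean area) `k`. -/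
def HasTriangleMultiplicity (u : 𝒜 → ℝ) (w : ℝ × ℝ) (k : ℤ) : Prop :=
  ∃ α β γ : 𝒜, convexHull ℝ (toPlane (cell u w)) =
      convexHull ℝ {pt α.1, pt β.1, pt γ.1} ∧
    |(β.1.1 - α.1.1) * (γ.1.2 - α.1.2) - (γ.1.1 - α.1.1) * (β.1.2 - α.1.2)| = k

end RealTrop

end

/-!
The polynomials whose coefficients satisfy `∑ ℓ(α) a_α = 0` for all affine functions `ℓ` are those
with a singular curve at `(1,1)`. The terms of lowest order in such a relation must cancel, so over
a real tropical singular curve the initial form of each of these relations contains terms of both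
signs; this condition is closed and hence holds on the whole of `realTropSingularAtOne`
(`IsSingularAtZeroPlus.initialFormChangesSign`). Only this consequence of the singularity is used.

In the other direction, the moduli on a refined cell are subject to linear relations: the moduli at
two monomials of the same initial form agree, and the moduli are affine on each marked polygon of
the subdivision. In codimension three at most three such relations are independent
(`HasSmallestCodimension.false_of_echelon`). Finally, since every point of the support is marked,
every polygon of the subdivision has all its lattice points among its marked points
(`isLatticeConvex_cell`), so lattice triangles without further marked points are unimodular
(`IsLatticeConvex.exists_mem_of_orient`).

Let `U` be the set of monomials of largest modulus, that is, the cell at the origin. By the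
sign condition, no affine function vanishes at all points of `U` but one, so that `U` has at
least three points; the equalities between moduli leave at most four.

* If `U` has four points, no three of them are collinear, for a line containing all four would
  contribute a fourth relation. The sign condition then forces the signs to be those of the unique
  affine dependence of the four points. Either the signs alternate on a quadrilateral, whose sides
  are the edges at the origin, or one point lies in the interior of the triangle formed by the
  others, which decomposes into three unimodular triangles.
* If `U` has three points `a`, `b`, `c`, these are collinear with `b` as the midpoint, and the sign
  changes at `b`: the origin lies on an edge of weight two. The affine function vanishing on the
  line `ab` provides the third relation: the largest modulus off the line is attained at exactly
  two points `p` and `q`. As there are no more relations, each end of the dual edge is dual to a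
  triangle over `abc` or to the trapezoid `abcpq`, of height one in either case
  (`IsLineConfiguration.exists_endpoint`). Hence the distance from the origin to an end is the
  difference of the moduli at `a` and at the apex, in units of the normal vector, and it is
  smallest for `p` and `q`. If `p` and `q` are on different sides of the line, the origin is the
  midpoint, and the signs of `p` and `q` agree. If they are on the same side, they have
  different signs, the trapezoid is a 3-valent vertex, and the other end, if there is one, is
  farther away.
-/

namespace RealTrop

variable {𝒜 : Finset (ℤ × ℤ)}

/-! ### The sign condition on initial forms -/

/-- The value at `α` of the affine function with coefficients `c`. -/
def affineValue (c : ℝ × ℝ × ℝ) (α : 𝒜) : ℝ :=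
  c.1 + c.2.1 * (α.1.1 : ℝ) + c.2.2 * (α.1.2 : ℝ)

/-- The initial form at `f` of the linear form `∑ ℓ(α) y_α`, `ℓ` being the affine function with
coefficients `c`, has terms of both signs. -/
def InitialFormChangesSign (c : ℝ × ℝ × ℝ) (f : RealTropicalPolynomial 𝒜) : Prop :=
  ∃ α β : 𝒜, 0 < (((f α).1 : ℤ) : ℝ) * affineValue c α ∧
    (((f β).1 : ℤ) : ℝ) * affineValue c β < 0 ∧
    (∀ γ, affineValue c γ ≠ 0 → (f γ).2 ≤ (f α).2) ∧
    (∀ γ, affineValue c γ ≠ 0 → (f γ).2 ≤ (f β).2)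

lemma isClosed_initialFormChangesSign (c : ℝ × ℝ × ℝ) :
    IsClosed {f : RealTropicalPolynomial 𝒜 | InitialFormChangesSign c f} := by
  have hsign : ∀ (α : 𝒜) (P : ℝ → Prop),
      IsClosed {f : RealTropicalPolynomial 𝒜 | P (((f α).1 : ℤ) : ℝ)} := by
    intro α P
    have : Continuous fun f : RealTropicalPolynomial 𝒜 => ((f α).1 : ℤ) :=
      Units.continuous_val.comp (continuous_fst.comp (continuous_apply α))
    exact (isClosed_discrete {k : ℤ | P (k : ℝ)}).preimage this
  have hle : ∀ α γ : 𝒜, IsClosed {f : RealTropicalPolynomial 𝒜 |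
      affineValue c γ ≠ 0 → (f γ).2 ≤ (f α).2} := by
    intro α γ
    by_cases h : affineValue c γ = 0
    · simp [h]
    · simp only [ne_eq, h, not_false_eq_true, forall_const]
      exact isClosed_le (by fun_prop) (by fun_prop)
  simp only [InitialFormChangesSign, Set.ofPred_exists, Set.ofPred_and]
  refine isClosed_iUnion_of_finite fun α => isClosed_iUnion_of_finite fun β => ?_
  have hle' : ∀ α : 𝒜, IsClosed {f : RealTropicalPolynomial 𝒜 |
      ∀ γ, affineValue c γ ≠ 0 → (f γ).2 ≤ (f α).2} := by
    intro α
    rw [Set.ofPred_forall]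
    exact isClosed_iInter (hle α)
  exact (hsign α fun s => 0 < s * affineValue c α).inter
    ((hsign β fun s => s * affineValue c β < 0).inter ((hle' α).inter (hle' β)))

lemma realTrop_sign_mul_leadingCoeff_pos {a : HahnSeries ℚ ℝ} (ha : a ≠ 0) :
    0 < (((realTrop a).1 : ℤ) : ℝ) * a.leadingCoeff := by
  have h : a.leadingCoeff ≠ 0 := HahnSeries.leadingCoeff_ne_zero.mpr ha
  unfold realTrop
  by_cases h0 : 0 < a.leadingCoeff
  · simp [h0]
  · simpa [h0] using lt_of_le_of_ne (not_lt.mp h0) h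

/-- The terms of lowest order of a relation between series cannot all have the same sign. -/
lemma initialFormChangesSign_of_mem_singularAtOne {a : 𝒜 → HahnSeries ℚ ℝ}
    (ha : a ∈ singularAtOne 𝒜) (c : ℝ × ℝ × ℝ) (hc : ∃ α : 𝒜, affineValue c α ≠ 0) :
    InitialFormChangesSign c (fun α => realTrop (a α)) := by
  classical
  obtain ⟨hne, h0, h1, h2⟩ := ha
  simp only [laurentEval, laurentDeriv₁, laurentDeriv₂, one_zpow, mul_one] at h0 h1 h2
  have hcoeff : ∀ q : ℚ, ∑ α : 𝒜, affineValue c α * (a α).coeff q = 0 := by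
    intro q
    have key : ∀ (b : 𝒜 → ℤ), ∑ α : 𝒜, a α * (b α : HahnSeries ℚ ℝ) = 0 →
        ∑ α : 𝒜, (b α : ℝ) * (a α).coeff q = 0 := by
      intro b hb
      have := congrArg (fun x : HahnSeries ℚ ℝ => x.coeff q) hb
      simp only [HahnSeries.coeff_sum, HahnSeries.coeff_zero] at this
      rw [← this]
      refine Finset.sum_congr rfl fun α _ => ?_
      rw [mul_comm (a α), ← map_intCast (HahnSeries.C (Γ := ℚ) (R := ℝ)),
        HahnSeries.C_mul_eq_smul, HahnSeries.coeff_smul, smul_eq_mul]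
    have e0 := key (fun _ => 1) (by simpa using h0)
    have e1 := key (fun α => α.1.1) h1
    have e2 := key (fun α => α.1.2) h2
    have : ∑ α : 𝒜, affineValue c α * (a α).coeff q =
        c.1 * ∑ α : 𝒜, (((1 : ℤ)) : ℝ) * (a α).coeff q +
        c.2.1 * ∑ α : 𝒜, (α.1.1 : ℝ) * (a α).coeff q +
        c.2.2 * ∑ α : 𝒜, (α.1.2 : ℝ) * (a α).coeff q := by
      simp only [Finset.mul_sum, ← Finset.sum_add_distrib]
      refine Finset.sum_congr rfl fun α _ => ?_
      simp only [affineValue]; push_cast; ring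
    rw [this, e0, e1, e2]; ring
  obtain ⟨μ, hμ, hmin⟩ := (Finset.univ.filter fun α : 𝒜 => affineValue c α ≠ 0).exists_min_image
    (fun α => (a α).order) (by obtain ⟨α, hα⟩ := hc; exact ⟨α, by simp [hα]⟩)
  simp only [Finset.mem_filter, Finset.mem_univ, true_and] at hμ hmin
  set q := (a μ).order with hq
  have hterm : ∀ α : 𝒜, affineValue c α * (a α).coeff q ≠ 0 →
      affineValue c α ≠ 0 ∧ (a α).order = q ∧ (a α).coeff q = (a α).leadingCoeff := by
    intro α hα
    have h1 := left_ne_zero_of_mul hα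
    have h2 := right_ne_zero_of_mul hα
    have h3 : (a α).order = q := le_antisymm (HahnSeries.order_le_of_coeff_ne_zero h2) (hmin α h1)
    refine ⟨h1, h3, ?_⟩
    rw [HahnSeries.leadingCoeff_eq, h3]
  have hμ' : affineValue c μ * (a μ).coeff q ≠ 0 := by
    refine mul_ne_zero hμ ?_
    rw [hq, ← HahnSeries.leadingCoeff_eq]
    exact HahnSeries.leadingCoeff_ne_zero.mpr (hne μ).2
  have hmax : ∀ α : 𝒜, (a α).order = q → ∀ γ, affineValue c γ ≠ 0 →
      (realTrop (a γ)).2 ≤ (realTrop (a α)).2 := by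
    intro α hα γ hγ
    have := hmin γ hγ
    simp only [realTrop, neg_le_neg_iff, hα]
    exact_mod_cast this
  have hpos : ∃ α ∈ Finset.univ, 0 < affineValue c α * (a α).coeff q :=
    Finset.exists_pos_of_sum_zero_of_exists_nonzero _ (hcoeff q) ⟨μ, Finset.mem_univ _, hμ'⟩
  have hneg : ∃ β ∈ Finset.univ, 0 < -(affineValue c β * (a β).coeff q) :=
    Finset.exists_pos_of_sum_zero_of_exists_nonzero _
      (by rw [Finset.sum_neg_distrib, hcoeff q, neg_zero])
      ⟨μ, Finset.mem_univ _, neg_ne_zero.mpr hμ'⟩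
  obtain ⟨α, -, hα⟩ := hpos
  obtain ⟨β, -, hβ⟩ := hneg
  obtain ⟨-, oα, lα⟩ := hterm α hα.ne'
  obtain ⟨-, oβ, lβ⟩ := hterm β (neg_ne_zero.mp hβ.ne')
  refine ⟨α, β, ?_, ?_, hmax α oα, hmax β oβ⟩
  · have := realTrop_sign_mul_leadingCoeff_pos (hne α).2
    rw [lα] at hα
    by_contra hcon
    nlinarith [mul_pos this hα, sq_nonneg (a α).leadingCoeff, mul_nonneg (neg_nonneg.mpr
      (not_lt.mp hcon)) (sq_nonneg (a α).leadingCoeff)]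
  · have := realTrop_sign_mul_leadingCoeff_pos (hne β).2
    rw [lβ] at hβ
    by_contra hcon
    nlinarith [mul_pos this hβ, sq_nonneg (a β).leadingCoeff, mul_nonneg
      (not_lt.mp hcon) (sq_nonneg (a β).leadingCoeff)]

/-- The condition on initial forms is closed, so it passes to the closure defining the real
tropicalization. -/
lemma IsSingularAtZeroPlus.initialFormChangesSign {f : RealTropicalPolynomial 𝒜}
    (hf : IsSingularAtZeroPlus f) (c : ℝ × ℝ × ℝ) (hc : ∃ α : 𝒜, affineValue c α ≠ 0) :
    InitialFormChangesSign c f := by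
  have : realTropSingularAtOne 𝒜 ⊆ {f | InitialFormChangesSign c f} :=
    closure_minimal (by
      rintro _ ⟨a, ha, rfl⟩
      exact initialFormChangesSign_of_mem_singularAtOne ha c hc) (isClosed_initialFormChangesSign c)
  exact this hf

/-! ### Linear relations on a refined cell -/

/-- The linear form with coefficients `φ` vanishes on the refined cell of `u`. -/
def IsCellRelation (u φ : 𝒜 → ℝ) : Prop :=
  ∀ u' ∈ refinedCell u, ∑ α, φ α * u' α = 0

lemma IsCellRelation.sub_smul {u φ ψ : 𝒜 → ℝ} (hφ : IsCellRelation u φ)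
    (hψ : IsCellRelation u ψ) (k : ℝ) : IsCellRelation u (fun α => φ α - k * ψ α) := by
  intro u' hu'
  have h1 := hφ u' hu'
  have h2 := hψ u' hu'
  simp only [sub_mul, Finset.sum_sub_distrib, mul_assoc, ← Finset.mul_sum, h1, h2]
  simp

open Classical in
lemma isCellRelation_single_sub_single {u : 𝒜 → ℝ} {c : ℝ × ℝ × ℝ} {α β : 𝒜}
    (hα : α ∈ initialSupport c u) (hβ : β ∈ initialSupport c u) :
    IsCellRelation u (Pi.single α 1 - Pi.single β 1) := by
  intro u' hu'
  rw [← hu'.2 c] at hα hβ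
  have : u' α = u' β := le_antisymm (hβ.2 α hα.1) (hα.2 β hβ.1)
  simp [sub_mul, Finset.sum_sub_distrib, Pi.single_apply, this]

/-- On each marked polygon of the subdivision the heights are affine. -/
lemma isCellRelation_of_affine_dependence {u φ : 𝒜 → ℝ} {Q : Set 𝒜} (hQ : Q ∈ subdivision u)
    (hsupp : ∀ α, φ α ≠ 0 → α ∈ Q) (h0 : ∑ α, φ α = 0) (h1 : ∑ α, φ α * (α.1.1 : ℝ) = 0)
    (h2 : ∑ α, φ α * (α.1.2 : ℝ) = 0) : IsCellRelation u φ := by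
  intro u' hu'
  rw [← hu'.1] at hQ
  obtain ⟨w, rfl⟩ := hQ.2
  by_cases hφ : ∃ β, φ β ≠ 0
  · obtain ⟨β, hβ⟩ := hφ
    have hβ' := hsupp β hβ
    have hterm : ∀ α, φ α * u' α = monomialValue u' w β * φ α -
        w.1 * (φ α * (α.1.1 : ℝ)) - w.2 * (φ α * (α.1.2 : ℝ)) := by
      intro α
      by_cases hα : φ α = 0
      · simp [hα]
      · have : monomialValue u' w α = monomialValue u' w β :=
          le_antisymm (hβ' α) (hsupp α hα β)
        rw [← this, monomialValue]; ring
    simp only [hterm, Finset.sum_sub_distrib, ← Finset.mul_sum, h0, h1, h2]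
    ring
  · push Not at hφ
    simp [hφ]

/-- A cell of codimension three has no four relations in echelon form. -/
lemma HasSmallestCodimension.false_of_echelon {u : 𝒜 → ℝ} (hu : HasSmallestCodimension u)
    {φ₁ φ₂ φ₃ φ₄ : 𝒜 → ℝ} {x₁ x₂ x₃ x₄ : 𝒜} (h₁ : IsCellRelation u φ₁) (h₂ : IsCellRelation u φ₂)
    (h₃ : IsCellRelation u φ₃) (h₄ : IsCellRelation u φ₄) (d₁ : φ₁ x₁ ≠ 0) (d₂ : φ₂ x₂ ≠ 0)
    (d₃ : φ₃ x₃ ≠ 0) (d₄ : φ₄ x₄ ≠ 0) (e₁₂ : φ₁ x₂ = 0) (e₁₃ : φ₁ x₃ = 0) (e₁₄ : φ₁ x₄ = 0)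
    (e₂₃ : φ₂ x₃ = 0) (e₂₄ : φ₂ x₄ = 0) (e₃₄ : φ₃ x₄ = 0) : False := by
  have hli : LinearIndependent ℝ ![φ₁, φ₂, φ₃, φ₄] := by
    rw [Fintype.linearIndependent_iff]
    intro g hg
    simp only [Fin.sum_univ_four, Matrix.cons_val] at hg
    have ev : ∀ x, g 0 * φ₁ x + g 1 * φ₂ x + g 2 * φ₃ x + g 3 * φ₄ x = 0 := by
      intro x
      simpa using congrFun hg x
    have g3 : g 3 = 0 := by have := ev x₄; simp_all
    have g2 : g 2 = 0 := by have := ev x₃; simp_all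
    have g1 : g 1 = 0 := by have := ev x₂; simp_all
    have g0 : g 0 = 0 := by have := ev x₁; simp_all
    intro i
    fin_cases i <;> assumption
  set M : Matrix (Fin 4) 𝒜 ℝ := Matrix.of ![φ₁, φ₂, φ₃, φ₄] with hM
  have hrank : M.rank = 4 := by simpa using LinearIndependent.rank_matrix (M := M) hli
  have hker : Submodule.span ℝ (refinedCell u) ≤ LinearMap.ker M.mulVecLin := by
    rw [Submodule.span_le]
    intro u' hu'
    rw [SetLike.mem_coe, LinearMap.mem_ker]
    ext i
    fin_cases i
    · simpa [hM, Matrix.mulVec, dotProduct] using h₁ u' hu'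
    · simpa [hM, Matrix.mulVec, dotProduct] using h₂ u' hu'
    · simpa [hM, Matrix.mulVec, dotProduct] using h₃ u' hu'
    · simpa [hM, Matrix.mulVec, dotProduct] using h₄ u' hu'
  have h5 := Submodule.finrank_mono hker
  have h6 := LinearMap.finrank_range_add_finrank_ker M.mulVecLin
  rw [← Matrix.rank, hrank, Module.finrank_fintype_fun_eq_card, Fintype.card_coe] at h6
  unfold HasSmallestCodimension at hu
  omega

/-! ### Lattice geometry of cells -/

/-- The determinant of `y - x` and `z - x`: the signed normalized area of the triangle `xyz`. -/
def orient (x y z : ℤ × ℤ) : ℤ :=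
  (y.1 - x.1) * (z.2 - x.2) - (z.1 - x.1) * (y.2 - x.2)

lemma collinear_toPlane_iff {Q : Set 𝒜} {x y : 𝒜} (hx : x ∈ Q) (hy : y ∈ Q) (hxy : x ≠ y) :
    Collinear ℝ (toPlane Q) ↔ ∀ z ∈ Q, orient x.1 y.1 z.1 = 0 := by
  have hx' : pt x.1 ∈ toPlane Q := ⟨x, hx, rfl⟩
  rw [collinear_iff_of_mem hx']
  constructor
  · rintro ⟨v, hv⟩ z hz
    obtain ⟨r, hr⟩ := hv (pt y.1) ⟨y, hy, rfl⟩
    obtain ⟨t, ht⟩ := hv (pt z.1) ⟨z, hz, rfl⟩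
    simp only [pt, vadd_eq_add, Prod.ext_iff, Prod.fst_add, Prod.snd_add, Prod.smul_fst,
      Prod.smul_snd, smul_eq_mul] at hr ht
    have : ((orient x.1 y.1 z.1 : ℤ) : ℝ) = 0 := by
      simp only [orient]; push_cast
      rw [hr.1, hr.2, ht.1, ht.2]; ring
    exact_mod_cast this
  · intro h
    refine ⟨pt y.1 - pt x.1, ?_⟩
    rintro _ ⟨z, hz, rfl⟩
    have hz' : ((orient x.1 y.1 z.1 : ℤ) : ℝ) = 0 := by exact_mod_cast h z hz
    simp only [orient] at hz'
    push_cast at hz'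
    have hN : ((y.1.1 : ℝ) - x.1.1) ^ 2 + ((y.1.2 : ℝ) - x.1.2) ^ 2 ≠ 0 := by
      intro h0
      have n1 := sq_nonneg ((y.1.1 : ℝ) - x.1.1)
      have n2 := sq_nonneg ((y.1.2 : ℝ) - x.1.2)
      have h1 : ((y.1.1 : ℝ) - x.1.1) = 0 := pow_eq_zero_iff two_ne_zero |>.mp (by linarith)
      have h2 : ((y.1.2 : ℝ) - x.1.2) = 0 := pow_eq_zero_iff two_ne_zero |>.mp (by linarith)
      refine hxy (Subtype.ext (Prod.ext ?_ ?_))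
      · exact_mod_cast (sub_eq_zero.mp h1).symm
      · exact_mod_cast (sub_eq_zero.mp h2).symm
    refine ⟨(((z.1.1 : ℝ) - x.1.1) * (y.1.1 - x.1.1) + ((z.1.2 : ℝ) - x.1.2) * (y.1.2 - x.1.2)) /
      (((y.1.1 : ℝ) - x.1.1) ^ 2 + ((y.1.2 : ℝ) - x.1.2) ^ 2), ?_⟩
    simp only [pt, vadd_eq_add, Prod.ext_iff, Prod.fst_add, Prod.snd_add, Prod.smul_fst,
      Prod.smul_snd, smul_eq_mul, Prod.fst_sub, Prod.snd_sub]
    constructor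
    · field_simp
      linear_combination (-((y.1.2 : ℝ) - x.1.2)) * hz'
    · field_simp
      linear_combination ((y.1.1 : ℝ) - x.1.1) * hz'

lemma mem_convexHull_of_orient {S : Set (ℝ × ℝ)} {x y z p : ℤ × ℤ} (hx : pt x ∈ S)
    (hy : pt y ∈ S) (hz : pt z ∈ S) (hD : orient x y z ≠ 0)
    (h₁ : 0 ≤ orient x y z * orient p y z) (h₂ : 0 ≤ orient x y z * orient x p z)
    (h₃ : 0 ≤ orient x y z * orient x y p) : pt p ∈ convexHull ℝ S := by
  have hD' : ((orient x y z : ℤ) : ℝ) ≠ 0 := by exact_mod_cast hD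
  have hpos : ∀ k : ℤ, 0 ≤ orient x y z * k → 0 ≤ (k : ℝ) / (orient x y z : ℤ) := by
    intro k hk
    have : (k : ℝ) / (orient x y z : ℤ) =
        ((orient x y z * k : ℤ) : ℝ) / ((orient x y z : ℤ) : ℝ) ^ 2 := by
      push_cast; field_simp
    rw [this]
    exact div_nonneg (by exact_mod_cast hk) (sq_nonneg _)
  have := (convex_convexHull ℝ S).sum_mem (t := (Finset.univ : Finset (Fin 3)))
    (w := ![((orient p y z : ℤ) : ℝ) / (orient x y z : ℤ),
      ((orient x p z : ℤ) : ℝ) / (orient x y z : ℤ), ((orient x y p : ℤ) : ℝ) / (orient x y z : ℤ)])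
    (z := ![pt x, pt y, pt z])
    (by
      intro i _
      fin_cases i
      · exact hpos _ h₁
      · exact hpos _ h₂
      · exact hpos _ h₃)
    (by
      simp only [Fin.sum_univ_three, Matrix.cons_val]
      field_simp
      simp only [orient]; push_cast; ring)
    (by
      intro i _
      fin_cases i
      · exact subset_convexHull ℝ S hx
      · exact subset_convexHull ℝ S hy
      · exact subset_convexHull ℝ S hz)
  convert this using 1
  simp only [Fin.sum_univ_three, Matrix.cons_val, pt, Prod.smul_mk, Prod.mk_add_mk, smul_eq_mul,
    Prod.ext_iff]
  constructor
  · field_simp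
    simp only [orient]; push_cast; ring
  · field_simp
    simp only [orient]; push_cast; ring

/-- A lattice triangle of normalized area greater than one contains a lattice point besides its
vertices: a lattice point outside of the lattice spanned by the edges is moved into the
parallelogram spanned by them, and then, if necessary, reflected in its centre. -/
lemma exists_lattice_point_of_one_lt_orient {x y z : ℤ × ℤ} (hD : 1 < orient x y z) :
    ∃ p, p ≠ x ∧ p ≠ y ∧ p ≠ z ∧ 0 ≤ orient p y z ∧ 0 ≤ orient x p z ∧ 0 ≤ orient x y p := by
  set D := orient x y z with hDdef
  have hsum : ∀ p, orient p y z = D - orient x p z - orient x y p := by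
    intro p; rw [hDdef]; simp only [orient]; ring
  obtain ⟨p, hp⟩ : ∃ p : ℤ × ℤ, ¬ (D ∣ orient x p z ∧ D ∣ orient x y p) := by
    by_contra! hcon
    obtain ⟨⟨k₁, h₁⟩, ⟨k₂, h₂⟩⟩ := hcon (x.1 + 1, x.2)
    obtain ⟨⟨k₃, h₃⟩, ⟨k₄, h₄⟩⟩ := hcon (x.1, x.2 + 1)
    have hsq : D * 1 = D * (D * (k₁ * k₄ - k₂ * k₃)) := by
      have : D = (orient x (x.1 + 1, x.2) z) * (orient x y (x.1, x.2 + 1)) -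
          (orient x y (x.1 + 1, x.2)) * (orient x (x.1, x.2 + 1) z) := by
        rw [hDdef]; simp only [orient]; ring
      rw [h₁, h₂, h₃, h₄] at this
      linear_combination this
    have h1 := mul_left_cancel₀ (by omega) hsq
    have h2 := Int.eq_one_or_neg_one_of_mul_eq_one h1.symm
    omega
  set i := orient x p z / D
  set j := orient x y p / D
  set q : ℤ × ℤ := (p.1 - i * (y.1 - x.1) - j * (z.1 - x.1),
    p.2 - i * (y.2 - x.2) - j * (z.2 - x.2)) with hq
  have hB : orient x q z = orient x p z % D := by
    rw [show orient x p z % D = orient x p z - D * i from Int.emod_def _ _, hq, hDdef]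
    simp only [orient]; ring
  have hC : orient x y q = orient x y p % D := by
    rw [show orient x y p % D = orient x y p - D * j from Int.emod_def _ _, hq, hDdef]
    simp only [orient]; ring
  have hB0 := Int.emod_nonneg (orient x p z) (show D ≠ 0 by omega)
  have hB1 := Int.emod_lt_of_pos (orient x p z) (show 0 < D by omega)
  have hC0 := Int.emod_nonneg (orient x y p) (show D ≠ 0 by omega)
  have hC1 := Int.emod_lt_of_pos (orient x y p) (show 0 < D by omega)
  have hBC : ¬ (orient x q z = 0 ∧ orient x y q = 0) := by
    rw [hB, hC]
    rintro ⟨h1, h2⟩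
    exact hp ⟨Int.dvd_of_emod_eq_zero h1, Int.dvd_of_emod_eq_zero h2⟩
  rw [← hB] at hB0 hB1
  rw [← hC] at hC0 hC1
  -- a point equal to a vertex has the barycentric coordinates of that vertex
  have hvert : ∀ r : ℤ × ℤ, ¬ (orient x r z = 0 ∧ orient x y r = 0) → orient x r z ≠ D ∨
      orient x y r ≠ 0 → orient x y r ≠ D ∨ orient x r z ≠ 0 → r ≠ x ∧ r ≠ y ∧ r ≠ z := by
    intro r h1 h2 h3
    refine ⟨?_, ?_, ?_⟩
    · rintro rfl; exact h1 ⟨by simp only [orient]; ring, by simp only [orient]; ring⟩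
    · rintro rfl
      rcases h2 with h2 | h2
      · exact h2 rfl
      · exact h2 (by simp only [orient]; ring)
    · rintro rfl
      rcases h3 with h3 | h3
      · exact h3 rfl
      · exact h3 (by simp only [orient]; ring)
  by_cases hle : orient x q z + orient x y q ≤ D
  · obtain ⟨n1, n2, n3⟩ := hvert q hBC (Or.inl hB1.ne) (Or.inl hC1.ne)
    exact ⟨q, n1, n2, n3, by rw [hsum]; omega, hB0, hC0⟩
  · set r : ℤ × ℤ := (y.1 + z.1 - q.1, y.2 + z.2 - q.2) with hr
    have hB' : orient x r z = D - orient x q z := by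
      rw [hr, hDdef]; simp only [orient]; ring
    have hC' : orient x y r = D - orient x y q := by
      rw [hr, hDdef]; simp only [orient]; ring
    obtain ⟨n1, n2, n3⟩ := hvert r (by omega) (by omega) (by omega)
    exact ⟨r, n1, n2, n3, by rw [hsum]; omega, by omega, by omega⟩

/-- The sign-free form of `exists_lattice_point_of_one_lt_orient`. -/
lemma exists_lattice_point_of_orient {x y z : ℤ × ℤ} (hD : orient x y z ≠ 0)
    (h1 : |orient x y z| ≠ 1) :
    ∃ p, p ≠ x ∧ p ≠ y ∧ p ≠ z ∧ 0 ≤ orient x y z * orient p y z ∧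
      0 ≤ orient x y z * orient x p z ∧ 0 ≤ orient x y z * orient x y p := by
  have hswap : ∀ a b c : ℤ × ℤ, orient a b c = - orient a c b := by
    intro a b c; simp only [orient]; ring
  rcases lt_or_gt_of_ne hD with h | h
  · rw [abs_of_neg h] at h1
    obtain ⟨p, n1, n2, n3, h4, h5, h6⟩ := exists_lattice_point_of_one_lt_orient
      (x := x) (y := z) (z := y) (by rw [hswap x z y]; omega)
    refine ⟨p, n1, n3, n2, ?_, ?_, ?_⟩
    · rw [hswap p y z]; nlinarith
    · rw [hswap x p z]; nlinarith
    · rw [hswap x y p]; nlinarith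
  · rw [abs_of_pos h] at h1
    obtain ⟨p, n1, n2, n3, h4, h5, h6⟩ := exists_lattice_point_of_one_lt_orient
      (x := x) (y := y) (z := z) (by omega)
    exact ⟨p, n1, n2, n3, by positivity, by positivity, by positivity⟩

/-- `Q` consists of all lattice points of its convex hull. -/
def IsLatticeConvex (Q : Set 𝒜) : Prop :=
  ∀ p : ℤ × ℤ, pt p ∈ convexHull ℝ (toPlane Q) → ∃ α ∈ Q, α.1 = p

/-- If every point of the support is marked, then every cell contains all lattice points of its
convex hull: the height of a marked point is at least the value of the affine interpolation of the
heights on any polygon containing it. -/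
lemma isLatticeConvex_cell (h𝒜 : IsPolygonSupport 𝒜) {u : 𝒜 → ℝ}
    (hu : ∀ α : 𝒜, ∃ Q ∈ subdivision u, α ∈ Q) (w : ℝ × ℝ) : IsLatticeConvex (cell u w) := by
  intro p hp
  have hpA : p ∈ 𝒜 := by
    refine h𝒜.2 p (convexHull_mono ?_ hp)
    rintro _ ⟨α, -, rfl⟩
    exact ⟨α.1, α.2, rfl⟩
  obtain ⟨β, hβ⟩ : (cell u w).Nonempty := by
    by_contra hne
    rw [Set.not_nonempty_iff_eq_empty] at hne
    simp [hne, toPlane] at hp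
  obtain ⟨Q, ⟨-, w', rfl⟩, hw'⟩ := hu ⟨p, hpA⟩
  refine ⟨⟨p, hpA⟩, ?_, rfl⟩
  set α : 𝒜 := ⟨p, hpA⟩ with hα
  let L : ℝ × ℝ →ₗ[ℝ] ℝ :=
    (w'.1 - w.1) • LinearMap.fst ℝ ℝ ℝ + (w'.2 - w.2) • LinearMap.snd ℝ ℝ ℝ
  have hsub : convexHull ℝ (toPlane (cell u w)) ⊆
      {x | L x ≤ monomialValue u w' α - monomialValue u w β} := by
    refine convexHull_min ?_ (convex_halfSpace_le L.isLinear _)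
    rintro _ ⟨γ, hγ, rfl⟩
    have h1 := hw' γ
    have h2 := hγ β
    simp only [Set.mem_ofPred_eq, L, pt, monomialValue, LinearMap.add_apply, LinearMap.smul_apply,
      LinearMap.fst_apply, LinearMap.snd_apply, smul_eq_mul] at h1 h2 ⊢
    linarith
  have h := hsub hp
  intro γ
  have h3 := hβ γ
  simp only [Set.mem_ofPred_eq, L, pt, monomialValue, LinearMap.add_apply, LinearMap.smul_apply,
    LinearMap.fst_apply, LinearMap.snd_apply, smul_eq_mul, hα] at h h3 ⊢
  linarith

namespace IsLatticeConvex

lemma exists_mem_of_orient {Q : Set 𝒜} (hQ : IsLatticeConvex Q) {x y z : 𝒜}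
    (hx : x ∈ Q) (hy : y ∈ Q) (hz : z ∈ Q) (hD : orient x.1 y.1 z.1 ≠ 0)
    (h1 : |orient x.1 y.1 z.1| ≠ 1) :
    ∃ p ∈ Q, p ≠ x ∧ p ≠ y ∧ p ≠ z ∧ 0 ≤ orient x.1 y.1 z.1 * orient p.1 y.1 z.1 ∧
      0 ≤ orient x.1 y.1 z.1 * orient x.1 p.1 z.1 ∧
      0 ≤ orient x.1 y.1 z.1 * orient x.1 y.1 p.1 := by
  obtain ⟨p, n1, n2, n3, h4, h5, h6⟩ := exists_lattice_point_of_orient hD h1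
  obtain ⟨α, hα, rfl⟩ := hQ p (mem_convexHull_of_orient ⟨x, hx, rfl⟩ ⟨y, hy, rfl⟩ ⟨z, hz, rfl⟩
    hD h4 h5 h6)
  exact ⟨α, hα, by rintro rfl; exact n1 rfl, by rintro rfl; exact n2 rfl,
    by rintro rfl; exact n3 rfl, h4, h5, h6⟩

lemma exists_mem_of_segment {Q : Set 𝒜} (hQ : IsLatticeConvex Q) {x y : 𝒜}
    (hx : x ∈ Q) (hy : y ∈ Q) {p : ℤ × ℤ} {r : ℝ} (hr0 : 0 ≤ r) (hr1 : r ≤ 1)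
    (h1 : (p.1 : ℝ) = x.1.1 + r * (y.1.1 - x.1.1))
    (h2 : (p.2 : ℝ) = x.1.2 + r * (y.1.2 - x.1.2)) : ∃ α ∈ Q, α.1 = p := by
  refine hQ p ?_
  have := (convex_convexHull ℝ (toPlane Q)) (subset_convexHull ℝ _ ⟨x, hx, rfl⟩)
    (subset_convexHull ℝ _ ⟨y, hy, rfl⟩) (sub_nonneg.mpr hr1) hr0 (by ring)
  convert this using 1
  simp only [pt, Prod.smul_mk, Prod.mk_add_mk, smul_eq_mul, Prod.ext_iff, h1, h2]
  constructor <;> ring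

lemma exists_mem_of_gcd_ne_one {Q : Set 𝒜} (hQ : IsLatticeConvex Q) {x y : 𝒜}
    (hx : x ∈ Q) (hy : y ∈ Q) (hxy : x ≠ y)
    (hg : Int.gcd (y.1.1 - x.1.1) (y.1.2 - x.1.2) ≠ 1) :
    ∃ p ∈ Q, ∃ k : ℤ, 2 ≤ k ∧ y.1.1 - x.1.1 = k * (p.1.1 - x.1.1) ∧
      y.1.2 - x.1.2 = k * (p.1.2 - x.1.2) := by
  set k := Int.gcd (y.1.1 - x.1.1) (y.1.2 - x.1.2) with hk
  have hk0 : k ≠ 0 := by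
    intro h0
    rw [hk, Int.gcd_eq_zero_iff] at h0
    exact hxy (Subtype.ext (Prod.ext (by omega) (by omega)))
  obtain ⟨i, hi⟩ : (k : ℤ) ∣ y.1.1 - x.1.1 := Int.gcd_dvd_left ..
  obtain ⟨j, hj⟩ : (k : ℤ) ∣ y.1.2 - x.1.2 := Int.gcd_dvd_right ..
  have hk' : (k : ℝ) ≠ 0 := by exact_mod_cast hk0
  have hi' : (y.1.1 : ℝ) - x.1.1 = k * i := by exact_mod_cast hi
  have hj' : (y.1.2 : ℝ) - x.1.2 = k * j := by exact_mod_cast hj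
  obtain ⟨p, hp, hpe⟩ := hQ.exists_mem_of_segment hx hy (p := (x.1.1 + i, x.1.2 + j))
    (r := 1 / (k : ℝ)) (by positivity)
    (by rw [div_le_one (by positivity)]; exact_mod_cast Nat.one_le_iff_ne_zero.mpr hk0)
    (by rw [hi']; push_cast; field_simp) (by rw [hj']; push_cast; field_simp)
  refine ⟨p, hp, k, by omega, ?_, ?_⟩
  · rw [hpe, hi]; ring
  · rw [hpe, hj]; ring

end IsLatticeConvex

/-! ### Faces of cells and edges at a vertex -/

/-- The value at `α` of the linear form `⟨·, d⟩`. -/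
def linearValue (d : ℝ × ℝ) (α : 𝒜) : ℝ := (α.1.1 : ℝ) * d.1 + (α.1.2 : ℝ) * d.2

/-- The face of `Q` on which the linear form `⟨·, d⟩` is maximal. -/
def face (Q : Set 𝒜) (d : ℝ × ℝ) : Set 𝒜 :=
  {α | α ∈ Q ∧ ∀ β ∈ Q, linearValue d β ≤ linearValue d α}

lemma monomialValue_add (u : 𝒜 → ℝ) (w d : ℝ × ℝ) (α : 𝒜) :
    monomialValue u (w + d) α = monomialValue u w α + linearValue d α := by
  simp only [monomialValue, linearValue, Prod.fst_add, Prod.snd_add]; ring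

lemma cell_eq_face {u : 𝒜 → ℝ} {w d : ℝ × ℝ} (hsub : cell u (w + d) ⊆ cell u w)
    (hne : (cell u (w + d)).Nonempty) : cell u (w + d) = face (cell u w) d := by
  obtain ⟨γ, hγ⟩ := hne
  ext α
  constructor
  · intro hα
    refine ⟨hsub hα, fun β hβ => ?_⟩
    have h1 := hα β
    have h2 := hβ α
    rw [monomialValue_add, monomialValue_add] at h1
    linarith
  · rintro ⟨hα, h⟩ β
    have h1 := hγ β
    have h2 := h γ (hsub hγ)
    have h3 := hα γ
    rw [monomialValue_add, monomialValue_add] at *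
    linarith

/-- Every face of a cell is a cell, attained at a nearby point. -/
lemma exists_cell_eq_face {u : 𝒜 → ℝ} {w : ℝ × ℝ} (hne : (cell u w).Nonempty) (d : ℝ × ℝ) :
    ∃ w', cell u w' = face (cell u w) d := by
  obtain ⟨γ, hγ⟩ := hne
  have hev : ∀ᶠ ε : ℝ in 𝓝[>] 0, ∀ β : 𝒜, β ∉ cell u w →
      monomialValue u w β + ε * linearValue d β < monomialValue u w γ + ε * linearValue d γ := by
    rw [Filter.eventually_all]
    intro β
    by_cases hβ : β ∈ cell u w
    · simp [hβ]
    · simp only [hβ, not_false_eq_true, forall_const]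
      have hlt : monomialValue u w β < monomialValue u w γ := by
        refine lt_of_not_ge fun hle => hβ fun δ => (hγ δ).trans hle
      have hc : Filter.Tendsto (fun ε : ℝ => monomialValue u w γ + ε * linearValue d γ -
          (monomialValue u w β + ε * linearValue d β)) (𝓝[>] 0)
          (𝓝 (monomialValue u w γ + 0 * linearValue d γ -
          (monomialValue u w β + 0 * linearValue d β))) :=
        (Continuous.tendsto (by fun_prop) 0).mono_left nhdsWithin_le_nhds
      filter_upwards [hc.eventually (lt_mem_nhds (show (0 : ℝ) < _ by linarith))] with ε hε
      linarith
  obtain ⟨ε, hε, hε0⟩ := (hev.and self_mem_nhdsWithin).exists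
  have hε0 : 0 < ε := hε0
  have hval : ∀ α : 𝒜, monomialValue u (w + ε • d) α =
      monomialValue u w α + ε * linearValue d α := by
    intro α
    simp only [monomialValue, linearValue, Prod.fst_add, Prod.snd_add, Prod.smul_fst,
      Prod.smul_snd, smul_eq_mul]; ring
  refine ⟨w + ε • d, ?_⟩
  ext α
  constructor
  · intro hα
    have hαQ : α ∈ cell u w := by
      by_contra hcon
      have h1 := hε α hcon
      have h2 := hα γ
      rw [hval, hval] at h2
      linarith
    refine ⟨hαQ, fun β hβ => ?_⟩
    have h1 := hα β
    have h2 := hβ α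
    rw [hval, hval] at h1
    exact le_of_mul_le_mul_left (by linarith) hε0
  · rintro ⟨hα, h⟩ β
    rw [hval, hval]
    by_cases hβ : β ∈ cell u w
    · have h1 := mul_le_mul_of_nonneg_left (h β hβ) hε0.le
      have h2 := hα β
      linarith
    · have h1 := hε β hβ
      have h2 := mul_le_mul_of_nonneg_left (h γ hγ) hε0.le
      have h3 := hα γ
      linarith

lemma mem_incidentEdges_iff {f : RealTropicalPolynomial 𝒜} {v : ℤˣ × ℤˣ} {w : ℝ × ℝ}
    {E : Set 𝒜} : E ∈ incidentEdges f v w ↔ E.Nontrivial ∧ Collinear ℝ (toPlane E) ∧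
      HasBothSigns f v E ∧ ∃ d, E = face (cell (modulus f) w) d := by
  constructor
  · rintro ⟨⟨h1, h2, ⟨w', rfl⟩, h4⟩, h5⟩
    refine ⟨h1, h2, h4, w' - w, ?_⟩
    have hw : w' = w + (w' - w) := by abel
    have := cell_eq_face (u := modulus f) (w := w) (d := w' - w)
    rw [← hw] at this
    exact this h5 h1.nonempty
  · rintro ⟨h1, h2, h3, d, rfl⟩
    obtain ⟨x, hx⟩ := h1.nonempty
    obtain ⟨w', hw'⟩ := exists_cell_eq_face ⟨x, hx.1⟩ d
    exact ⟨⟨h1, h2, ⟨w', hw'.symm⟩, h3⟩, fun y hy => hy.1⟩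

/-- If `Q` lies on one side of the line `xy`, then the points of `Q` on that line form a face. -/
lemma exists_face_eq_line {Q : Set 𝒜} {x y : 𝒜} (hx : x ∈ Q) (σ : ℤ) (hσ : σ ≠ 0)
    (h : ∀ z ∈ Q, 0 ≤ σ * orient x.1 y.1 z.1) :
    ∃ d, {z | z ∈ Q ∧ orient x.1 y.1 z.1 = 0} = face Q d := by
  refine ⟨(σ * (y.1.2 - x.1.2), -(σ * (y.1.1 - x.1.1))), ?_⟩
  set d : ℝ × ℝ := (σ * (y.1.2 - x.1.2), -(σ * (y.1.1 - x.1.1))) with hd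
  have hval : ∀ z : 𝒜, linearValue d z = linearValue d x - ((σ * orient x.1 y.1 z.1 : ℤ) : ℝ) := by
    intro z
    simp only [linearValue, hd, orient]; push_cast; ring
  have h' : ∀ z ∈ Q, (0 : ℝ) ≤ ((σ * orient x.1 y.1 z.1 : ℤ) : ℝ) := by
    intro z hz; exact_mod_cast h z hz
  ext z
  constructor
  · rintro ⟨hz, hz0⟩
    refine ⟨hz, fun β hβ => ?_⟩
    rw [hval z, hval β, hz0]
    have := h' β hβ
    simp only [mul_zero, Int.cast_zero]
    linarith
  · rintro ⟨hz, hmax⟩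
    refine ⟨hz, ?_⟩
    have h1 := hmax x hx
    have h2 := h' z hz
    rw [hval z] at h1
    have h3 : ((σ * orient x.1 y.1 z.1 : ℤ) : ℝ) = 0 := by linarith
    have h4 : σ * orient x.1 y.1 z.1 = 0 := by exact_mod_cast h3
    exact (mul_eq_zero.mp h4).resolve_left hσ

/-- If a positive combination of points of a face is a positive combination of two points of `Q`
with the same total weight, then these lie on the face, too. -/
lemma mem_face_of_combination {Q : Set 𝒜} {d : ℝ × ℝ} {x y z w : 𝒜} (hx : x ∈ face Q d)
    (hy : y ∈ face Q d) (hz : z ∈ Q) (hw : w ∈ Q) {i j k l : ℤ} (hk : 0 < k) (hl : 0 < l)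
    (h0 : i + j = k + l) (h1 : i * x.1.1 + j * y.1.1 = k * z.1.1 + l * w.1.1)
    (h2 : i * x.1.2 + j * y.1.2 = k * z.1.2 + l * w.1.2) : z ∈ face Q d := by
  refine ⟨hz, fun β hβ => (hx.2 β hβ).trans ?_⟩
  have e : linearValue d x = linearValue d y := le_antisymm (hy.2 x hx.1) (hx.2 y hy.1)
  have hwx := hx.2 w hw
  have h0' : (i : ℝ) + j = k + l := by exact_mod_cast h0
  have h1' : (i : ℝ) * x.1.1 + j * y.1.1 = k * z.1.1 + l * w.1.1 := by exact_mod_cast h1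
  have h2' : (i : ℝ) * x.1.2 + j * y.1.2 = k * z.1.2 + l * w.1.2 := by exact_mod_cast h2
  have hk' : (0 : ℝ) < k := by exact_mod_cast hk
  have hl' : (0 : ℝ) < l := by exact_mod_cast hl
  have hsum : (i : ℝ) * linearValue d x + j * linearValue d y =
      k * linearValue d z + l * linearValue d w := by
    simp only [linearValue]; linear_combination d.1 * h1' + d.2 * h2'
  rw [← e] at hsum
  have h3 : (k : ℝ) * linearValue d x ≤ k * linearValue d z := by
    have := mul_le_mul_of_nonneg_left hwx hl'.le
    have h4 : (i : ℝ) * linearValue d x + j * linearValue d x =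
      k * linearValue d x + l * linearValue d x := by linear_combination linearValue d x * h0'
    linarith
  exact le_of_mul_le_mul_left h3 hk'

lemma signAt_one (f : RealTropicalPolynomial 𝒜) (α : 𝒜) : signAt f (1, 1) α = (f α).1 := by
  simp [signAt]

/-! ### Valences of the vertices that occur -/

lemma hasBothSigns_one {f : RealTropicalPolynomial 𝒜} {Q : Set 𝒜} :
    HasBothSigns f (1, 1) Q ↔ ∃ α ∈ Q, ∃ β ∈ Q, (f α).1 ≠ (f β).1 := by
  simp only [HasBothSigns, signAt_one]

lemma not_collinear_toPlane {Q : Set 𝒜} {x y z : 𝒜} (hx : x ∈ Q) (hy : y ∈ Q) (hz : z ∈ Q)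
    (h : orient x.1 y.1 z.1 ≠ 0) : ¬ Collinear ℝ (toPlane Q) := by
  intro hcol
  have hxy : x ≠ y := by
    rintro rfl; exact h (by simp only [orient]; ring)
  exact h ((collinear_toPlane_iff hx hy hxy).mp hcol z hz)

lemma orient_self_mid (x y : ℤ × ℤ) : orient x y x = 0 := by simp only [orient]; ring
lemma orient_self_right (x y : ℤ × ℤ) : orient x y y = 0 := by simp only [orient]; ring
lemma orient_rotate (x y z : ℤ × ℤ) : orient y z x = orient x y z := by simp only [orient]; ring

/-- `b` is the midpoint of `a` and `c`. -/
def IsMid (a b c : ℤ × ℤ) : Prop := a.1 + c.1 = 2 * b.1 ∧ a.2 + c.2 = 2 * b.2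

lemma IsMid.symm {a b c : ℤ × ℤ} (h : IsMid a b c) : IsMid c b a :=
  ⟨by have := h.1; omega, by have := h.2; omega⟩

lemma IsMid.orient_swap {a b c : ℤ × ℤ} (h : IsMid a b c) (z : ℤ × ℤ) :
    orient c b z = -orient a b z := by
  have h1 : c.1 = 2 * b.1 - a.1 := by have := h.1; omega
  have h2 : c.2 = 2 * b.2 - a.2 := by have := h.2; omega
  simp only [orient, h1, h2]; ring

lemma IsMid.orient_eq_zero {a b c : ℤ × ℤ} (h : IsMid a b c) : orient a b c = 0 := by
  have h1 : c.1 = 2 * b.1 - a.1 := by have := h.1; omega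
  have h2 : c.2 = 2 * b.2 - a.2 := by have := h.2; omega
  simp only [orient, h1, h2]; ring

lemma IsMid.mem_face {Q : Set 𝒜} {d : ℝ × ℝ} {a b c : 𝒜} (h : IsMid a.1 b.1 c.1)
    (hb : b ∈ face Q d) (ha : a ∈ Q) (hc : c ∈ Q) : a ∈ face Q d :=
  mem_face_of_combination hb hb ha hc (i := 1) (j := 1) one_pos one_pos rfl
    (by have := h.1; omega) (by have := h.2; omega)

lemma IsMid.mid_mem_face {Q : Set 𝒜} {d : ℝ × ℝ} {a b c : 𝒜} (h : IsMid a.1 b.1 c.1)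
    (ha : a ∈ face Q d) (hc : c ∈ face Q d) (hb : b ∈ Q) : b ∈ face Q d :=
  mem_face_of_combination ha hc hb hb (i := 1) (j := 1) one_pos one_pos rfl
    (by have := h.1; omega) (by have := h.2; omega)

/-- Two points of opposite signs such that all other points of `Q` lie strictly on one side of the
line through them span a face of `Q` that gives an edge of the chart. -/
lemma pair_isEdge {f : RealTropicalPolynomial 𝒜} {Q : Set 𝒜} {x y : 𝒜} (hx : x ∈ Q) (hy : y ∈ Q)
    (hs : (f x).1 ≠ (f y).1) {σ : ℤ} (hσ : σ ≠ 0)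
    (h : ∀ z ∈ Q, z ≠ x → z ≠ y → 0 < σ * orient x.1 y.1 z.1) :
    ({x, y} : Set 𝒜).Nontrivial ∧ Collinear ℝ (toPlane ({x, y} : Set 𝒜)) ∧
      (∃ α ∈ ({x, y} : Set 𝒜), ∃ β ∈ ({x, y} : Set 𝒜), (f α).1 ≠ (f β).1) ∧
      ∃ d, {x, y} = face Q d := by
  have hxy : x ≠ y := by rintro rfl; exact hs rfl
  refine ⟨⟨x, by simp, y, by simp, hxy⟩, ?_, ⟨x, by simp, y, by simp, hs⟩, ?_⟩
  · rw [collinear_toPlane_iff (x := x) (y := y) (by simp) (by simp) hxy]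
    rintro z (rfl | rfl)
    exacts [orient_self_mid _ _, orient_self_right _ _]
  · obtain ⟨d, hd⟩ := exists_face_eq_line (y := y) hx σ hσ (fun z hz => by
      by_cases hzx : z = x
      · simp [hzx, orient_self_mid]
      by_cases hzy : z = y
      · simp [hzy, orient_self_right]
      exact (h z hz hzx hzy).le)
    refine ⟨d, hd ▸ ?_⟩
    ext z
    constructor
    · rintro (rfl | rfl)
      · exact ⟨hx, orient_self_mid _ _⟩
      · exact ⟨hy, orient_self_right _ _⟩
    · rintro ⟨hz, hz0⟩
      by_contra hcon
      simp only [Set.mem_insert_iff, Set.mem_singleton_iff, not_or] at hcon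
      have := h z hz hcon.1 hcon.2
      rw [hz0] at this
      simp at this

/-- The edges at a vertex dual to a triangle with base `abc` of lattice length two, the sign
changing at the midpoint `b`: the base, and the other two sides if the apex has the sign opposite to
that of `a` and `c`. -/
lemma incidentEdges_triangle {f : RealTropicalPolynomial 𝒜} {w : ℝ × ℝ} {a b c r : 𝒜}
    (hQ : cell (modulus f) w = {a, b, c, r}) (hmid : IsMid a.1 b.1 c.1)
    (hr : orient a.1 b.1 r.1 ≠ 0) (hac : (f a).1 = (f c).1) (hab : (f a).1 ≠ (f b).1)
    (E : Set 𝒜) : E ∈ incidentEdges f (1, 1) w ↔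
      E = {a, b, c} ∨ ((f r).1 ≠ (f a).1 ∧ (E = {a, r} ∨ E = {c, r})) := by
  rw [mem_incidentEdges_iff, hQ, hasBothSigns_one]
  have h1 : c.1.1 = 2 * b.1.1 - a.1.1 := by have := hmid.1; omega
  have h2 : c.1.2 = 2 * b.1.2 - a.1.2 := by have := hmid.2; omega
  have hne_ab : a ≠ b := by rintro rfl; exact hab rfl
  have hne_cb : c ≠ b := by rintro rfl; exact hab hac
  have hne_ac : a ≠ c := by
    rintro rfl
    exact hne_ab (Subtype.ext (Prod.ext (by omega) (by omega)))
  have hne_ra : r ≠ a := by rintro rfl; exact hr (orient_self_mid _ _)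
  have hne_rb : r ≠ b := by rintro rfl; exact hr (orient_self_right _ _)
  have hne_rc : r ≠ c := by rintro rfl; exact hr hmid.orient_eq_zero
  have oarb : orient a.1 r.1 b.1 = -orient a.1 b.1 r.1 := by simp only [orient]; ring
  have oarc : orient a.1 r.1 c.1 = -(2 * orient a.1 b.1 r.1) := by
    simp only [orient, h1, h2]; ring
  have ocrb : orient c.1 r.1 b.1 = orient a.1 b.1 r.1 := by
    simp only [orient, h1, h2]; ring
  have ocra : orient c.1 r.1 a.1 = 2 * orient a.1 b.1 r.1 := by
    simp only [orient, h1, h2]; ring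
  have hsq := mul_self_pos.mpr hr
  constructor
  · rintro ⟨hnt, hcol, hs, d, hd⟩
    have hEQ : ∀ x ∈ E, x = a ∨ x = b ∨ x = c ∨ x = r := by
      intro x hx; rw [hd] at hx; simpa using hx.1
    by_cases hb : b ∈ E
    · have ha : a ∈ E := by
        rw [hd] at hb ⊢; exact hmid.mem_face hb (by simp) (by simp)
      have hc : c ∈ E := by
        rw [hd] at hb ⊢; exact hmid.symm.mem_face hb (by simp) (by simp)
      have hr' : r ∉ E := fun h => not_collinear_toPlane ha hb h hr hcol
      left
      grind
    · have hac' : ¬ (a ∈ E ∧ c ∈ E) := by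
        rintro ⟨ha, hc⟩
        apply hb
        rw [hd] at ha hc ⊢
        exact hmid.mid_mem_face ha hc (by simp)
      obtain ⟨x, hx, y, hy, hxy⟩ := hs
      right
      grind
  · rintro (rfl | ⟨hs, rfl | rfl⟩)
    · refine ⟨⟨a, by simp, b, by simp, hne_ab⟩, ?_, ⟨a, by simp, b, by simp, hab⟩, ?_⟩
      · rw [collinear_toPlane_iff (x := a) (y := b) (by simp) (by simp) hne_ab]
        rintro z (rfl | rfl | rfl)
        exacts [orient_self_mid _ _, orient_self_right _ _, hmid.orient_eq_zero]
      · obtain ⟨d, hd⟩ := exists_face_eq_line (Q := {a, b, c, r}) (x := a) (y := b) (by simp)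
          (orient a.1 b.1 r.1) hr (by
            rintro z (rfl | rfl | rfl | rfl)
            · simp [orient_self_mid]
            · simp [orient_self_right]
            · simp [hmid.orient_eq_zero]
            · exact hsq.le)
        refine ⟨d, hd ▸ ?_⟩
        have := orient_self_mid a.1 b.1
        have := orient_self_right a.1 b.1
        have := hmid.orient_eq_zero
        ext z
        simp only [Set.mem_insert_iff, Set.mem_singleton_iff, Set.mem_ofPred_eq]
        grind
    · refine pair_isEdge (by simp) (by simp) hs.symm
        (σ := -orient a.1 b.1 r.1) (neg_ne_zero.mpr hr) ?_
      rintro z (rfl | rfl | rfl | rfl) h h'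
      · exact absurd rfl h
      · rw [oarb]; nlinarith
      · rw [oarc]; nlinarith
      · exact absurd rfl h'
    · refine pair_isEdge (by simp) (by simp) (hac ▸ hs.symm) (σ := orient a.1 b.1 r.1) hr ?_
      rintro z (rfl | rfl | rfl | rfl) h h'
      · rw [ocra]; nlinarith
      · rw [ocrb]; nlinarith
      · exact absurd rfl h
      · exact absurd rfl h'

/-- The edges at a vertex dual to a trapezoid with base `abc` of lattice length two and opposite
side `pq` parallel to it, the signs changing at `b` and between `p` and `q`: the two parallel sides
and the lateral side with end points of opposite signs. -/
lemma incidentEdges_trapezoid {f : RealTropicalPolynomial 𝒜} {w : ℝ × ℝ} {a b c p q : 𝒜}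
    (hQ : cell (modulus f) w = {a, b, c, p, q}) (hmid : IsMid a.1 b.1 c.1)
    (hp : orient a.1 b.1 p.1 ≠ 0) (hq1 : q.1.1 - p.1.1 = b.1.1 - a.1.1)
    (hq2 : q.1.2 - p.1.2 = b.1.2 - a.1.2) (hac : (f a).1 = (f c).1) (hab : (f a).1 ≠ (f b).1)
    (hpq : (f p).1 ≠ (f q).1) (hpa : (f p).1 ≠ (f a).1) (E : Set 𝒜) :
    E ∈ incidentEdges f (1, 1) w ↔ E = {a, b, c} ∨ E = {p, q} ∨ E = {a, p} := by
  rw [mem_incidentEdges_iff, hQ, hasBothSigns_one]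
  have h1 : c.1.1 = 2 * b.1.1 - a.1.1 := by have := hmid.1; omega
  have h2 : c.1.2 = 2 * b.1.2 - a.1.2 := by have := hmid.2; omega
  have hq1' : q.1.1 = p.1.1 + b.1.1 - a.1.1 := by omega
  have hq2' : q.1.2 = p.1.2 + b.1.2 - a.1.2 := by omega
  have hqa : (f q).1 = (f a).1 := by
    rcases Int.units_eq_one_or (f p).1 with h | h <;>
    rcases Int.units_eq_one_or (f q).1 with h' | h' <;>
    rcases Int.units_eq_one_or (f a).1 with h'' | h'' <;> simp_all
  have hne_ab : a ≠ b := by rintro rfl; exact hab rfl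
  have hne_cb : c ≠ b := by rintro rfl; exact hab hac
  have hne_pq : p ≠ q := by rintro rfl; exact hpq rfl
  have hne_pa : p ≠ a := by rintro rfl; exact hpa rfl
  have oq : orient a.1 b.1 q.1 = orient a.1 b.1 p.1 := by
    simp only [orient, hq1', hq2']; ring
  have hne_pb : p ≠ b := by rintro rfl; exact hp (orient_self_right _ _)
  have hne_pc : p ≠ c := by rintro rfl; exact hp hmid.orient_eq_zero
  have hne_qa : q ≠ a := by rintro rfl; exact hp (oq ▸ orient_self_mid _ _)
  have hne_qb : q ≠ b := by rintro rfl; exact hp (oq ▸ orient_self_right _ _)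
  have hne_qc : q ≠ c := by rintro rfl; exact hp (oq ▸ hmid.orient_eq_zero)
  have hsq := mul_self_pos.mpr hp
  constructor
  · rintro ⟨hnt, hcol, hs, d, hd⟩
    have hEQ : ∀ x ∈ E, x = a ∨ x = b ∨ x = c ∨ x = p ∨ x = q := by
      intro x hx; rw [hd] at hx; simpa using hx.1
    by_cases hb : b ∈ E
    · have ha : a ∈ E := by
        rw [hd] at hb ⊢; exact hmid.mem_face hb (by simp) (by simp)
      have hc : c ∈ E := by
        rw [hd] at hb ⊢; exact hmid.symm.mem_face hb (by simp) (by simp)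
      have hp' : p ∉ E := fun h => not_collinear_toPlane ha hb h hp hcol
      have hq' : q ∉ E := fun h => not_collinear_toPlane ha hb h (oq ▸ hp) hcol
      left
      grind
    · have hac' : ¬ (a ∈ E ∧ c ∈ E) := by
        rintro ⟨ha, hc⟩
        apply hb
        rw [hd] at ha hc ⊢
        exact hmid.mid_mem_face ha hc (by simp)
      have haq' : ¬ (a ∈ E ∧ q ∈ E) := by
        rintro ⟨ha, hc⟩
        apply hb
        rw [hd] at ha hc ⊢
        exact mem_face_of_combination ha hc (by simp) (w := p) (by simp) (i := 1) (j := 1)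
          one_pos one_pos rfl (by omega) (by omega)
      have hcp' : ¬ (c ∈ E ∧ p ∈ E) := by
        rintro ⟨ha, hc⟩
        apply hb
        rw [hd] at ha hc ⊢
        exact mem_face_of_combination ha hc (by simp) (w := q) (by simp) (i := 1) (j := 1)
          one_pos one_pos rfl (by omega) (by omega)
      obtain ⟨x, hx, y, hy, hxy⟩ := hs
      clear hd hcol hnt
      by_cases ha : a ∈ E
      · have hc : c ∉ E := fun h => hac' ⟨ha, h⟩
        have hq : q ∉ E := fun h => haq' ⟨ha, h⟩
        right; right
        grind
      · have hp' : p ∈ E := by grind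
        have hc : c ∉ E := fun h => hcp' ⟨h, hp'⟩
        right; left
        grind
  · rintro (rfl | rfl | rfl)
    · refine ⟨⟨a, by simp, b, by simp, hne_ab⟩, ?_, ⟨a, by simp, b, by simp, hab⟩, ?_⟩
      · rw [collinear_toPlane_iff (x := a) (y := b) (by simp) (by simp) hne_ab]
        rintro z (rfl | rfl | rfl)
        exacts [orient_self_mid _ _, orient_self_right _ _, hmid.orient_eq_zero]
      · obtain ⟨d, hd⟩ := exists_face_eq_line (Q := {a, b, c, p, q}) (x := a) (y := b) (by simp)
          (orient a.1 b.1 p.1) hp (by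
            rintro z (rfl | rfl | rfl | rfl | rfl)
            · simp [orient_self_mid]
            · simp [orient_self_right]
            · simp [hmid.orient_eq_zero]
            · exact hsq.le
            · rw [oq]; exact hsq.le)
        refine ⟨d, hd ▸ ?_⟩
        have := orient_self_mid a.1 b.1
        have := orient_self_right a.1 b.1
        have := hmid.orient_eq_zero
        ext z
        simp only [Set.mem_insert_iff, Set.mem_singleton_iff, Set.mem_ofPred_eq]
        grind
    · have oa : orient p.1 q.1 a.1 = -orient a.1 b.1 p.1 := by
        simp only [orient, hq1', hq2']; ring
      have ob : orient p.1 q.1 b.1 = -orient a.1 b.1 p.1 := by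
        simp only [orient, hq1', hq2']; ring
      have oc : orient p.1 q.1 c.1 = -orient a.1 b.1 p.1 := by
        simp only [orient, hq1', hq2', h1, h2]; ring
      refine pair_isEdge (by simp) (by simp) hpq (σ := -orient a.1 b.1 p.1) (neg_ne_zero.mpr hp) ?_
      rintro z (rfl | rfl | rfl | rfl | rfl) h h'
      · rw [oa]; nlinarith
      · rw [ob]; nlinarith
      · rw [oc]; nlinarith
      · exact absurd rfl h
      · exact absurd rfl h'
    · have ob : orient a.1 p.1 b.1 = -orient a.1 b.1 p.1 := by
        simp only [orient]; ring
      have oc : orient a.1 p.1 c.1 = -(2 * orient a.1 b.1 p.1) := by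
        simp only [orient, h1, h2]; ring
      have oq' : orient a.1 p.1 q.1 = -orient a.1 b.1 p.1 := by
        simp only [orient, hq1', hq2']; ring
      refine pair_isEdge (by simp) (by simp) hpa.symm
        (σ := -orient a.1 b.1 p.1) (neg_ne_zero.mpr hp) ?_
      rintro z (rfl | rfl | rfl | rfl | rfl) h h'
      · exact absurd rfl h
      · rw [ob]; nlinarith
      · rw [oc]; nlinarith
      · exact absurd rfl h'
      · rw [oq']; nlinarith

lemma isChartVertex_of_mem {f : RealTropicalPolynomial 𝒜} {w : ℝ × ℝ} {a b r : 𝒜}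
    (ha : a ∈ cell (modulus f) w) (hb : b ∈ cell (modulus f) w) (hr : r ∈ cell (modulus f) w)
    (hD : orient a.1 b.1 r.1 ≠ 0) (hab : (f a).1 ≠ (f b).1) : IsChartVertex f (1, 1) w :=
  ⟨not_collinear_toPlane ha hb hr hD, hasBothSigns_one.mpr ⟨a, ha, b, hb, hab⟩⟩

lemma valence_triangle {f : RealTropicalPolynomial 𝒜} {w : ℝ × ℝ} {a b c r : 𝒜}
    (hQ : cell (modulus f) w = {a, b, c, r}) (hmid : IsMid a.1 b.1 c.1)
    (hr : orient a.1 b.1 r.1 ≠ 0) (hac : (f a).1 = (f c).1) (hab : (f a).1 ≠ (f b).1) :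
    ((f r).1 = (f a).1 → IsChartVertexOfValence f (1, 1) w 1) ∧
      ((f r).1 ≠ (f a).1 → IsChartVertexOfValence f (1, 1) w 3) := by
  have hE := incidentEdges_triangle hQ hmid hr hac hab
  have hv : IsChartVertex f (1, 1) w := isChartVertex_of_mem (a := a) (b := b) (r := r)
    (by rw [hQ]; simp) (by rw [hQ]; simp) (by rw [hQ]; simp) hr hab
  refine ⟨fun h => ⟨hv, ?_⟩, fun h => ⟨hv, ?_⟩⟩
  · rw [Set.ncard_eq_one]
    refine ⟨{a, b, c}, ?_⟩
    ext E
    rw [hE]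
    simp [h]
  · have hne_rb : r ≠ b := by rintro rfl; exact hr (orient_self_right _ _)
    have hne_ab : a ≠ b := by rintro rfl; exact hab rfl
    have hne_cb : c ≠ b := by rintro rfl; exact hab hac
    have hne_ra : r ≠ a := by rintro rfl; exact hr (orient_self_mid _ _)
    have hne_ac : a ≠ c := by
      rintro rfl
      have := hmid.1
      have := hmid.2
      exact hne_ab (Subtype.ext (Prod.ext (by omega) (by omega)))
    have hbmem : b ∈ ({a, b, c} : Set 𝒜) := by simp
    rw [Set.ncard_eq_three]
    refine ⟨{a, b, c}, {a, r}, {c, r}, ?_, ?_, ?_, ?_⟩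
    · intro he
      rw [he] at hbmem
      simp [hne_ab.symm, hne_rb.symm] at hbmem
    · intro he
      rw [he] at hbmem
      simp [hne_cb.symm, hne_rb.symm] at hbmem
    · intro he
      have : a ∈ ({a, r} : Set 𝒜) := by simp
      rw [he] at this
      simp [hne_ac, hne_ra.symm] at this
    · ext E
      rw [hE]
      simp [h]

lemma valence_trapezoid {f : RealTropicalPolynomial 𝒜} {w : ℝ × ℝ} {a b c p q : 𝒜}
    (hQ : cell (modulus f) w = {a, b, c, p, q}) (hmid : IsMid a.1 b.1 c.1)
    (hp : orient a.1 b.1 p.1 ≠ 0) (hq1 : q.1.1 - p.1.1 = b.1.1 - a.1.1)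
    (hq2 : q.1.2 - p.1.2 = b.1.2 - a.1.2) (hac : (f a).1 = (f c).1) (hab : (f a).1 ≠ (f b).1)
    (hpq : (f p).1 ≠ (f q).1) : IsChartVertexOfValence f (1, 1) w 3 := by
  -- up to exchanging the two lateral sides, the end points of `ap` have opposite signs
  wlog hpa : (f p).1 ≠ (f a).1 generalizing a c p q
  · have h1 : c.1.1 = 2 * b.1.1 - a.1.1 := by have := hmid.1; omega
    have h2 : c.1.2 = 2 * b.1.2 - a.1.2 := by have := hmid.2; omega
    push Not at hpa
    refine this (a := c) (c := a) (p := q) (q := p) ?_ hmid.symm ?_ (by omega) (by omega) hac.symm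
      (hac ▸ hab) hpq.symm (by rw [← hac, ← hpa]; exact hpq.symm)
    · rw [hQ]; ext z; simp only [Set.mem_insert_iff, Set.mem_singleton_iff]; tauto
    · rw [hmid.orient_swap]
      have hq1' : q.1.1 = p.1.1 + b.1.1 - a.1.1 := by omega
      have hq2' : q.1.2 = p.1.2 + b.1.2 - a.1.2 := by omega
      have oq : orient a.1 b.1 q.1 = orient a.1 b.1 p.1 := by
        simp only [orient, hq1', hq2']; ring
      rw [oq]
      exact neg_ne_zero.mpr hp
  have hE := incidentEdges_trapezoid hQ hmid hp hq1 hq2 hac hab hpq hpa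
  have hv : IsChartVertex f (1, 1) w := isChartVertex_of_mem (a := a) (b := b) (r := p)
    (by rw [hQ]; simp) (by rw [hQ]; simp) (by rw [hQ]; simp) hp hab
  refine ⟨hv, ?_⟩
  have hne_ab : a ≠ b := by rintro rfl; exact hab rfl
  have hne_pb : p ≠ b := by rintro rfl; exact hp (orient_self_right _ _)
  have hne_pa : p ≠ a := by rintro rfl; exact hp (orient_self_mid _ _)
  have hne_qb : q ≠ b := by
    rintro rfl
    exact hne_pa (Subtype.ext (Prod.ext (by omega) (by omega)))
  have hne_qa : q ≠ a := by
    rintro rfl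
    refine hp ?_
    have h1 : p.1.1 = 2 * q.1.1 - b.1.1 := by omega
    have h2 : p.1.2 = 2 * q.1.2 - b.1.2 := by omega
    simp only [orient, h1, h2]; ring
  have hbmem : b ∈ ({a, b, c} : Set 𝒜) := by simp
  rw [Set.ncard_eq_three]
  refine ⟨{a, b, c}, {p, q}, {a, p}, ?_, ?_, ?_, ?_⟩
  · intro he
    rw [he] at hbmem
    simp [hne_pb.symm, hne_qb.symm] at hbmem
  · intro he
    rw [he] at hbmem
    simp [hne_ab.symm, hne_pb.symm] at hbmem
  · intro he
    have : a ∈ ({a, p} : Set 𝒜) := by simp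
    rw [← he] at this
    simp [hne_pa.symm, hne_qa.symm] at this
  · ext E
    rw [hE]
    simp

/-! ### The initial form of the constant function -/

/-- No integral affine function, multiplied by the signs of `f`, is nonnegative and not identically
zero on `U`. -/
def IsSignBalanced (f : RealTropicalPolynomial 𝒜) (U : Set 𝒜) : Prop :=
  ∀ i j k : ℤ, (∃ α ∈ U, i + j * α.1.1 + k * α.1.2 ≠ 0) →
    ∃ α ∈ U, ∃ β ∈ U, 0 < ((f α).1 : ℤ) * (i + j * α.1.1 + k * α.1.2) ∧
      ((f β).1 : ℤ) * (i + j * β.1.1 + k * β.1.2) < 0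

lemma mem_cell_zero {u : 𝒜 → ℝ} {α : 𝒜} : α ∈ cell u 0 ↔ ∀ β, u β ≤ u α := by
  simp [cell, monomialValue]

lemma IsSingularAtZeroPlus.isSignBalanced {f : RealTropicalPolynomial 𝒜}
    (hf : IsSingularAtZeroPlus f) : IsSignBalanced f (cell (modulus f) 0) := by
  rintro i j k ⟨γ, hγ, hne⟩
  rw [mem_cell_zero] at hγ
  have hval : ∀ α : 𝒜, affineValue ((i : ℝ), (j : ℝ), (k : ℝ)) α =
      ((i + j * α.1.1 + k * α.1.2 : ℤ) : ℝ) := by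
    intro α; simp [affineValue]
  have hγne : affineValue ((i : ℝ), (j : ℝ), (k : ℝ)) γ ≠ 0 := by
    rw [hval]; exact_mod_cast hne
  obtain ⟨α, β, h1, h2, h3, h4⟩ := hf.initialFormChangesSign ((i : ℝ), (j : ℝ), (k : ℝ)) ⟨γ, hγne⟩
  rw [hval] at h1 h2
  refine ⟨α, mem_cell_zero.mpr fun δ => (hγ δ).trans (h3 γ hγne), β,
    mem_cell_zero.mpr fun δ => (hγ δ).trans (h4 γ hγne), ?_, ?_⟩
  · exact_mod_cast h1
  · exact_mod_cast h2

lemma IsSignBalanced.orient {f : RealTropicalPolynomial 𝒜} {U : Set 𝒜} (h : IsSignBalanced f U)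
    (x y : ℤ × ℤ) (hne : ∃ α ∈ U, orient x y α.1 ≠ 0) :
    ∃ α ∈ U, ∃ β ∈ U, 0 < ((f α).1 : ℤ) * RealTrop.orient x y α.1 ∧
      ((f β).1 : ℤ) * RealTrop.orient x y β.1 < 0 := by
  have hval : ∀ α : 𝒜, (y.2 - x.2) * x.1 - (y.1 - x.1) * x.2 + (-(y.2 - x.2)) * α.1.1 +
      (y.1 - x.1) * α.1.2 = RealTrop.orient x y α.1 := by
    intro α; simp only [RealTrop.orient]; ring
  have := h ((y.2 - x.2) * x.1 - (y.1 - x.1) * x.2) (-(y.2 - x.2)) (y.1 - x.1)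
  simp only [hval] at this
  exact this hne

lemma IsSignBalanced.exists_ne {f : RealTropicalPolynomial 𝒜} {U : Set 𝒜}
    (h : IsSignBalanced f U) (hU : U.Nonempty) : ∃ x ∈ U, ∃ y ∈ U, (f x).1 ≠ (f y).1 := by
  obtain ⟨γ, hγ⟩ := hU
  obtain ⟨α, hα, β, hβ, h1, h2⟩ := h 1 0 0 ⟨γ, hγ, by simp⟩
  refine ⟨α, hα, β, hβ, fun he => ?_⟩
  rw [he] at h1
  simp only [zero_mul, add_zero, mul_one] at h1 h2
  omega

/-- A point of `U` cannot be the only one off a line. -/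
lemma IsSignBalanced.orient_eq_zero {f : RealTropicalPolynomial 𝒜} {U : Set 𝒜}
    (h : IsSignBalanced f U) {x y z : 𝒜} (hz : z ∈ U)
    (hU : ∀ w ∈ U, w ≠ z → RealTrop.orient x.1 y.1 w.1 = 0) :
    RealTrop.orient x.1 y.1 z.1 = 0 := by
  by_contra hne
  obtain ⟨α, hα, β, hβ, h1, h2⟩ := h.orient x.1 y.1 ⟨z, hz, hne⟩
  have hαz : α = z := by
    by_contra hc; rw [hU α hα hc] at h1; simp at h1
  have hβz : β = z := by
    by_contra hc; rw [hU β hβ hc] at h2; simp at h2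
  rw [hαz] at h1; rw [hβz] at h2
  omega

/-- If all points of `U` but two lie on a line, then these two contribute with opposite signs to the
initial form of the affine function vanishing on the line. -/
lemma IsSignBalanced.mul_neg {f : RealTropicalPolynomial 𝒜} {U : Set 𝒜}
    (h : IsSignBalanced f U) {x y z w : 𝒜} (hz : z ∈ U)
    (hU : ∀ v ∈ U, v = x ∨ v = y ∨ v = z ∨ v = w)
    (hne : RealTrop.orient x.1 y.1 z.1 ≠ 0) :
    (((f z).1 : ℤ) * RealTrop.orient x.1 y.1 z.1) *
      (((f w).1 : ℤ) * RealTrop.orient x.1 y.1 w.1) < 0 := by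
  obtain ⟨α, hα, β, hβ, h1, h2⟩ := h.orient x.1 y.1 ⟨z, hz, hne⟩
  have hx := orient_self_mid x.1 y.1
  have hy := orient_self_right x.1 y.1
  rcases hU α hα with rfl | rfl | rfl | rfl <;> rcases hU β hβ with rfl | rfl | rfl | rfl <;>
    try simp only [hx, hy, mul_zero, lt_irrefl] at h1 h2
  · omega
  · exact mul_neg_of_pos_of_neg h1 h2
  · exact mul_neg_of_neg_of_pos h2 h1
  · omega

lemma int_units_mul_self (s : ℤˣ) : (s : ℤ) * s = 1 := by
  rw [← Units.val_mul, Int.units_mul_self]; rfl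

/-- Four balanced points in general position satisfy an affine dependence whose signs are those of
`f`: both are determined by the positions of the points with respect to the lines spanned by
them. -/
lemma IsSignBalanced.exists_dependence {f : RealTropicalPolynomial 𝒜} {x y z w : 𝒜}
    (h : IsSignBalanced f {x, y, z, w}) (hxyz : RealTrop.orient x.1 y.1 z.1 ≠ 0) :
    ∃ i j k l : ℤ, 0 < i ∧ 0 < j ∧ 0 < k ∧ 0 < l ∧
      (f x).1 * i + (f y).1 * j + (f z).1 * k + (f w).1 * l = 0 ∧
      (f x).1 * i * x.1.1 + (f y).1 * j * y.1.1 + (f z).1 * k * z.1.1 + (f w).1 * l * w.1.1 = 0 ∧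
      (f x).1 * i * x.1.2 + (f y).1 * j * y.1.2 + (f z).1 * k * z.1.2 +
        (f w).1 * l * w.1.2 = 0 := by
  have e1 := h.mul_neg (x := x) (y := y) (z := z) (w := w) (by simp) (by simp) hxyz
  have e2 := h.mul_neg (x := y) (y := z) (z := x) (w := w) (by simp)
    (by simp only [Set.mem_insert_iff, Set.mem_singleton_iff]; tauto) (by rwa [orient_rotate])
  have e3 := h.mul_neg (x := z) (y := x) (z := y) (w := w) (by simp)
    (by simp only [Set.mem_insert_iff, Set.mem_singleton_iff]; tauto)
    (by rwa [orient_rotate, orient_rotate])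
  rw [orient_rotate] at e2
  rw [orient_rotate, orient_rotate] at e3
  set D := RealTrop.orient x.1 y.1 z.1 with hD
  set t : ℤ := (f w).1 * D with ht
  refine ⟨-(t * ((f x).1 * RealTrop.orient y.1 z.1 w.1)),
    -(t * ((f y).1 * RealTrop.orient z.1 x.1 w.1)),
    -(t * ((f z).1 * RealTrop.orient x.1 y.1 w.1)), t * ((f w).1 * D), ?_, ?_, ?_, ?_, ?_, ?_, ?_⟩
  · rw [ht]; linarith
  · rw [ht]; linarith
  · rw [ht]; linarith
  · rw [ht]
    have : (f w).1 * D * ((f w).1 * D) = ((f w).1 * (f w).1 : ℤ) * (D * D) := by ring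
    rw [this, int_units_mul_self, one_mul]
    exact mul_self_pos.mpr hxyz
  all_goals
    have sx := int_units_mul_self (f x).1
    have sy := int_units_mul_self (f y).1
    have sz := int_units_mul_self (f z).1
    have sw := int_units_mul_self (f w).1
  · have key : -RealTrop.orient y.1 z.1 w.1 - RealTrop.orient z.1 x.1 w.1 -
        RealTrop.orient x.1 y.1 w.1 + D = 0 := by
      rw [hD]; simp only [RealTrop.orient]; ring
    linear_combination (-t * RealTrop.orient y.1 z.1 w.1) * sx -
      t * RealTrop.orient z.1 x.1 w.1 * sy - t * RealTrop.orient x.1 y.1 w.1 * sz + t * D * sw +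
      t * key
  · have key : -RealTrop.orient y.1 z.1 w.1 * x.1.1 - RealTrop.orient z.1 x.1 w.1 * y.1.1 -
        RealTrop.orient x.1 y.1 w.1 * z.1.1 + D * w.1.1 = 0 := by
      rw [hD]; simp only [RealTrop.orient]; ring
    linear_combination (-t * RealTrop.orient y.1 z.1 w.1) * x.1.1 * sx -
      t * RealTrop.orient z.1 x.1 w.1 * y.1.1 * sy -
      t * RealTrop.orient x.1 y.1 w.1 * z.1.1 * sz + t * D * w.1.1 * sw + t * key
  · have key : -RealTrop.orient y.1 z.1 w.1 * x.1.2 - RealTrop.orient z.1 x.1 w.1 * y.1.2 -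
        RealTrop.orient x.1 y.1 w.1 * z.1.2 + D * w.1.2 = 0 := by
      rw [hD]; simp only [RealTrop.orient]; ring
    linear_combination (-t * RealTrop.orient y.1 z.1 w.1) * x.1.2 * sx -
      t * RealTrop.orient z.1 x.1 w.1 * y.1.2 * sy -
      t * RealTrop.orient x.1 y.1 w.1 * z.1.2 * sz + t * D * w.1.2 * sw + t * key

/-! ### Four monomials attaining the maximum at the origin -/

lemma hasWeight_one_pair {Q : Set 𝒜} (hQ : IsLatticeConvex Q) {x y : 𝒜} (hx : x ∈ Q) (hy : y ∈ Q)
    (hxy : x ≠ y) (h : ∀ z ∈ Q, z ≠ x → z ≠ y → orient x.1 y.1 z.1 ≠ 0) :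
    HasWeight ({x, y} : Set 𝒜) 1 := by
  refine ⟨x, by simp, y, by simp, ?_, ?_⟩
  · rw [toPlane, Set.image_pair, convexHull_pair]
  · by_contra hg
    obtain ⟨p, hp, k, hk, h1, h2⟩ := hQ.exists_mem_of_gcd_ne_one hx hy hxy hg
    refine h p hp ?_ ?_ ?_
    · rintro rfl
      exact hxy (Subtype.ext (Prod.ext (by simp at h1; omega) (by simp at h2; omega)))
    · rintro rfl
      refine hxy (Subtype.ext (Prod.ext ?_ ?_))
      · have : (k - 1) * (p.1.1 - x.1.1) = 0 := by linear_combination -h1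
        have := (mul_eq_zero.mp this).resolve_left (by omega)
        omega
      · have : (k - 1) * (p.1.2 - x.1.2) = 0 := by linear_combination -h2
        have := (mul_eq_zero.mp this).resolve_left (by omega)
        omega
    · simp only [orient, h1, h2]; ring

/-- The diagonals of a quadrilateral with alternating signs cross, so exactly its four sides give
edges of the chart. -/
lemma four_valent_of_dependence {f : RealTropicalPolynomial 𝒜} {w : ℝ × ℝ} {a b c d : 𝒜}
    (hQ : cell (modulus f) w = {a, b, c, d}) (hlat : IsLatticeConvex (cell (modulus f) w))
    (hac : (f a).1 = (f c).1) (hbd : (f b).1 = (f d).1) (hab : (f a).1 ≠ (f b).1) {i j k l : ℤ}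
    (hi : 0 < i) (hj : 0 < j) (hk : 0 < k) (hl : 0 < l) (h0 : i + j = k + l)
    (h1 : i * a.1.1 + j * c.1.1 = k * b.1.1 + l * d.1.1)
    (h2 : i * a.1.2 + j * c.1.2 = k * b.1.2 + l * d.1.2)
    (hne : orient a.1 b.1 c.1 ≠ 0) :
    IsChartVertexOfValence f (1, 1) w 4 ∧ ∀ E ∈ incidentEdges f (1, 1) w, HasWeight E 1 := by
  -- the four triangles have the same orientation
  have o1 : l * orient a.1 b.1 d.1 = j * orient a.1 b.1 c.1 := by
    simp only [orient]
    linear_combination (b.1.2 - a.1.2) * h1 - (b.1.1 - a.1.1) * h2 +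
      (a.1.2 * b.1.1 - a.1.1 * b.1.2) * h0
  have o2 : l * orient b.1 c.1 d.1 = i * orient a.1 b.1 c.1 := by
    simp only [orient]
    linear_combination (c.1.2 - b.1.2) * h1 - (c.1.1 - b.1.1) * h2 +
      (b.1.2 * c.1.1 - b.1.1 * c.1.2) * h0
  have o3 : l * orient c.1 d.1 a.1 = k * orient a.1 b.1 c.1 := by
    simp only [orient]
    linear_combination -(a.1.2 - c.1.2) * h1 + (a.1.1 - c.1.1) * h2 -
      (c.1.2 * a.1.1 - c.1.1 * a.1.2) * h0
  set σ := orient a.1 b.1 c.1 with hσ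
  have hpos : ∀ x y z : ℤ × ℤ, ∀ n : ℤ, 0 < n → l * orient x y z = n * σ →
      0 < σ * orient x y z := by
    intro x y z n hn h
    have : l * (σ * orient x y z) = n * (σ * σ) := by linear_combination σ * h
    have h3 : 0 < l * (σ * orient x y z) := by
      rw [this]; exact mul_pos hn (mul_self_pos.mpr hne)
    exact pos_of_mul_pos_right h3 hl.le
  have pabc : 0 < σ * orient a.1 b.1 c.1 := mul_self_pos.mpr hne
  have pabd := hpos _ _ _ j hj o1
  have pbcd := hpos _ _ _ i hi o2
  have pcda := hpos _ _ _ k hk o3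
  have pbca : 0 < σ * orient b.1 c.1 a.1 := by rwa [orient_rotate]
  have pcdb : 0 < σ * orient c.1 d.1 b.1 := by rwa [orient_rotate]
  have pdac : 0 < σ * orient d.1 a.1 c.1 := by rwa [orient_rotate]
  have pdab : 0 < σ * orient d.1 a.1 b.1 := by rwa [← orient_rotate]
  have hne_ab : a ≠ b := by rintro rfl; exact hab rfl
  have hne_cb : c ≠ b := by rintro rfl; exact hab hac
  have hne_cd : c ≠ d := by rintro rfl; exact hab (hac.trans hbd.symm)
  have hne_da : d ≠ a := by rintro rfl; exact hab hbd.symm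
  have hne_ac : a ≠ c := by rintro rfl; exact hne (orient_self_mid _ _)
  have hne_bd : b ≠ d := by
    rintro rfl; rw [orient_self_right] at pabd; simp at pabd
  have hcd : (f c).1 ≠ (f d).1 := by rw [← hac, ← hbd]; exact hab
  have hcb : (f b).1 ≠ (f c).1 := by rw [← hac]; exact hab.symm
  have hda : (f d).1 ≠ (f a).1 := by rw [← hbd]; exact hab.symm
  have sab : ∀ z ∈ ({a, b, c, d} : Set 𝒜), z ≠ a → z ≠ b → 0 < σ * orient a.1 b.1 z.1 := by
    rintro z (rfl | rfl | rfl | rfl) h h'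
    exacts [absurd rfl h, absurd rfl h', pabc, pabd]
  have sbc : ∀ z ∈ ({a, b, c, d} : Set 𝒜), z ≠ b → z ≠ c → 0 < σ * orient b.1 c.1 z.1 := by
    rintro z (rfl | rfl | rfl | rfl) h h'
    exacts [pbca, absurd rfl h, absurd rfl h', pbcd]
  have scd : ∀ z ∈ ({a, b, c, d} : Set 𝒜), z ≠ c → z ≠ d → 0 < σ * orient c.1 d.1 z.1 := by
    rintro z (rfl | rfl | rfl | rfl) h h'
    exacts [pcda, pcdb, absurd rfl h, absurd rfl h']
  have sda : ∀ z ∈ ({a, b, c, d} : Set 𝒜), z ≠ d → z ≠ a → 0 < σ * orient d.1 a.1 z.1 := by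
    rintro z (rfl | rfl | rfl | rfl) h h'
    exacts [absurd rfl h', pdab, pdac, absurd rfl h]
  have hE : ∀ E, E ∈ incidentEdges f (1, 1) w ↔
      E = {a, b} ∨ E = {b, c} ∨ E = {c, d} ∨ E = {d, a} := by
    intro E
    rw [mem_incidentEdges_iff, hQ, hasBothSigns_one]
    constructor
    · rintro ⟨hnt, hcol, hs, e, he⟩
      have hEQ : ∀ x ∈ E, x = a ∨ x = b ∨ x = c ∨ x = d := by
        intro x hx; rw [he] at hx; simpa using hx.1
      have hac' : ¬ (a ∈ E ∧ c ∈ E) := by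
        rintro ⟨ha, hc⟩
        have hb : b ∈ E := by
          rw [he] at ha hc ⊢
          exact mem_face_of_combination ha hc (by simp) (w := d) (by simp) hk hl h0 h1 h2
        exact not_collinear_toPlane ha hb hc hne hcol
      have hbd' : ¬ (b ∈ E ∧ d ∈ E) := by
        rintro ⟨hb, hd⟩
        have ha : a ∈ E := by
          rw [he] at hb hd ⊢
          exact mem_face_of_combination hb hd (by simp) (w := c) (by simp) hi hj h0.symm h1.symm
            h2.symm
        refine not_collinear_toPlane ha hb hd ?_ hcol
        intro h
        rw [h] at pabd
        simp at pabd
      obtain ⟨x, hx, y, hy, hxy⟩ := hs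
      clear he hcol hnt
      by_cases ha : a ∈ E
      · have hc : c ∉ E := fun h => hac' ⟨ha, h⟩
        by_cases hb : b ∈ E
        · have hd : d ∉ E := fun h => hbd' ⟨hb, h⟩
          left
          grind
        · right; right; right
          grind
      · by_cases hb : b ∈ E
        · have hd : d ∉ E := fun h => hbd' ⟨hb, h⟩
          right; left
          grind
        · right; right; left
          grind
    · rintro (rfl | rfl | rfl | rfl)
      · exact pair_isEdge (by simp) (by simp) hab hne sab
      · exact pair_isEdge (by simp) (by simp) hcb hne sbc
      · exact pair_isEdge (by simp) (by simp) hcd hne scd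
      · exact pair_isEdge (by simp) (by simp) hda hne sda
  refine ⟨⟨isChartVertex_of_mem (a := a) (b := b) (r := c) (by rw [hQ]; simp) (by rw [hQ]; simp)
    (by rw [hQ]; simp) hne hab, ?_⟩, ?_⟩
  · have : incidentEdges f (1, 1) w =
        insert {a, b} (insert {b, c} (insert {c, d} {({d, a} : Set 𝒜)})) := by
      ext E; rw [hE]; simp
    rw [this, Set.ncard_insert_of_notMem, Set.ncard_insert_of_notMem, Set.ncard_insert_of_notMem,
      Set.ncard_singleton]
    · intro h
      have hm : c ∈ ({c, d} : Set 𝒜) := by simp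
      rw [Set.mem_singleton_iff.mp h] at hm
      simp [hne_cd, hne_ac.symm] at hm
    · intro h
      have hm : b ∈ ({b, c} : Set 𝒜) := by simp
      rcases h with h | h
      · rw [h] at hm; simp [hne_cb.symm, hne_bd] at hm
      · rw [Set.mem_singleton_iff.mp h] at hm; simp [hne_ab.symm, hne_bd] at hm
    · intro h
      have hm : a ∈ ({a, b} : Set 𝒜) := by simp
      have hm' : b ∈ ({a, b} : Set 𝒜) := by simp
      rcases h with h | h | h
      · rw [h] at hm; simp [hne_ab, hne_ac] at hm
      · rw [h] at hm; simp [hne_da.symm, hne_ac] at hm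
      · rw [Set.mem_singleton_iff.mp h] at hm'; simp [hne_ab.symm, hne_bd] at hm'
  · intro E hEm
    rw [← hQ] at sab sbc scd sda
    have nz : ∀ {n : ℤ}, 0 < σ * n → n ≠ 0 := by
      rintro n hn rfl; simp at hn
    rcases (hE E).mp hEm with rfl | rfl | rfl | rfl
    · exact hasWeight_one_pair hlat (by rw [hQ]; simp) (by rw [hQ]; simp) hne_ab
        fun z hz h h' => nz (sab z hz h h')
    · exact hasWeight_one_pair hlat (by rw [hQ]; simp) (by rw [hQ]; simp) hne_cb.symm
        fun z hz h h' => nz (sbc z hz h h')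
    · exact hasWeight_one_pair hlat (by rw [hQ]; simp) (by rw [hQ]; simp) hne_cd
        fun z hz h h' => nz (scd z hz h h')
    · exact hasWeight_one_pair hlat (by rw [hQ]; simp) (by rw [hQ]; simp) hne_da
        fun z hz h h' => nz (sda z hz h h')

/-- A triangle whose only further lattice point is an interior point `d` is the union of three
empty, hence unimodular, triangles with vertex `d`. -/
lemma triangle_multiplicity_three {u : 𝒜 → ℝ} {w : ℝ × ℝ} {a b c d : 𝒜}
    (hQ : cell u w = {a, b, c, d}) (hlat : IsLatticeConvex (cell u w)) {i j k : ℤ}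
    (hi : 0 < i) (hj : 0 < j) (hk : 0 < k)
    (h1 : i * a.1.1 + j * b.1.1 + k * c.1.1 = (i + j + k) * d.1.1)
    (h2 : i * a.1.2 + j * b.1.2 + k * c.1.2 = (i + j + k) * d.1.2)
    (hne : orient a.1 b.1 c.1 ≠ 0) : HasTriangleMultiplicity u w 3 := by
  have ha : a ∈ cell u w := by rw [hQ]; simp
  have hb : b ∈ cell u w := by rw [hQ]; simp
  have hc : c ∈ cell u w := by rw [hQ]; simp
  have hd : d ∈ cell u w := by rw [hQ]; simp
  -- if `z` is the vertex opposite to the side `xy`, then the triangle `xyd` is empty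
  have hunit : ∀ x ∈ cell u w, ∀ y ∈ cell u w, ∀ z : 𝒜, ∀ l m n : ℤ, 0 < l → 0 < n →
      cell u w = {x, y, z, d} → orient x.1 y.1 z.1 ≠ 0 →
      l * x.1.1 + m * y.1.1 + n * z.1.1 = (l + m + n) * d.1.1 →
      l * x.1.2 + m * y.1.2 + n * z.1.2 = (l + m + n) * d.1.2 → 0 < l + m + n →
      |orient x.1 y.1 d.1| = 1 ∧ (l + m + n) * orient x.1 y.1 d.1 = n * orient x.1 y.1 z.1 := by
    intro x hx y hy z l m n hl hn hset hxyz e1 e2 hpos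
    have hrel : (l + m + n) * orient x.1 y.1 d.1 = n * orient x.1 y.1 z.1 := by
      simp only [orient]
      linear_combination (y.1.2 - x.1.2) * e1 - (y.1.1 - x.1.1) * e2
    refine ⟨?_, hrel⟩
    have hD : orient x.1 y.1 d.1 ≠ 0 := by
      intro h
      rw [h, mul_zero] at hrel
      exact hxyz ((mul_eq_zero.mp hrel.symm).resolve_left hn.ne')
    by_contra h1
    obtain ⟨p, hp, n1, n2, n3, h4, -, -⟩ := hlat.exists_mem_of_orient hx hy hd hD h1
    have hpz : p = z := by
      rw [hset] at hp
      rcases hp with h | h | h | h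
      exacts [absurd h n1, absurd h n2, h, absurd h n3]
    rw [hpz] at h4
    have hz : n * orient z.1 y.1 d.1 = -(l * orient x.1 y.1 d.1) := by
      simp only [orient]
      linear_combination -(d.1.2 - y.1.2) * e1 + (d.1.1 - y.1.1) * e2
    have h5 : n * (orient x.1 y.1 d.1 * orient z.1 y.1 d.1) =
        -(l * (orient x.1 y.1 d.1 * orient x.1 y.1 d.1)) := by
      linear_combination orient x.1 y.1 d.1 * hz
    have h6 := mul_pos hl (mul_self_pos.mpr hD)
    have h7 := mul_nonneg hn.le h4
    omega
  obtain ⟨u1, r1⟩ := hunit a ha b hb c i j k hi hk hQ hne h1 h2 (by omega)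
  obtain ⟨u2, r2⟩ := hunit b hb c hc a j k i hj hi
    (by rw [hQ]; ext z; simp only [Set.mem_insert_iff, Set.mem_singleton_iff]; tauto)
    (by rwa [orient_rotate]) (by linear_combination h1) (by linear_combination h2) (by omega)
  obtain ⟨u3, r3⟩ := hunit c hc a ha b k i j hk hj
    (by rw [hQ]; ext z; simp only [Set.mem_insert_iff, Set.mem_singleton_iff]; tauto)
    (by rwa [orient_rotate, orient_rotate]) (by linear_combination h1) (by linear_combination h2)
    (by omega)
  rw [orient_rotate a.1 b.1 c.1] at r2
  rw [← orient_rotate c.1 a.1 b.1] at r3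
  have hsum : orient a.1 b.1 c.1 =
      orient a.1 b.1 d.1 + orient b.1 c.1 d.1 + orient c.1 a.1 d.1 := by
    simp only [orient]; ring
  have hsign : ∀ m n D : ℤ, 0 < m → 0 < n → m * D = n * orient a.1 b.1 c.1 →
      0 < orient a.1 b.1 c.1 * D := by
    intro m n D hm hn h
    have h3 : m * (orient a.1 b.1 c.1 * D) =
        n * (orient a.1 b.1 c.1 * orient a.1 b.1 c.1) := by
      linear_combination orient a.1 b.1 c.1 * h
    have h4 : 0 < m * (orient a.1 b.1 c.1 * D) := by
      rw [h3]; exact mul_pos hn (mul_self_pos.mpr hne)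
    exact pos_of_mul_pos_right h4 hm.le
  have p1 := hsign _ _ _ (by omega) hk r1
  have p2 := hsign _ _ _ (by omega) hi r2
  have p3 := hsign _ _ _ (by omega) hj r3
  refine ⟨a, b, c, ?_, ?_⟩
  · apply subset_antisymm
    · refine convexHull_min ?_ (convex_convexHull ℝ _)
      rintro _ ⟨z, hz, rfl⟩
      rw [hQ] at hz
      rcases hz with rfl | rfl | rfl | rfl
      · exact subset_convexHull ℝ _ (by simp)
      · exact subset_convexHull ℝ _ (by simp)
      · exact subset_convexHull ℝ _ (by simp)
      · refine mem_convexHull_of_orient (x := a.1) (y := b.1) (z := c.1) (by simp) (by simp)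
          (by simp) hne ?_ ?_ p1.le
        · rw [← orient_rotate z.1 b.1 c.1]; exact p2.le
        · rw [orient_rotate c.1 a.1 z.1]; exact p3.le
    · refine convexHull_mono ?_
      rintro _ (rfl | rfl | rfl)
      exacts [⟨a, ha, rfl⟩, ⟨b, hb, rfl⟩, ⟨c, hc, rfl⟩]
  · change |orient a.1 b.1 c.1| = 3
    rcases lt_or_gt_of_ne hne with h | h
    · rw [abs_of_neg (neg_of_mul_pos_right p1 h.le)] at u1
      rw [abs_of_neg (neg_of_mul_pos_right p2 h.le)] at u2
      rw [abs_of_neg (neg_of_mul_pos_right p3 h.le)] at u3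
      rw [abs_of_neg h]
      omega
    · rw [abs_of_pos (pos_of_mul_pos_right p1 h.le)] at u1
      rw [abs_of_pos (pos_of_mul_pos_right p2 h.le)] at u2
      rw [abs_of_pos (pos_of_mul_pos_right p3 h.le)] at u3
      rw [abs_of_pos h]
      omega

/-- If only the interior point `d` of a triangle has the opposite sign, then the chart is reduced to
a point nearby: a linear form attaining its maximum at `d` is constant on the triangle. -/
lemma isIsolatedInChart_of_dependence {f : RealTropicalPolynomial 𝒜} {a b c d : 𝒜}
    (hQ : cell (modulus f) 0 = {a, b, c, d}) (hb : (f b).1 = (f a).1) (hc : (f c).1 = (f a).1)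
    (hd : (f d).1 ≠ (f a).1) {i j k : ℤ} (hi : 0 < i) (hj : 0 < j) (hk : 0 < k)
    (h1 : i * a.1.1 + j * b.1.1 + k * c.1.1 = (i + j + k) * d.1.1)
    (h2 : i * a.1.2 + j * b.1.2 + k * c.1.2 = (i + j + k) * d.1.2)
    (hne : orient a.1 b.1 c.1 ≠ 0) : IsIsolatedInChart f (1, 1) 0 := by
  set u := modulus f with hu
  have ha' : a ∈ cell u 0 := by rw [hQ]; simp
  have hb' : b ∈ cell u 0 := by rw [hQ]; simp
  have hc' : c ∈ cell u 0 := by rw [hQ]; simp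
  have hd' : d ∈ cell u 0 := by rw [hQ]; simp
  have had : a ≠ d := by rintro rfl; exact hd rfl
  constructor
  · exact ⟨a, d, had, le_antisymm (hd' a) (ha' d), fun k => ha' k, by
      rw [signAt_one, signAt_one]; exact hd.symm⟩
  · have hev : ∀ᶠ w in 𝓝 (0 : ℝ × ℝ), ∀ β : 𝒜, β ∉ cell u 0 →
        monomialValue u w β < monomialValue u w a := by
      rw [Filter.eventually_all]
      intro β
      by_cases hβ : β ∈ cell u 0
      · simp [hβ]
      · simp only [hβ, not_false_eq_true, forall_const]
        have hlt : monomialValue u 0 β < monomialValue u 0 a :=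
          lt_of_not_ge fun hle => hβ fun δ => (ha' δ).trans hle
        have c1 : Continuous fun w : ℝ × ℝ => monomialValue u w β := by
          unfold monomialValue; fun_prop
        have c2 : Continuous fun w : ℝ × ℝ => monomialValue u w a := by
          unfold monomialValue; fun_prop
        exact (c1.tendsto 0).eventually_lt (c2.tendsto 0) hlt
    filter_upwards [nhdsWithin_le_nhds hev, self_mem_nhdsWithin] with w hw hw0
    rintro ⟨x, y, -, hxy, hmax, hs⟩
    rw [signAt_one, signAt_one] at hs
    change monomialValue u w x = monomialValue u w y at hxy
    change ∀ z, monomialValue u w z ≤ monomialValue u w x at hmax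
    have hmaxy : ∀ z, monomialValue u w z ≤ monomialValue u w y := fun z => hxy ▸ hmax z
    have hmem : ∀ z : 𝒜, (∀ γ, monomialValue u w γ ≤ monomialValue u w z) →
        z = a ∨ z = b ∨ z = c ∨ z = d := by
      intro z hz
      have : z ∈ cell u 0 := by
        by_contra hcon
        exact absurd (hw z hcon) (not_lt.mpr (hz a))
      rwa [hQ] at this
    have hdmax : ∀ z, monomialValue u w z ≤ monomialValue u w d := by
      by_cases hxd : x = d
      · exact hxd ▸ hmax
      by_cases hyd : y = d
      · exact hyd ▸ hmaxy
      exfalso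
      apply hs
      have hsx : ∀ z : 𝒜, z = a ∨ z = b ∨ z = c ∨ z = d → z ≠ d → (f z).1 = (f a).1 := by
        rintro z (rfl | rfl | rfl | rfl) h
        exacts [rfl, hb, hc, absurd rfl h]
      rw [hsx x (hmem x hmax) hxd, hsx y (hmem y hmaxy) hyd]
    have heq : ∀ z ∈ cell u 0, u z = u d := by
      intro z hz
      exact le_antisymm (mem_cell_zero.mp hd' z) (mem_cell_zero.mp hz d)
    have la := hdmax a
    have lb := hdmax b
    have lc := hdmax c
    simp only [monomialValue, heq a ha', heq b hb', heq c hc', add_le_add_iff_left] at la lb lc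
    have hi' : (0 : ℝ) < i := by exact_mod_cast hi
    have hj' : (0 : ℝ) < j := by exact_mod_cast hj
    have hk' : (0 : ℝ) < k := by exact_mod_cast hk
    have h1' : (i : ℝ) * a.1.1 + j * b.1.1 + k * c.1.1 = (i + j + k) * d.1.1 := by
      exact_mod_cast h1
    have h2' : (i : ℝ) * a.1.2 + j * b.1.2 + k * c.1.2 = (i + j + k) * d.1.2 := by
      exact_mod_cast h2
    have ga := mul_nonneg hi'.le (sub_nonneg.mpr la)
    have gb := mul_nonneg hj'.le (sub_nonneg.mpr lb)
    have gc := mul_nonneg hk'.le (sub_nonneg.mpr lc)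
    have gsum : (i : ℝ) * ((d.1.1 : ℝ) * w.1 + d.1.2 * w.2 - (a.1.1 * w.1 + a.1.2 * w.2)) +
        j * ((d.1.1 : ℝ) * w.1 + d.1.2 * w.2 - (b.1.1 * w.1 + b.1.2 * w.2)) +
        k * ((d.1.1 : ℝ) * w.1 + d.1.2 * w.2 - (c.1.1 * w.1 + c.1.2 * w.2)) = 0 := by
      linear_combination -w.1 * h1' - w.2 * h2'
    have za := (mul_eq_zero.mp (le_antisymm (by linarith) ga)).resolve_left hi'.ne'
    have zb := (mul_eq_zero.mp (le_antisymm (by linarith) gb)).resolve_left hj'.ne'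
    have zc := (mul_eq_zero.mp (le_antisymm (by linarith) gc)).resolve_left hk'.ne'
    have hne' : ((orient a.1 b.1 c.1 : ℤ) : ℝ) ≠ 0 := by exact_mod_cast hne
    have e1 : ((orient a.1 b.1 c.1 : ℤ) : ℝ) * w.1 = 0 := by
      simp only [orient]; push_cast
      linear_combination ((b.1.2 : ℝ) - c.1.2) * (-za) + ((c.1.2 : ℝ) - a.1.2) * (-zb) +
        ((a.1.2 : ℝ) - b.1.2) * (-zc)
    have e2 : ((orient a.1 b.1 c.1 : ℤ) : ℝ) * w.2 = 0 := by
      simp only [orient]; push_cast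
      linear_combination -((b.1.1 : ℝ) - c.1.1) * (-za) - ((c.1.1 : ℝ) - a.1.1) * (-zb) -
        ((a.1.1 : ℝ) - b.1.1) * (-zc)
    exact hw0 (Prod.ext ((mul_eq_zero.mp e1).resolve_left hne')
      ((mul_eq_zero.mp e2).resolve_left hne'))

/-! ### Counting the relations -/

open Classical in
lemma isCellRelation_of_mem_cell_zero {u : 𝒜 → ℝ} {α β : 𝒜} (hα : α ∈ cell u 0)
    (hβ : β ∈ cell u 0) : IsCellRelation u (Pi.single α 1 - Pi.single β 1) := by
  rw [mem_cell_zero] at hα hβ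
  exact isCellRelation_single_sub_single (c := (1, 0, 0)) ⟨by simp, fun γ _ => hα γ⟩
    ⟨by simp, fun γ _ => hβ γ⟩

/-- The coefficients of the affine function `orient x y ·`. -/
def lineCoeff (x y : ℤ × ℤ) : ℝ × ℝ × ℝ :=
  (((y.2 - x.2) * x.1 - (y.1 - x.1) * x.2 : ℤ), ((-(y.2 - x.2) : ℤ), (y.1 - x.1 : ℤ)))

lemma affineValue_lineCoeff (x y : ℤ × ℤ) (α : 𝒜) :
    affineValue (lineCoeff x y) α = (orient x y α.1 : ℤ) := by
  simp only [affineValue, lineCoeff, orient]; push_cast; ring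

open Classical in
lemma isCellRelation_off_line {u : 𝒜 → ℝ} (x y : ℤ × ℤ) {α β : 𝒜}
    (hα : orient x y α.1 ≠ 0) (hβ : orient x y β.1 ≠ 0)
    (hα' : ∀ γ : 𝒜, orient x y γ.1 ≠ 0 → u γ ≤ u α)
    (hβ' : ∀ γ : 𝒜, orient x y γ.1 ≠ 0 → u γ ≤ u β) :
    IsCellRelation u (Pi.single α 1 - Pi.single β 1) := by
  have hmem : ∀ δ : 𝒜, orient x y δ.1 ≠ 0 → (∀ γ : 𝒜, orient x y γ.1 ≠ 0 → u γ ≤ u δ) →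
      δ ∈ initialSupport (lineCoeff x y) u := by
    intro δ h h'
    refine ⟨?_, fun γ hγ => h' γ ?_⟩
    · change affineValue (lineCoeff x y) δ ≠ 0
      rw [affineValue_lineCoeff]; exact_mod_cast h
    · change affineValue (lineCoeff x y) γ ≠ 0 at hγ
      rw [affineValue_lineCoeff] at hγ; exact_mod_cast hγ
  exact isCellRelation_single_sub_single (hmem α hα hα') (hmem β hβ hβ')

lemma exists_orient_ne_zero (h𝒜 : IsPolygonSupport 𝒜) {x y : 𝒜} (hxy : x ≠ y) :
    ∃ z : 𝒜, orient x.1 y.1 z.1 ≠ 0 := by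
  by_contra! hcon
  refine h𝒜.1 ?_
  have : pt '' (𝒜 : Set (ℤ × ℤ)) = toPlane (Set.univ : Set 𝒜) := by
    ext v
    constructor
    · rintro ⟨α, hα, rfl⟩; exact ⟨⟨α, hα⟩, trivial, rfl⟩
    · rintro ⟨α, -, rfl⟩; exact ⟨α.1, α.2, rfl⟩
  rw [this, collinear_toPlane_iff (Set.mem_univ x) (Set.mem_univ y) hxy]
  exact fun z _ => hcon z

/-- The initial form of the affine function vanishing on the line `xy`. -/
lemma IsSingularAtZeroPlus.exists_off_line {f : RealTropicalPolynomial 𝒜}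
    (hf : IsSingularAtZeroPlus f) (h𝒜 : IsPolygonSupport 𝒜) {x y : 𝒜} (hxy : x ≠ y) :
    ∃ p q : 𝒜, 0 < ((f p).1 : ℤ) * orient x.1 y.1 p.1 ∧
      ((f q).1 : ℤ) * orient x.1 y.1 q.1 < 0 ∧
      (∀ γ : 𝒜, orient x.1 y.1 γ.1 ≠ 0 → modulus f γ ≤ modulus f p) ∧
      (∀ γ : 𝒜, orient x.1 y.1 γ.1 ≠ 0 → modulus f γ ≤ modulus f q) := by
  obtain ⟨z, hz⟩ := exists_orient_ne_zero h𝒜 hxy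
  obtain ⟨p, q, h1, h2, h3, h4⟩ := hf.initialFormChangesSign (lineCoeff x.1 y.1)
    ⟨z, by rw [affineValue_lineCoeff]; exact_mod_cast hz⟩
  simp only [affineValue_lineCoeff] at h1 h2 h3 h4
  refine ⟨p, q, by exact_mod_cast h1, by exact_mod_cast h2, fun γ hγ => h3 γ ?_,
    fun γ hγ => h4 γ ?_⟩ <;> exact_mod_cast hγ

lemma ne_zero_of_sign_mul_pos {s : ℤˣ} {n : ℤ} (h : 0 < (s : ℤ) * n) : n ≠ 0 := by
  rintro rfl; simp at h

lemma ne_zero_of_sign_mul_neg {s : ℤˣ} {n : ℤ} (h : (s : ℤ) * n < 0) : n ≠ 0 := by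
  rintro rfl; simp at h

lemma HasSmallestCodimension.false_of_five {u : 𝒜 → ℝ} (hu : HasSmallestCodimension u)
    {x₀ x₁ x₂ x₃ x₄ : 𝒜} (h₀ : x₀ ∈ cell u 0) (h₁ : x₁ ∈ cell u 0) (h₂ : x₂ ∈ cell u 0)
    (h₃ : x₃ ∈ cell u 0) (h₄ : x₄ ∈ cell u 0) (hnd : [x₀, x₁, x₂, x₃, x₄].Nodup) : False := by
  classical
  simp only [List.nodup_cons, List.mem_cons, List.not_mem_nil, or_false, not_or,
    not_false_eq_true, List.nodup_nil, and_true] at hnd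
  obtain ⟨⟨n01, n02, n03, n04⟩, ⟨n12, n13, n14⟩, ⟨n23, n24⟩, n34⟩ := hnd
  have n10 := Ne.symm n01
  have n20 := Ne.symm n02
  have n30 := Ne.symm n03
  have n40 := Ne.symm n04
  have n21 := Ne.symm n12
  have n31 := Ne.symm n13
  have n41 := Ne.symm n14
  have n32 := Ne.symm n23
  have n42 := Ne.symm n24
  have n43 := Ne.symm n34
  refine hu.false_of_echelon (isCellRelation_of_mem_cell_zero h₁ h₀)
    (isCellRelation_of_mem_cell_zero h₂ h₀) (isCellRelation_of_mem_cell_zero h₃ h₀)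
    (isCellRelation_of_mem_cell_zero h₄ h₀) (x₁ := x₁) (x₂ := x₂) (x₃ := x₃) (x₄ := x₄)
    ?_ ?_ ?_ ?_ ?_ ?_ ?_ ?_ ?_ ?_ <;> simp_all

/-- Four collinear points at which the maximum is attained give three relations, and the line
through them a fourth one. -/
lemma false_of_four_collinear (h𝒜 : IsPolygonSupport 𝒜) {f : RealTropicalPolynomial 𝒜}
    (hf : IsSingularAtZeroPlus f) (hu : HasSmallestCodimension (modulus f))
    {x y z w : 𝒜} (hx : x ∈ cell (modulus f) 0) (hy : y ∈ cell (modulus f) 0)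
    (hz : z ∈ cell (modulus f) 0) (hw : w ∈ cell (modulus f) 0) (hnd : [x, y, z, w].Nodup)
    (hxyz : orient x.1 y.1 z.1 = 0) (hxyw : orient x.1 y.1 w.1 = 0) : False := by
  classical
  simp only [List.nodup_cons, List.mem_cons, List.not_mem_nil, or_false, not_or,
    not_false_eq_true, List.nodup_nil, and_true] at hnd
  obtain ⟨⟨nxy, nxz, nxw⟩, ⟨nyz, nyw⟩, nzw⟩ := hnd
  obtain ⟨p, q, hp, hq, hp', hq'⟩ := hf.exists_off_line h𝒜 nxy
  have hp0 := ne_zero_of_sign_mul_pos hp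
  have hq0 := ne_zero_of_sign_mul_neg hq
  have hpq : p ≠ q := by rintro rfl; omega
  have npx : p ≠ x := by rintro rfl; exact hp0 (orient_self_mid _ _)
  have npy : p ≠ y := by rintro rfl; exact hp0 (orient_self_right _ _)
  have npz : p ≠ z := by rintro rfl; exact hp0 hxyz
  have npw : p ≠ w := by rintro rfl; exact hp0 hxyw
  have n1 := Ne.symm nxy
  have n2 := Ne.symm nxz
  have n3 := Ne.symm nxw
  have n4 := Ne.symm nyz
  have n5 := Ne.symm nyw
  have n6 := Ne.symm nzw
  refine hu.false_of_echelon (isCellRelation_of_mem_cell_zero hy hx)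
    (isCellRelation_of_mem_cell_zero hz hx) (isCellRelation_of_mem_cell_zero hw hx)
    (isCellRelation_off_line x.1 y.1 hp0 hq0 hp' hq') (x₁ := y) (x₂ := z) (x₃ := w) (x₄ := p)
    ?_ ?_ ?_ ?_ ?_ ?_ ?_ ?_ ?_ ?_ <;> simp_all

/-! ### The monomials attaining the maximum at the origin -/

lemma IsSignBalanced.exists_third {f : RealTropicalPolynomial 𝒜} {U : Set 𝒜}
    (h : IsSignBalanced f U) {x y : 𝒜} (hy : y ∈ U) (hxy : x ≠ y) :
    ∃ z ∈ U, z ≠ x ∧ z ≠ y := by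
  have hval : ∀ w : 𝒜, -((y.1.1 - x.1.1) * x.1.1 + (y.1.2 - x.1.2) * x.1.2) +
      (y.1.1 - x.1.1) * w.1.1 + (y.1.2 - x.1.2) * w.1.2 =
      (y.1.1 - x.1.1) * (w.1.1 - x.1.1) + (y.1.2 - x.1.2) * (w.1.2 - x.1.2) := by
    intro w; ring
  have h' := h (-((y.1.1 - x.1.1) * x.1.1 + (y.1.2 - x.1.2) * x.1.2)) (y.1.1 - x.1.1)
    (y.1.2 - x.1.2)
  simp only [hval] at h'
  obtain ⟨α, hα, β, hβ, h1, h2⟩ := h' ⟨y, hy, by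
    intro h0
    have n1 := mul_self_nonneg (y.1.1 - x.1.1)
    have n2 := mul_self_nonneg (y.1.2 - x.1.2)
    have e1 := mul_self_eq_zero.mp (show (y.1.1 - x.1.1) * (y.1.1 - x.1.1) = 0 by linarith)
    have e2 := mul_self_eq_zero.mp (show (y.1.2 - x.1.2) * (y.1.2 - x.1.2) = 0 by linarith)
    exact hxy (Subtype.ext (Prod.ext (by omega) (by omega)))⟩
  have hαx : α ≠ x := by rintro rfl; simp at h1
  have hβx : β ≠ x := by rintro rfl; simp at h2
  by_cases hαy : α = y
  · refine ⟨β, hβ, hβx, ?_⟩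
    rintro rfl
    rw [hαy] at h1
    omega
  · exact ⟨α, hα, hαx, hαy⟩

/-- In a balanced set of three points, the point whose sign differs from the others is the
midpoint of these: it lies between them since the affine functions vanishing only at it change
sign, and it is the midpoint since its reflections of the others cannot be further lattice
points. -/
lemma IsSignBalanced.isMid {f : RealTropicalPolynomial 𝒜} {U : Set 𝒜} (h : IsSignBalanced f U)
    (hlat : IsLatticeConvex U) {x y z : 𝒜} (hU : U = {x, y, z}) (hyz : (f y).1 = (f z).1)
    (hyx : (f y).1 ≠ (f x).1) : IsMid y.1 x.1 z.1 := by
  have hx : x ∈ U := by rw [hU]; simp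
  have hy : y ∈ U := by rw [hU]; simp
  have hz : z ∈ U := by rw [hU]; simp
  have hne_yx : y ≠ x := by rintro rfl; exact hyx rfl
  have hne_zx : z ≠ x := by rintro rfl; exact hyx hyz
  have hcol : RealTrop.orient x.1 y.1 z.1 = 0 := by
    refine h.orient_eq_zero hz fun w hw hwz => ?_
    rw [hU] at hw
    rcases hw with rfl | rfl | rfl
    exacts [orient_self_mid _ _, orient_self_right _ _, absurd rfl hwz]
  set e₁ := y.1.1 - x.1.1 with he₁
  set e₂ := y.1.2 - x.1.2 with he₂
  set g₁ := z.1.1 - x.1.1 with hg₁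
  set g₂ := z.1.2 - x.1.2 with hg₂
  have hcross : e₁ * g₂ = g₁ * e₂ := by
    have : e₁ * g₂ - g₁ * e₂ = 0 := hcol
    linarith
  have hval : ∀ w : 𝒜, -(e₁ * x.1.1 + e₂ * x.1.2) + e₁ * w.1.1 + e₂ * w.1.2 =
      e₁ * (w.1.1 - x.1.1) + e₂ * (w.1.2 - x.1.2) := by
    intro w; ring
  have hN : 0 < e₁ * e₁ + e₂ * e₂ := by
    have n1 := mul_self_nonneg e₁
    have n2 := mul_self_nonneg e₂
    by_contra hcon
    have f1 := mul_self_eq_zero.mp (show e₁ * e₁ = 0 by omega)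
    have f2 := mul_self_eq_zero.mp (show e₂ * e₂ = 0 by omega)
    exact hne_yx (Subtype.ext (Prod.ext (by omega) (by omega)))
  have hdot : e₁ * g₁ + e₂ * g₂ < 0 := by
    have h' := h (-(e₁ * x.1.1 + e₂ * x.1.2)) e₁ e₂
    simp only [hval] at h'
    obtain ⟨α, hα, β, hβ, h1, h2⟩ := h' ⟨y, hy, by rw [← he₁, ← he₂]; omega⟩
    have hcases : ∀ w ∈ U, ((f w).1 : ℤ) * (e₁ * (w.1.1 - x.1.1) + e₂ * (w.1.2 - x.1.2)) =
        0 ∨ ((f w).1 : ℤ) * (e₁ * (w.1.1 - x.1.1) + e₂ * (w.1.2 - x.1.2)) =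
        (f y).1 * (e₁ * e₁ + e₂ * e₂) ∨
        ((f w).1 : ℤ) * (e₁ * (w.1.1 - x.1.1) + e₂ * (w.1.2 - x.1.2)) =
        (f y).1 * (e₁ * g₁ + e₂ * g₂) := by
      intro w hw
      rw [hU] at hw
      rcases hw with rfl | rfl | rfl
      · left; ring
      · right; left; rw [he₁, he₂]
      · right; right; rw [hyz, hg₁, hg₂]
    have c1 := hcases α hα
    have c2 := hcases β hβ
    rcases Int.units_eq_one_or (f y).1 with hs | hs <;> rw [hs] at c1 c2 <;>
      simp only [Units.val_one, one_mul, Units.val_neg, neg_mul] at c1 c2 <;> omega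
  have hxU : ∀ {p : ℤ × ℤ} {v : 𝒜} {r : ℝ}, v ∈ U → 0 ≤ r → r ≤ 1 →
      (p.1 : ℝ) = x.1.1 + r * (v.1.1 - x.1.1) → (p.2 : ℝ) = x.1.2 + r * (v.1.2 - x.1.2) →
      p = x.1 ∨ p = y.1 ∨ p = z.1 := by
    intro p v r hv h0 h1 h2 h3
    obtain ⟨α, hα, rfl⟩ := hlat.exists_mem_of_segment hx hv h0 h1 h2 h3
    rw [hU] at hα
    rcases hα with rfl | rfl | rfl <;> simp
  have hcross' : (e₁ : ℝ) * g₂ = g₁ * e₂ := by exact_mod_cast hcross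
  have hdot' : (e₁ : ℝ) * g₁ + e₂ * g₂ < 0 := by exact_mod_cast hdot
  have hN' : (0 : ℝ) < e₁ * e₁ + e₂ * e₂ := by exact_mod_cast hN
  by_cases hle : e₁ * e₁ + e₂ * e₂ ≤ -(e₁ * g₁ + e₂ * g₂)
  · have hle' : (e₁ : ℝ) * e₁ + e₂ * e₂ ≤ -(e₁ * g₁ + e₂ * g₂) := by exact_mod_cast hle
    have hD : (-((e₁ : ℝ) * g₁ + e₂ * g₂)) ≠ 0 := by linarith
    have hr := div_mul_cancel₀ ((e₁ : ℝ) * e₁ + e₂ * e₂) hD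
    have := hxU (p := (x.1.1 - e₁, x.1.2 - e₂))
      (r := ((e₁ : ℝ) * e₁ + e₂ * e₂) / (-(e₁ * g₁ + e₂ * g₂))) hz
      (div_nonneg hN'.le (by linarith)) ((div_le_one (by linarith)).mpr hle')
      (by
        have : (z.1.1 : ℝ) - x.1.1 = g₁ := by rw [hg₁]; push_cast; ring
        rw [this]; push_cast; refine mul_left_cancel₀ hD ?_
        linear_combination (e₂ : ℝ) * hcross' - (g₁ : ℝ) * hr)
      (by
        have : (z.1.2 : ℝ) - x.1.2 = g₂ := by rw [hg₂]; push_cast; ring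
        rw [this]; push_cast; refine mul_left_cancel₀ hD ?_
        linear_combination (-e₁ : ℝ) * hcross' - (g₂ : ℝ) * hr)
    rcases this with h | h | h
    · exfalso
      have h1 := congrArg Prod.fst h
      have h2 := congrArg Prod.snd h
      simp only at h1 h2
      exact hne_yx (Subtype.ext (Prod.ext (by omega) (by omega)))
    · exfalso
      have h1 := congrArg Prod.fst h
      have h2 := congrArg Prod.snd h
      simp only at h1 h2
      exact hne_yx (Subtype.ext (Prod.ext (by omega) (by omega)))
    · have h1 := congrArg Prod.fst h
      have h2 := congrArg Prod.snd h
      simp only at h1 h2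
      exact ⟨by omega, by omega⟩
  · have hle' : -((e₁ : ℝ) * g₁ + e₂ * g₂) ≤ e₁ * e₁ + e₂ * e₂ := by
      exact_mod_cast (not_le.mp hle).le
    have hr := div_mul_cancel₀ (-((e₁ : ℝ) * g₁ + e₂ * g₂)) hN'.ne'
    have := hxU (p := (x.1.1 - g₁, x.1.2 - g₂))
      (r := (-(e₁ * g₁ + e₂ * g₂)) / ((e₁ : ℝ) * e₁ + e₂ * e₂)) hy
      (div_nonneg (by linarith) hN'.le) ((div_le_one hN').mpr hle')
      (by
        have : (y.1.1 : ℝ) - x.1.1 = e₁ := by rw [he₁]; push_cast; ring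
        rw [this]; push_cast; refine mul_left_cancel₀ hN'.ne' ?_
        linear_combination (e₂ : ℝ) * hcross' - (e₁ : ℝ) * hr)
      (by
        have : (y.1.2 : ℝ) - x.1.2 = e₂ := by rw [he₂]; push_cast; ring
        rw [this]; push_cast; refine mul_left_cancel₀ hN'.ne' ?_
        linear_combination (-e₁ : ℝ) * hcross' - (e₂ : ℝ) * hr)
    rcases this with h | h | h
    · exfalso
      have h1 := congrArg Prod.fst h
      have h2 := congrArg Prod.snd h
      simp only at h1 h2
      exact hne_zx (Subtype.ext (Prod.ext (by omega) (by omega)))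
    · have h1 := congrArg Prod.fst h
      have h2 := congrArg Prod.snd h
      simp only at h1 h2
      exact ⟨by omega, by omega⟩
    · exfalso
      have h1 := congrArg Prod.fst h
      have h2 := congrArg Prod.snd h
      simp only at h1 h2
      exact hne_zx (Subtype.ext (Prod.ext (by omega) (by omega)))

/-! ### Three monomials attaining the maximum at the origin -/

/-- The maximum at the origin is attained at `a`, `b`, `c` only, where `b` is the midpoint of `a`
and `c` and has the opposite sign, and off the line `abc` the largest modulus is attained at `p` and
`q`, with opposite signs in the initial form of the affine function vanishing on that line. -/
structure IsLineConfiguration (f : RealTropicalPolynomial 𝒜) (a b c p q : 𝒜) : Prop where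
  cell_eq : cell (modulus f) 0 = {a, b, c}
  mid : IsMid a.1 b.1 c.1
  sign_ac : (f a).1 = (f c).1
  sign_ab : (f a).1 ≠ (f b).1
  sign_pq : (((f p).1 : ℤ) * orient a.1 b.1 p.1) * (((f q).1 : ℤ) * orient a.1 b.1 q.1) < 0
  max_p : ∀ γ : 𝒜, orient a.1 b.1 γ.1 ≠ 0 → modulus f γ ≤ modulus f p
  max_q : ∀ γ : 𝒜, orient a.1 b.1 γ.1 ≠ 0 → modulus f γ ≤ modulus f q

/-- A normal vector of the line `ab`, in the direction in which `orient a b ·` increases. -/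
def lineNormal (a b : ℤ × ℤ) : ℝ × ℝ := (-((b.2 : ℝ) - a.2), (b.1 : ℝ) - a.1)

lemma linearValue_smul_lineNormal (t : ℝ) (a b z : 𝒜) :
    linearValue (t • lineNormal a.1 b.1) z =
      linearValue (t • lineNormal a.1 b.1) a + t * (orient a.1 b.1 z.1 : ℤ) := by
  simp only [linearValue, lineNormal, orient, Prod.smul_fst, Prod.smul_snd, smul_eq_mul]
  push_cast; ring

lemma monomialValue_smul_lineNormal (u : 𝒜 → ℝ) (t : ℝ) (a b z : 𝒜) :
    monomialValue u (t • lineNormal a.1 b.1) z =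
      u z + t * (orient a.1 b.1 z.1 : ℤ) + linearValue (t • lineNormal a.1 b.1) a := by
  have : monomialValue u (t • lineNormal a.1 b.1) z =
    u z + linearValue (t • lineNormal a.1 b.1) z := rfl
  rw [this, linearValue_smul_lineNormal]; ring

/-- The cell at a point of the line dual to `ab` at which the maximum is attained at `a`. -/
lemma mem_cell_smul_lineNormal_iff {u : 𝒜 → ℝ} {a b : 𝒜} {t : ℝ}
    (ht : ∀ z : 𝒜, t * (orient a.1 b.1 z.1 : ℤ) ≤ u a - u z) (z : 𝒜) :
    z ∈ cell u (t • lineNormal a.1 b.1) ↔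
      t * (orient a.1 b.1 z.1 : ℤ) = u a - u z := by
  constructor
  · intro hz
    have h1 := hz a
    rw [monomialValue_smul_lineNormal, monomialValue_smul_lineNormal, orient_self_mid] at h1
    have h2 := ht z
    simp only [Int.cast_zero, mul_zero] at h1
    linarith
  · intro hz β
    rw [monomialValue_smul_lineNormal, monomialValue_smul_lineNormal]
    have h2 := ht β
    linarith

lemma IsMid.lineNormal_swap {a b c : ℤ × ℤ} (h : IsMid a b c) :
    lineNormal c b = -lineNormal a b := by
  have h1 : c.1 = 2 * b.1 - a.1 := by have := h.1; omega
  have h2 : c.2 = 2 * b.2 - a.2 := by have := h.2; omega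
  simp only [lineNormal, h1, h2, Prod.neg_mk, Prod.mk.injEq]
  push_cast
  constructor <;> ring

namespace IsLineConfiguration

variable {f : RealTropicalPolynomial 𝒜} {a b c p q : 𝒜}

lemma swap_pq (h : IsLineConfiguration f a b c p q) : IsLineConfiguration f a b c q p :=
  ⟨h.cell_eq, h.mid, h.sign_ac, h.sign_ab, by rw [mul_comm]; exact h.sign_pq, h.max_q, h.max_p⟩

lemma swap_ac (h : IsLineConfiguration f a b c p q) : IsLineConfiguration f c b a p q where
  cell_eq := by
    rw [h.cell_eq]; ext z; simp only [Set.mem_insert_iff, Set.mem_singleton_iff]; tauto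
  mid := h.mid.symm
  sign_ac := h.sign_ac.symm
  sign_ab := h.sign_ac ▸ h.sign_ab
  sign_pq := by
    have := h.sign_pq
    rw [h.mid.orient_swap, h.mid.orient_swap]
    linarith
  max_p := fun γ hγ => h.max_p γ (by
    rw [h.mid.orient_swap] at hγ; exact neg_ne_zero.mp hγ)
  max_q := fun γ hγ => h.max_q γ (by
    rw [h.mid.orient_swap] at hγ; exact neg_ne_zero.mp hγ)

lemma mem_a (h : IsLineConfiguration f a b c p q) : a ∈ cell (modulus f) 0 := by
  rw [h.cell_eq]; simp

lemma mem_b (h : IsLineConfiguration f a b c p q) : b ∈ cell (modulus f) 0 := by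
  rw [h.cell_eq]; simp

lemma mem_c (h : IsLineConfiguration f a b c p q) : c ∈ cell (modulus f) 0 := by
  rw [h.cell_eq]; simp

lemma ne_ab (h : IsLineConfiguration f a b c p q) : a ≠ b := by
  rintro rfl; exact h.sign_ab rfl

lemma ne_cb (h : IsLineConfiguration f a b c p q) : c ≠ b := h.swap_ac.ne_ab

lemma ne_ac (h : IsLineConfiguration f a b c p q) : a ≠ c := by
  rintro rfl
  have := h.mid.1
  have := h.mid.2
  exact h.ne_ab (Subtype.ext (Prod.ext (by omega) (by omega)))

lemma orient_p (h : IsLineConfiguration f a b c p q) : orient a.1 b.1 p.1 ≠ 0 := by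
  intro h0
  have := h.sign_pq
  rw [h0] at this
  simp at this

lemma orient_q (h : IsLineConfiguration f a b c p q) : orient a.1 b.1 q.1 ≠ 0 :=
  h.swap_pq.orient_p

lemma ne_pq (h : IsLineConfiguration f a b c p q) : p ≠ q := by
  rintro rfl
  exact absurd h.sign_pq (not_lt.mpr (mul_self_nonneg _))

lemma orient_of_mem (h : IsLineConfiguration f a b c p q) {z : 𝒜}
    (hz : z = a ∨ z = b ∨ z = c) : orient a.1 b.1 z.1 = 0 := by
  rcases hz with rfl | rfl | rfl
  exacts [orient_self_mid _ _, orient_self_right _ _, h.mid.orient_eq_zero]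

lemma modulus_pq (h : IsLineConfiguration f a b c p q) : modulus f p = modulus f q :=
  le_antisymm (h.max_q p h.orient_p) (h.max_p q h.orient_q)

open Classical in
lemma relation_pq (h : IsLineConfiguration f a b c p q) :
    IsCellRelation (modulus f) (Pi.single q 1 - Pi.single p 1) :=
  isCellRelation_off_line a.1 b.1 h.orient_q h.orient_p h.max_q h.max_p

/-- The equalities of moduli at `a`, `b`, `c` and at `p`, `q` generate all relations, so further
relations are subject to linear conditions. -/
lemma relation_eq_zero (h : IsLineConfiguration f a b c p q)
    (hu : HasSmallestCodimension (modulus f)) {φ : 𝒜 → ℝ} (hφ : IsCellRelation (modulus f) φ) :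
    (∀ z, z ≠ a → z ≠ b → z ≠ c → z ≠ p → z ≠ q → φ z = 0) ∧ φ p + φ q = 0 := by
  classical
  have n1 := h.ne_ab
  have n2 := h.ne_cb
  have n3 := h.ne_ac
  have n4 := h.ne_pq
  have n1' := h.ne_ab.symm
  have n2' := h.ne_cb.symm
  have n3' := h.ne_ac.symm
  have n4' := h.ne_pq.symm
  have hoff : ∀ y : 𝒜, orient a.1 b.1 y.1 ≠ 0 → y ≠ a ∧ y ≠ b ∧ y ≠ c := by
    intro y hy
    refine ⟨?_, ?_, ?_⟩ <;> rintro rfl <;> exact hy (h.orient_of_mem (by simp))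
  obtain ⟨p1, p2, p3⟩ := hoff p h.orient_p
  obtain ⟨q1, q2, q3⟩ := hoff q h.orient_q
  constructor
  · intro z z1 z2 z3 z4 z5
    by_contra hz
    refine hu.false_of_echelon (isCellRelation_of_mem_cell_zero h.mem_b h.mem_a)
      (isCellRelation_of_mem_cell_zero h.mem_c h.mem_a) h.relation_pq hφ (x₁ := b) (x₂ := c)
      (x₃ := q) (x₄ := z) ?_ ?_ ?_ hz ?_ ?_ ?_ ?_ ?_ ?_ <;> simp_all
  · by_contra hpq
    have hψ := hφ.sub_smul h.relation_pq (φ q)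
    refine hu.false_of_echelon (isCellRelation_of_mem_cell_zero h.mem_b h.mem_a)
      (isCellRelation_of_mem_cell_zero h.mem_c h.mem_a) hψ h.relation_pq (x₁ := b) (x₂ := c)
      (x₃ := p) (x₄ := q) ?_ ?_ ?_ ?_ ?_ ?_ ?_ ?_ ?_ ?_ <;> simp_all

lemma eq_of_modulus_eq (h : IsLineConfiguration f a b c p q)
    (hu : HasSmallestCodimension (modulus f)) {r : 𝒜} (hr : orient a.1 b.1 r.1 ≠ 0)
    (hrp : modulus f r = modulus f p) : r = p ∨ r = q := by
  classical
  by_contra! hcon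
  have hrel := isCellRelation_off_line a.1 b.1 hr h.orient_p
    (fun γ hγ => hrp ▸ h.max_p γ hγ) h.max_p
  have hne : ∀ z : 𝒜, z = a ∨ z = b ∨ z = c → r ≠ z := by
    rintro z hz rfl; exact hr (h.orient_of_mem hz)
  have := (h.relation_eq_zero hu hrel).1 r (hne a (by simp)) (hne b (by simp)) (hne c (by simp))
    hcon.1 hcon.2
  simp [hcon.1] at this

lemma mem_dualEdge_iff (h : IsLineConfiguration f a b c p q) (w : ℝ × ℝ) :
    w ∈ dualEdge (modulus f) {a, b, c} ↔ ∃ t : ℝ, w = t • lineNormal a.1 b.1 ∧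
      ∀ z : 𝒜, t * (orient a.1 b.1 z.1 : ℤ) ≤ modulus f a - modulus f z := by
  have hab : modulus f a = modulus f b :=
    le_antisymm (mem_cell_zero.mp h.mem_b a) (mem_cell_zero.mp h.mem_a b)
  have hac : modulus f a = modulus f c :=
    le_antisymm (mem_cell_zero.mp h.mem_c a) (mem_cell_zero.mp h.mem_a c)
  constructor
  · intro hw
    have ha : a ∈ cell (modulus f) w := hw (by simp)
    have hb : b ∈ cell (modulus f) w := hw (by simp)
    have hval := le_antisymm (ha b) (hb a)
    simp only [monomialValue, hab] at hval
    have hN : ((b.1.1 : ℝ) - a.1.1) ^ 2 + ((b.1.2 : ℝ) - a.1.2) ^ 2 ≠ 0 := by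
      intro h0
      have n1 := sq_nonneg ((b.1.1 : ℝ) - a.1.1)
      have n2 := sq_nonneg ((b.1.2 : ℝ) - a.1.2)
      have h1 : ((b.1.1 : ℝ) - a.1.1) = 0 := pow_eq_zero_iff two_ne_zero |>.mp (by linarith)
      have h2 : ((b.1.2 : ℝ) - a.1.2) = 0 := pow_eq_zero_iff two_ne_zero |>.mp (by linarith)
      refine h.ne_ab (Subtype.ext (Prod.ext ?_ ?_))
      · exact_mod_cast (sub_eq_zero.mp h1).symm
      · exact_mod_cast (sub_eq_zero.mp h2).symm
    have hwt : w = ((w.2 * ((b.1.1 : ℝ) - a.1.1) - w.1 * ((b.1.2 : ℝ) - a.1.2)) /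
        (((b.1.1 : ℝ) - a.1.1) ^ 2 + ((b.1.2 : ℝ) - a.1.2) ^ 2)) • lineNormal a.1 b.1 := by
      have horth : ((b.1.1 : ℝ) - a.1.1) * w.1 + ((b.1.2 : ℝ) - a.1.2) * w.2 = 0 := by
        linarith
      refine Prod.ext ?_ ?_
      · simp only [lineNormal, Prod.smul_fst, smul_eq_mul]
        field_simp
        linear_combination ((b.1.1 : ℝ) - a.1.1) * horth
      · simp only [lineNormal, Prod.smul_snd, smul_eq_mul]
        field_simp
        linear_combination ((b.1.2 : ℝ) - a.1.2) * horth
    refine ⟨_, hwt, fun z => ?_⟩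
    have h1 := ha z
    rw [hwt, monomialValue_smul_lineNormal, monomialValue_smul_lineNormal, orient_self_mid] at h1
    simp only [Int.cast_zero, mul_zero] at h1
    linarith
  · rintro ⟨t, rfl, ht⟩ z hz
    rw [mem_cell_smul_lineNormal_iff ht, h.orient_of_mem (by simpa using hz)]
    rcases hz with rfl | rfl | rfl
    · simp
    · simp [hab]
    · simp [hac]

lemma eq_of_modulus_eq_max (h : IsLineConfiguration f a b c p q) {z : 𝒜}
    (hz : modulus f z = modulus f a) : z = a ∨ z = b ∨ z = c := by
  have : z ∈ cell (modulus f) 0 := by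
    rw [mem_cell_zero, hz]; exact mem_cell_zero.mp h.mem_a
  rw [h.cell_eq] at this
  simpa using this

lemma mem_chartEdges (h : IsLineConfiguration f a b c p q) :
    {a, b, c} ∈ chartEdges f (1, 1) := by
  refine ⟨⟨a, by simp, b, by simp, h.ne_ab⟩, ?_, ⟨0, h.cell_eq.symm⟩,
    hasBothSigns_one.mpr ⟨a, by simp, b, by simp, h.sign_ab⟩⟩
  rw [collinear_toPlane_iff (x := a) (y := b) (by simp) (by simp) h.ne_ab]
  exact fun z hz => h.orient_of_mem (by simpa using hz)

lemma hasWeight_two (h : IsLineConfiguration f a b c p q)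
    (hlat : IsLatticeConvex (cell (modulus f) 0)) : HasWeight ({a, b, c} : Set 𝒜) 2 := by
  have h1 := h.mid.1
  have h2 := h.mid.2
  refine ⟨a, by simp, c, by simp, ?_, ?_⟩
  · apply subset_antisymm
    · refine convexHull_min ?_ (convex_segment _ _)
      rintro _ ⟨z, rfl | rfl | rfl, rfl⟩
      · exact left_mem_segment _ _ _
      · refine ⟨1 / 2, 1 / 2, by norm_num, by norm_num, by norm_num, ?_⟩
        have h1' : (a.1.1 : ℝ) + c.1.1 = 2 * z.1.1 := by exact_mod_cast h1
        have h2' : (a.1.2 : ℝ) + c.1.2 = 2 * z.1.2 := by exact_mod_cast h2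
        simp only [pt, Prod.smul_mk, Prod.mk_add_mk, smul_eq_mul, Prod.ext_iff]
        constructor <;> linarith
      · exact right_mem_segment _ _ _
    · rw [← convexHull_pair]
      refine convexHull_mono ?_
      rintro _ (rfl | rfl)
      exacts [⟨a, by simp, rfl⟩, ⟨c, by simp, rfl⟩]
  · have e1 : c.1.1 - a.1.1 = 2 * (b.1.1 - a.1.1) := by omega
    have e2 : c.1.2 - a.1.2 = 2 * (b.1.2 - a.1.2) := by omega
    rw [e1, e2, Int.gcd_mul_left]
    have hg : Int.gcd (b.1.1 - a.1.1) (b.1.2 - a.1.2) = 1 := by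
      by_contra hg
      obtain ⟨z, hz, k, hk, k1, k2⟩ := hlat.exists_mem_of_gcd_ne_one h.mem_a h.mem_b h.ne_ab hg
      have hzero : b.1.1 - a.1.1 = 0 ∧ b.1.2 - a.1.2 = 0 := by
        rw [h.cell_eq] at hz
        rcases hz with rfl | rfl | rfl
        · simp only [sub_self, mul_zero] at k1 k2; exact ⟨k1, k2⟩
        · constructor
          · have : (k - 1) * (z.1.1 - a.1.1) = 0 := by linear_combination -k1
            exact (mul_eq_zero.mp this).resolve_left (by omega)
          · have : (k - 1) * (z.1.2 - a.1.2) = 0 := by linear_combination -k2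
            exact (mul_eq_zero.mp this).resolve_left (by omega)
        · rw [e1] at k1
          rw [e2] at k2
          constructor
          · have : (2 * k - 1) * (b.1.1 - a.1.1) = 0 := by linear_combination -k1
            exact (mul_eq_zero.mp this).resolve_left (by omega)
          · have : (2 * k - 1) * (b.1.2 - a.1.2) = 0 := by linear_combination -k2
            exact (mul_eq_zero.mp this).resolve_left (by omega)
      exact h.ne_ab (Subtype.ext (Prod.ext (by omega) (by omega)))
    rw [hg]; rfl

/-- Two points of a marked polygon with side `abc` that are off this side give an affine dependence,
which has to be a multiple of the relation between `p` and `q`. -/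
lemma eq_pq_of_mem (h : IsLineConfiguration f a b c p q)
    (hu : HasSmallestCodimension (modulus f)) {Q : Set 𝒜} (hQ : Q ∈ subdivision (modulus f))
    (ha : a ∈ Q) (hb : b ∈ Q) {x y : 𝒜} (hx : x ∈ Q) (hy : y ∈ Q)
    (hx0 : orient a.1 b.1 x.1 ≠ 0) (hy0 : orient a.1 b.1 y.1 ≠ 0) (hxy : x ≠ y) :
    ((x = p ∧ y = q) ∨ (x = q ∧ y = p)) ∧ orient a.1 b.1 x.1 = orient a.1 b.1 y.1 := by
  classical
  have hoff : ∀ v : 𝒜, orient a.1 b.1 v.1 ≠ 0 → v ≠ a ∧ v ≠ b ∧ v ≠ c := by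
    intro v hv
    refine ⟨?_, ?_, ?_⟩ <;> rintro rfl <;> exact hv (h.orient_of_mem (by simp))
  obtain ⟨xa, xb, xc⟩ := hoff x hx0
  obtain ⟨ya, yb, yc⟩ := hoff y hy0
  set φ : 𝒜 → ℝ := fun α => (-(orient b.1 x.1 y.1 : ℤ)) * (Pi.single a 1 : 𝒜 → ℝ) α -
    (orient x.1 a.1 y.1 : ℤ) * (Pi.single b 1 : 𝒜 → ℝ) α -
    (orient a.1 b.1 y.1 : ℤ) * (Pi.single x 1 : 𝒜 → ℝ) α +
    (orient a.1 b.1 x.1 : ℤ) * (Pi.single y 1 : 𝒜 → ℝ) α with hφ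
  have hsum : ∀ g : 𝒜 → ℝ, ∑ α, φ α * g α = -(orient b.1 x.1 y.1 : ℤ) * g a -
      (orient x.1 a.1 y.1 : ℤ) * g b - (orient a.1 b.1 y.1 : ℤ) * g x +
      (orient a.1 b.1 x.1 : ℤ) * g y := by
    intro g
    simp only [hφ, add_mul, sub_mul, Finset.sum_add_distrib, Finset.sum_sub_distrib, mul_assoc,
      ← Finset.mul_sum, Pi.single_apply, ite_mul, one_mul, zero_mul, Finset.sum_ite_eq',
      Finset.mem_univ, if_true]
  have hrel : IsCellRelation (modulus f) φ := by
    refine isCellRelation_of_affine_dependence hQ ?_ ?_ ?_ ?_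
    · intro α hα
      by_contra hαQ
      have m1 : α ≠ a := by rintro rfl; exact hαQ ha
      have m2 : α ≠ b := by rintro rfl; exact hαQ hb
      have m3 : α ≠ x := by rintro rfl; exact hαQ hx
      have m4 : α ≠ y := by rintro rfl; exact hαQ hy
      simp [hφ, m1, m2, m3, m4] at hα
    · have := hsum fun _ => 1
      simp only [mul_one] at this
      rw [this]; simp only [orient]; push_cast; ring
    · rw [hsum fun α => (α.1.1 : ℝ)]; simp only [orient]; push_cast; ring
    · rw [hsum fun α => (α.1.2 : ℝ)]; simp only [orient]; push_cast; ring
  have hφx : φ x = -(orient a.1 b.1 y.1 : ℤ) := by simp [hφ, xa, xb, hxy]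
  have hφy : φ y = (orient a.1 b.1 x.1 : ℤ) := by simp [hφ, ya, yb, hxy.symm]
  obtain ⟨r1, r2⟩ := h.relation_eq_zero hu hrel
  have hxpq : x = p ∨ x = q := by
    by_contra! hcon
    have := r1 x xa xb xc hcon.1 hcon.2
    rw [hφx, neg_eq_zero] at this
    exact hy0 (by exact_mod_cast this)
  have hypq : y = p ∨ y = q := by
    by_contra! hcon
    have := r1 y ya yb yc hcon.1 hcon.2
    rw [hφy] at this
    exact hx0 (by exact_mod_cast this)
  have hcases : (x = p ∧ y = q) ∨ (x = q ∧ y = p) := by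
    rcases hxpq with h1 | h1 <;> rcases hypq with h2 | h2
    · exact absurd (h1.trans h2.symm) hxy
    · exact Or.inl ⟨h1, h2⟩
    · exact Or.inr ⟨h1, h2⟩
    · exact absurd (h1.trans h2.symm) hxy
  refine ⟨hcases, ?_⟩
  have hs : φ x + φ y = 0 := by
    rcases hcases with ⟨h1, h2⟩ | ⟨h1, h2⟩
    · rw [h1, h2]; exact r2
    · rw [h1, h2, add_comm]; exact r2
  rw [hφx, hφy] at hs
  have : ((orient a.1 b.1 x.1 : ℤ) : ℝ) = (orient a.1 b.1 y.1 : ℤ) := by linarith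
  exact_mod_cast this

/-- If all points of a lattice convex set that are off the line `ab` have the same height over this
line, then this height is one: otherwise a triangle with side `ab` would contain a further lattice
point. -/
lemma orient_eq_one_of_mem (h : IsLineConfiguration f a b c p q) {Q : Set 𝒜}
    (hlat : IsLatticeConvex Q) (ha : a ∈ Q) (hb : b ∈ Q) {r : 𝒜} (hr : r ∈ Q)
    (hr0 : 0 < orient a.1 b.1 r.1)
    (hQ : ∀ z ∈ Q, (z = a ∨ z = b ∨ z = c) ∨ orient a.1 b.1 z.1 = orient a.1 b.1 r.1) :
    orient a.1 b.1 r.1 = 1 := by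
  by_contra h1
  obtain ⟨z, hz, za, zb, zr, g1, g2, -⟩ := hlat.exists_mem_of_orient ha hb hr hr0.ne'
    (by rwa [abs_of_pos hr0])
  rcases hQ z hz with (hz' | hz' | hz') | hz'
  · exact za hz'
  · exact zb hz'
  · rw [hz', h.mid.orient_swap] at g1
    have := mul_pos hr0 hr0
    rw [mul_neg] at g1
    omega
  · have g1' := nonneg_of_mul_nonneg_right g1 hr0
    have g2' := nonneg_of_mul_nonneg_right g2 hr0
    have hsum : orient z.1 b.1 r.1 + orient a.1 z.1 r.1 + orient a.1 b.1 z.1 =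
        orient a.1 b.1 r.1 := by
      simp only [orient]; ring
    have g3 : orient a.1 z.1 r.1 = 0 := by omega
    have k1 : orient a.1 b.1 r.1 * (z.1.1 - r.1.1) = 0 := by
      have : orient a.1 b.1 r.1 * (z.1.1 - r.1.1) = (b.1.1 - a.1.1) * orient a.1 z.1 r.1 +
          (r.1.1 - a.1.1) * (orient a.1 b.1 z.1 - orient a.1 b.1 r.1) := by
        simp only [orient]; ring
      rw [this, g3, hz']; ring
    have k2 : orient a.1 b.1 r.1 * (z.1.2 - r.1.2) = 0 := by
      have : orient a.1 b.1 r.1 * (z.1.2 - r.1.2) = (b.1.2 - a.1.2) * orient a.1 z.1 r.1 +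
          (r.1.2 - a.1.2) * (orient a.1 b.1 z.1 - orient a.1 b.1 r.1) := by
        simp only [orient]; ring
      rw [this, g3, hz']; ring
    have k1' := (mul_eq_zero.mp k1).resolve_left hr0.ne'
    have k2' := (mul_eq_zero.mp k2).resolve_left hr0.ne'
    exact zr (Subtype.ext (Prod.ext (by omega) (by omega)))

/-- If `p` and `q` are the only points of a lattice convex set at height one over the line `ab`,
then their difference is `± (b - a)`. -/
lemma sub_eq_or (h : IsLineConfiguration f a b c p q) {Q : Set 𝒜} (hlat : IsLatticeConvex Q)
    (hp : p ∈ Q) (hq : q ∈ Q) (hp1 : orient a.1 b.1 p.1 = 1) (hq1 : orient a.1 b.1 q.1 = 1)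
    (hQ : ∀ z ∈ Q, orient a.1 b.1 z.1 = 1 → z = p ∨ z = q) :
    (q.1.1 - p.1.1 = b.1.1 - a.1.1 ∧ q.1.2 - p.1.2 = b.1.2 - a.1.2) ∨
      (p.1.1 - q.1.1 = b.1.1 - a.1.1 ∧ p.1.2 - q.1.2 = b.1.2 - a.1.2) := by
  -- the lattice is spanned by `b - a` and `x - a`, if `x` has height one
  have hmul : ∀ x y : 𝒜, orient a.1 b.1 x.1 = 1 → orient a.1 b.1 y.1 = 1 →
      ∃ k : ℤ, y.1.1 - x.1.1 = k * (b.1.1 - a.1.1) ∧ y.1.2 - x.1.2 = k * (b.1.2 - a.1.2) := by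
    intro x y hx hy
    refine ⟨(y.1.1 - x.1.1) * (x.1.2 - a.1.2) - (y.1.2 - x.1.2) * (x.1.1 - a.1.1), ?_, ?_⟩
    · simp only [orient] at hx hy
      linear_combination (x.1.1 - a.1.1) * hy - (y.1.1 - a.1.1) * hx
    · simp only [orient] at hx hy
      linear_combination (x.1.2 - a.1.2) * hy - (y.1.2 - a.1.2) * hx
  have hstep : ∀ x y : 𝒜, x ∈ Q → y ∈ Q → orient a.1 b.1 x.1 = 1 → ∀ k : ℤ, 1 ≤ k →
      y.1.1 - x.1.1 = k * (b.1.1 - a.1.1) → y.1.2 - x.1.2 = k * (b.1.2 - a.1.2) →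
      ∃ z ∈ Q, z.1 = (x.1.1 + (b.1.1 - a.1.1), x.1.2 + (b.1.2 - a.1.2)) ∧ z ≠ x ∧
        orient a.1 b.1 z.1 = 1 := by
    intro x y hx hy hx1 k hk e1 e2
    have hk' : (0 : ℝ) < k := by exact_mod_cast (by omega : 0 < k)
    have e1' : (y.1.1 : ℝ) - x.1.1 = k * (b.1.1 - a.1.1) := by exact_mod_cast e1
    have e2' : (y.1.2 : ℝ) - x.1.2 = k * (b.1.2 - a.1.2) := by exact_mod_cast e2
    obtain ⟨z, hz, hze⟩ := hlat.exists_mem_of_segment hx hy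
      (p := (x.1.1 + (b.1.1 - a.1.1), x.1.2 + (b.1.2 - a.1.2))) (r := 1 / (k : ℝ))
      (by positivity) ((div_le_one hk').mpr (by exact_mod_cast hk))
      (by rw [e1']; push_cast; field_simp) (by rw [e2']; push_cast; field_simp)
    refine ⟨z, hz, hze, ?_, ?_⟩
    · rintro rfl
      have c1 := congrArg Prod.fst hze
      have c2 := congrArg Prod.snd hze
      simp only at c1 c2
      exact h.ne_ab (Subtype.ext (Prod.ext (by omega) (by omega)))
    · rw [← hx1, hze]; simp only [orient]; ring
  obtain ⟨k, e1, e2⟩ := hmul p q hp1 hq1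
  rcases lt_trichotomy k 0 with hk | hk | hk
  · obtain ⟨z, hz, hze, hzx, hz1⟩ := hstep q p hq hp hq1 (-k) (by omega)
      (by linear_combination -e1) (by linear_combination -e2)
    have hzp : z = p := (hQ z hz hz1).resolve_right hzx
    rw [hzp] at hze
    right
    rw [hze]
    exact ⟨by ring, by ring⟩
  · exfalso
    rw [hk, zero_mul] at e1 e2
    exact h.ne_pq (Subtype.ext (Prod.ext (by omega) (by omega)))
  · obtain ⟨z, hz, hze, hzx, hz1⟩ := hstep p q hp hq hp1 k (by omega) e1 e2
    have hzq : z = q := (hQ z hz hz1).resolve_left hzx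
    rw [hzq] at hze
    left
    rw [hze]
    exact ⟨by ring, by ring⟩

/-- The end point of the dual edge of `abc` on the side of the normal vector, if there are points
of the support on this side: it is dual to a triangle or to a trapezoid of height one. -/
lemma exists_endpoint (h : IsLineConfiguration f a b c p q)
    (hu : HasSmallestCodimension (modulus f))
    (hlat : ∀ w, IsLatticeConvex (cell (modulus f) w)) (hpos : ∃ z : 𝒜, 0 < orient a.1 b.1 z.1) :
    ∃ (t : ℝ) (r : 𝒜), 0 < t ∧ orient a.1 b.1 r.1 = 1 ∧ t = modulus f a - modulus f r ∧
      (∀ z : 𝒜, t * (orient a.1 b.1 z.1 : ℤ) ≤ modulus f a - modulus f z) ∧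
      (cell (modulus f) (t • lineNormal a.1 b.1) = {a, b, c, r} ∨
        (cell (modulus f) (t • lineNormal a.1 b.1) = {a, b, c, p, q} ∧
          orient a.1 b.1 p.1 = 1 ∧ orient a.1 b.1 q.1 = 1)) := by
  obtain ⟨r, hr, hmin⟩ := (Finset.univ.filter fun z : 𝒜 => 0 < orient a.1 b.1 z.1).exists_min_image
    (fun z => (modulus f a - modulus f z) / (orient a.1 b.1 z.1 : ℤ))
    (by obtain ⟨z, hz⟩ := hpos; exact ⟨z, by simp [hz]⟩)
  simp only [Finset.mem_filter, Finset.mem_univ, true_and] at hr hmin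
  set t := (modulus f a - modulus f r) / (orient a.1 b.1 r.1 : ℤ) with htdef
  have hamax := mem_cell_zero.mp h.mem_a
  have hr' : (0 : ℝ) < (orient a.1 b.1 r.1 : ℤ) := by exact_mod_cast hr
  have htr : t * (orient a.1 b.1 r.1 : ℤ) = modulus f a - modulus f r :=
    div_mul_cancel₀ _ hr'.ne'
  have ht0 : 0 < t := by
    refine div_pos (sub_pos.mpr (lt_of_le_of_ne (hamax r) fun he => ?_)) hr'
    exact hr.ne' (h.orient_of_mem (h.eq_of_modulus_eq_max he))
  have hle : ∀ z : 𝒜, t * (orient a.1 b.1 z.1 : ℤ) ≤ modulus f a - modulus f z := by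
    intro z
    by_cases hz : 0 < orient a.1 b.1 z.1
    · have hz' : (0 : ℝ) < (orient a.1 b.1 z.1 : ℤ) := by exact_mod_cast hz
      exact (le_div_iff₀ hz').mp (hmin z hz)
    · have hz' : ((orient a.1 b.1 z.1 : ℤ) : ℝ) ≤ 0 := by exact_mod_cast not_lt.mp hz
      exact (mul_nonpos_of_nonneg_of_nonpos ht0.le hz').trans (sub_nonneg.mpr (hamax z))
  set Q := cell (modulus f) (t • lineNormal a.1 b.1) with hQdef
  have hmem : ∀ z, z ∈ Q ↔ t * (orient a.1 b.1 z.1 : ℤ) = modulus f a - modulus f z :=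
    mem_cell_smul_lineNormal_iff hle
  have hsub : ∀ z, z = a ∨ z = b ∨ z = c → z ∈ Q := by
    intro z hz
    rw [hmem, h.orient_of_mem hz]
    have hz0 : z ∈ cell (modulus f) 0 := by rw [h.cell_eq]; exact hz
    rw [le_antisymm (mem_cell_zero.mp hz0 a) (hamax z)]
    simp
  have hrQ : r ∈ Q := (hmem r).mpr htr
  have haQ : a ∈ Q := hsub a (by simp)
  have hbQ : b ∈ Q := hsub b (by simp)
  have hcQ : c ∈ Q := hsub c (by simp)
  have hQsub : Q ∈ subdivision (modulus f) := ⟨not_collinear_toPlane haQ hbQ hrQ hr.ne', _, rfl⟩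
  have hoff : ∀ z ∈ Q, (z = a ∨ z = b ∨ z = c) ∨ 0 < orient a.1 b.1 z.1 := by
    intro z hz
    rw [hmem] at hz
    rcases lt_trichotomy (orient a.1 b.1 z.1) 0 with hz0 | hz0 | hz0
    · exfalso
      have hz' : ((orient a.1 b.1 z.1 : ℤ) : ℝ) < 0 := by exact_mod_cast hz0
      have := mul_neg_of_pos_of_neg ht0 hz'
      linarith [hamax z]
    · rw [hz0] at hz
      simp only [Int.cast_zero, mul_zero] at hz
      exact Or.inl (h.eq_of_modulus_eq_max (by linarith))
    · exact Or.inr hz0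
  have hpair : ∀ z ∈ Q, 0 < orient a.1 b.1 z.1 → r ≠ z →
      ((r = p ∧ z = q) ∨ (r = q ∧ z = p)) ∧ orient a.1 b.1 r.1 = orient a.1 b.1 z.1 :=
    fun z hz hz0 hzr => h.eq_pq_of_mem hu hQsub haQ hbQ hrQ hz hr.ne' hz0.ne' hzr
  have hr1 : orient a.1 b.1 r.1 = 1 := by
    refine h.orient_eq_one_of_mem (hlat _) haQ hbQ hrQ hr fun z hz => ?_
    rcases hoff z hz with h1 | h1
    · exact Or.inl h1
    · by_cases hzr : r = z
      · exact Or.inr (by rw [hzr])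
      · exact Or.inr (hpair z hz h1 hzr).2.symm
  refine ⟨t, r, ht0, hr1, ?_, hle, ?_⟩
  · rw [hr1] at htr; simpa using htr
  by_cases hex : ∃ z ∈ Q, 0 < orient a.1 b.1 z.1 ∧ r ≠ z
  · right
    obtain ⟨z, hz, hz0, hzr⟩ := hex
    obtain ⟨hcases, heq⟩ := hpair z hz hz0 hzr
    have hp : p ∈ Q ∧ orient a.1 b.1 p.1 = 1 := by
      rcases hcases with ⟨h1, h2⟩ | ⟨h1, h2⟩
      · exact ⟨h1 ▸ hrQ, h1 ▸ hr1⟩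
      · exact ⟨h2 ▸ hz, h2 ▸ heq ▸ hr1⟩
    have hq : q ∈ Q ∧ orient a.1 b.1 q.1 = 1 := by
      rcases hcases with ⟨h1, h2⟩ | ⟨h1, h2⟩
      · exact ⟨h2 ▸ hz, h2 ▸ heq ▸ hr1⟩
      · exact ⟨h1 ▸ hrQ, h1 ▸ hr1⟩
    refine ⟨?_, hp.2, hq.2⟩
    ext y
    simp only [Set.mem_insert_iff, Set.mem_singleton_iff]
    constructor
    · intro hy
      rcases hoff y hy with h1 | h1
      · tauto
      · by_cases hyr : r = y
        · rcases hcases with ⟨h1, -⟩ | ⟨h1, -⟩ <;> rw [← hyr, h1] <;> simp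
        · rcases (hpair y hy h1 hyr).1 with ⟨-, h2⟩ | ⟨-, h2⟩ <;> simp [h2]
    · rintro (rfl | rfl | rfl | rfl | rfl)
      exacts [haQ, hbQ, hcQ, hp.1, hq.1]
  · left
    push Not at hex
    ext y
    simp only [Set.mem_insert_iff, Set.mem_singleton_iff]
    constructor
    · intro hy
      rcases hoff y hy with h1 | h1
      · tauto
      · have := hex y hy h1
        tauto
    · rintro (rfl | rfl | rfl | rfl)
      exacts [haQ, hbQ, hcQ, hrQ]

/-- The end point dual to a trapezoid is a 3-valent vertex. -/
lemma valence_three_of_trapezoid (h : IsLineConfiguration f a b c p q) {w : ℝ × ℝ}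
    (hlat : IsLatticeConvex (cell (modulus f) w)) (hQ : cell (modulus f) w = {a, b, c, p, q})
    (hp1 : orient a.1 b.1 p.1 = 1) (hq1 : orient a.1 b.1 q.1 = 1) :
    IsChartVertexOfValence f (1, 1) w 3 := by
  have hpq : (f p).1 ≠ (f q).1 := by
    intro he
    have := h.sign_pq
    rw [hp1, hq1, he, mul_one, int_units_mul_self] at this
    omega
  have hsub := h.sub_eq_or hlat (by rw [hQ]; simp) (by rw [hQ]; simp) hp1 hq1 (by
    intro z hz hz1
    rw [hQ] at hz
    simp only [Set.mem_insert_iff, Set.mem_singleton_iff] at hz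
    by_contra hcon
    have := h.orient_of_mem (z := z) (by tauto)
    omega)
  rcases hsub with ⟨e1, e2⟩ | ⟨e1, e2⟩
  · exact valence_trapezoid hQ h.mid h.orient_p e1 e2 h.sign_ac h.sign_ab hpq
  · refine valence_trapezoid (p := q) (q := p) ?_ h.mid h.orient_q e1 e2 h.sign_ac h.sign_ab
      hpq.symm
    rw [hQ]; ext z; simp only [Set.mem_insert_iff, Set.mem_singleton_iff]; tauto

/-- The dual edge of `abc` between its two end points, given in terms of the normal vectors for both
orientations of the line. -/
lemma dualEdge_eq_segment (h : IsLineConfiguration f a b c p q) {t t' : ℝ} {r r' : 𝒜}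
    (ht : 0 < t) (ht' : 0 < t') (hr : orient a.1 b.1 r.1 = 1)
    (htr : t = modulus f a - modulus f r)
    (hle : ∀ z : 𝒜, t * (orient a.1 b.1 z.1 : ℤ) ≤ modulus f a - modulus f z)
    (hr' : orient c.1 b.1 r'.1 = 1) (htr' : t' = modulus f c - modulus f r')
    (hle' : ∀ z : 𝒜, t' * (orient c.1 b.1 z.1 : ℤ) ≤ modulus f c - modulus f z) :
    dualEdge (modulus f) {a, b, c} =
      segment ℝ (t • lineNormal a.1 b.1) (t' • lineNormal c.1 b.1) := by
  have hac : modulus f c = modulus f a :=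
    le_antisymm (mem_cell_zero.mp h.mem_a c) (mem_cell_zero.mp h.mem_c a)
  rw [h.mid.lineNormal_swap]
  rw [h.mid.orient_swap] at hr'
  ext w
  rw [h.mem_dualEdge_iff]
  constructor
  · rintro ⟨s, rfl, hs⟩
    have h1 := hs r
    have h2 := hs r'
    rw [hr, ← htr] at h1
    rw [show orient a.1 b.1 r'.1 = -1 by omega, ← hac, ← htr'] at h2
    push_cast at h1 h2
    have hD : t + t' ≠ 0 := by positivity
    refine ⟨(s + t') / (t + t'), (t - s) / (t + t'), div_nonneg (by linarith) (by positivity),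
      div_nonneg (by linarith) (by positivity), by field_simp; ring, ?_⟩
    rw [smul_neg, smul_neg, smul_smul, smul_smul, ← sub_eq_add_neg, ← sub_smul]
    congr 1
    field_simp; ring
  · rintro ⟨x, y, hx, hy, hxy, rfl⟩
    refine ⟨x * t - y * t', ?_, fun z => ?_⟩
    · rw [smul_neg, smul_neg, smul_smul, smul_smul, ← sub_eq_add_neg, ← sub_smul]
    · have h1 := mul_le_mul_of_nonneg_left (hle z) hx
      have h2 := mul_le_mul_of_nonneg_left (hle' z) hy
      rw [h.mid.orient_swap, hac] at h2
      push_cast at h2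
      have h3 : modulus f a - modulus f z =
          x * (modulus f a - modulus f z) + y * (modulus f a - modulus f z) := by
        rw [← add_mul, hxy, one_mul]
      rw [h3]
      linarith

lemma lineNormal_ne_zero (h : IsLineConfiguration f a b c p q) : lineNormal a.1 b.1 ≠ 0 := by
  intro h0
  have h1 := congrArg Prod.fst h0
  have h2 := congrArg Prod.snd h0
  simp only [lineNormal, Prod.fst_zero, Prod.snd_zero] at h1 h2
  refine h.ne_ab (Subtype.ext (Prod.ext ?_ ?_))
  · exact_mod_cast (sub_eq_zero.mp h2).symm
  · have : (b.1.2 : ℝ) = a.1.2 := by linarith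
    exact_mod_cast this.symm

/-- If `p` and `q` are on different sides of the line, then both end points of the dual edge are at
the distance given by the common modulus of `p` and `q`. -/
lemma midpoint_of_opposite_sides (h : IsLineConfiguration f a b c p q)
    (hu : HasSmallestCodimension (modulus f))
    (hlat : ∀ w, IsLatticeConvex (cell (modulus f) w)) (hp : 0 < orient a.1 b.1 p.1)
    (hq : orient a.1 b.1 q.1 < 0) :
    ∃ v w : ℝ × ℝ, v ≠ w ∧ dualEdge (modulus f) {a, b, c} = segment ℝ v w ∧
      midpoint ℝ v w = 0 ∧
      ((IsChartVertexOfValence f (1, 1) v 1 ∧ IsChartVertexOfValence f (1, 1) w 1) ∨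
        (IsChartVertexOfValence f (1, 1) v 3 ∧ IsChartVertexOfValence f (1, 1) w 3)) := by
  have hac : modulus f c = modulus f a :=
    le_antisymm (mem_cell_zero.mp h.mem_a c) (mem_cell_zero.mp h.mem_c a)
  have hq' : 0 < orient c.1 b.1 q.1 := by rw [h.mid.orient_swap]; omega
  obtain ⟨t, r, ht, hr, htr, hle, hQ⟩ := h.exists_endpoint hu hlat ⟨p, hp⟩
  obtain ⟨t', r', ht', hr', htr', hle', hQ'⟩ := h.swap_ac.exists_endpoint hu hlat ⟨q, hq'⟩
  replace hQ := hQ.resolve_right (by rintro ⟨-, -, h1⟩; omega)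
  replace hQ' := hQ'.resolve_right (by
    rintro ⟨-, h1, -⟩; rw [h.mid.orient_swap] at h1; omega)
  -- `p` lies in the first polygon, and `q` in the second one
  have key : ∀ {s : ℝ} {m n x y : 𝒜}, 0 < s → s = modulus f a - modulus f x →
      modulus f x ≤ modulus f y → 0 < orient m.1 n.1 y.1 →
      s * (orient m.1 n.1 y.1 : ℤ) ≤ modulus f a - modulus f y →
      orient m.1 n.1 y.1 = 1 ∧ modulus f x = modulus f y := by
    intro s m n x y hs hsx hxy hy hsy
    have hy1 : (1 : ℝ) ≤ (orient m.1 n.1 y.1 : ℤ) := by exact_mod_cast hy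
    have h1 := mul_le_mul_of_nonneg_left hy1 hs.le
    refine ⟨?_, by linarith⟩
    have h2 : ((orient m.1 n.1 y.1 : ℤ) : ℝ) ≤ 1 := by
      refine le_of_mul_le_mul_left ?_ hs
      linarith
    have h3 : orient m.1 n.1 y.1 ≤ 1 := by exact_mod_cast h2
    omega
  obtain ⟨hp1, hrp⟩ := key ht htr (h.max_p r (by omega)) hp (hle p)
  rw [hac] at htr'
  obtain ⟨hq1, hrq⟩ := key ht' htr'
    (h.swap_ac.max_q r' (by rw [hr']; omega)) hq' (hac ▸ hle' q)
  have hrp' : r = p := by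
    refine (h.eq_of_modulus_eq hu (by omega) hrp).resolve_right ?_
    rintro rfl; omega
  have hrq' : r' = q := by
    refine (h.eq_of_modulus_eq hu ?_ (hrq.trans h.modulus_pq.symm)).resolve_left ?_
    · rw [h.mid.orient_swap] at hr'; omega
    · rintro rfl; rw [h.mid.orient_swap] at hr'; omega
  subst hrp' hrq'
  have htt : t' = t := by rw [htr, htr', h.modulus_pq]
  have hs : (f r).1 = (f r').1 := by
    have h1 := h.sign_pq
    have h2 : orient a.1 b.1 r'.1 = -1 := by rw [h.mid.orient_swap] at hr'; omega
    rw [hr, h2] at h1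
    rcases Int.units_eq_one_or (f r).1 with e | e <;>
      rcases Int.units_eq_one_or (f r').1 with e' | e' <;> rw [e, e'] at h1 ⊢ <;> simp at h1
  have hdual := h.dualEdge_eq_segment ht ht' hr htr hle hr' (hac ▸ htr') hle'
  have v1 := valence_triangle hQ h.mid (by omega) h.sign_ac h.sign_ab
  have v2 := valence_triangle hQ' h.mid.symm (by omega) h.sign_ac.symm h.swap_ac.sign_ab
  refine ⟨_, _, ?_, hdual, ?_, ?_⟩
  · rw [h.mid.lineNormal_swap, htt]
    intro he
    have h1 : (2 * t) • lineNormal a.1 b.1 = 0 := by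
      rw [two_mul, add_smul]
      nth_rewrite 1 [he]
      simp
    rcases smul_eq_zero.mp h1 with h2 | h2
    · linarith
    · exact h.lineNormal_ne_zero h2
  · rw [h.mid.lineNormal_swap, htt, smul_neg, midpoint_self_neg]
  · by_cases hsr : (f r).1 = (f a).1
    · exact Or.inl ⟨v1.1 hsr, v2.1 (by rw [← hs, hsr, h.sign_ac])⟩
    · exact Or.inr ⟨v1.2 hsr, v2.2 (by rw [← hs, ← h.sign_ac]; exact hsr)⟩

/-- If `p` and `q` are on the same side of the line, then the end point on this side is dual to a
trapezoid with vertices `p` and `q`, and the other end point, if it exists, is farther away from the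
origin. -/
lemma ray_or_segment_of_same_side (h : IsLineConfiguration f a b c p q)
    (hu : HasSmallestCodimension (modulus f))
    (hlat : ∀ w, IsLatticeConvex (cell (modulus f) w)) (hp : 0 < orient a.1 b.1 p.1)
    (hq : 0 < orient a.1 b.1 q.1) :
    (∃ v w : ℝ × ℝ, v ≠ w ∧ dualEdge (modulus f) {a, b, c} = segment ℝ v w ∧
      (0 : ℝ × ℝ) ∈ openSegment ℝ v (midpoint ℝ v w) ∧ IsChartVertexOfValence f (1, 1) v 3 ∧
      (IsChartVertexOfValence f (1, 1) w 1 ∨ IsChartVertexOfValence f (1, 1) w 3)) ∨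
    (∃ v d : ℝ × ℝ, d ≠ 0 ∧
      dualEdge (modulus f) {a, b, c} = {w | ∃ t : ℝ, 0 ≤ t ∧ w = v + t • d} ∧
      (∃ t : ℝ, 0 < t ∧ v + t • d = 0) ∧ IsChartVertexOfValence f (1, 1) v 3) := by
  have hac : modulus f c = modulus f a :=
    le_antisymm (mem_cell_zero.mp h.mem_a c) (mem_cell_zero.mp h.mem_c a)
  obtain ⟨t, r, ht, hr, htr, hle, hQ⟩ := h.exists_endpoint hu hlat ⟨p, hp⟩
  have hmem := mem_cell_smul_lineNormal_iff hle
  -- `p` and `q` both lie in the polygon dual to the end point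
  have key : ∀ y : 𝒜, modulus f r ≤ modulus f y → 0 < orient a.1 b.1 y.1 →
      y ∈ cell (modulus f) (t • lineNormal a.1 b.1) ∧ modulus f r = modulus f y := by
    intro y hy hy0
    have hy1 : (1 : ℝ) ≤ (orient a.1 b.1 y.1 : ℤ) := by exact_mod_cast hy0
    have h1 := mul_le_mul_of_nonneg_left hy1 ht.le
    have h2 := hle y
    exact ⟨(hmem y).mpr (by linarith), by linarith⟩
  obtain ⟨hpQ, hrp⟩ := key p (h.max_p r (by omega)) hp
  obtain ⟨hqQ, -⟩ := key q (h.max_q r (by omega)) hq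
  replace hQ : cell (modulus f) (t • lineNormal a.1 b.1) = {a, b, c, p, q} ∧
      orient a.1 b.1 p.1 = 1 ∧ orient a.1 b.1 q.1 = 1 := by
    refine hQ.resolve_left fun hQ3 => h.ne_pq ?_
    have honly : ∀ y ∈ cell (modulus f) (t • lineNormal a.1 b.1), 0 < orient a.1 b.1 y.1 →
        y = r := by
      intro y hy hy0
      rw [hQ3] at hy
      simp only [Set.mem_insert_iff, Set.mem_singleton_iff] at hy
      by_contra hcon
      have := h.orient_of_mem (z := y) (by tauto)
      omega
    rw [honly p hpQ hp, honly q hqQ hq]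
  obtain ⟨hQ, hp1, hq1⟩ := hQ
  have hv := h.valence_three_of_trapezoid (hlat _) hQ hp1 hq1
  by_cases hneg : ∃ z : 𝒜, 0 < orient c.1 b.1 z.1
  · left
    obtain ⟨t', r', ht', hr', htr', hle', hQ'⟩ := h.swap_ac.exists_endpoint hu hlat hneg
    replace hQ' := hQ'.resolve_right (by
      rintro ⟨-, h1, -⟩; rw [h.mid.orient_swap] at h1; omega)
    have hdual := h.dualEdge_eq_segment ht ht' hr htr hle hr' htr' hle'
    have v2 := valence_triangle hQ' h.mid.symm (by omega) h.sign_ac.symm h.swap_ac.sign_ab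
    have hr'0 : orient a.1 b.1 r'.1 = -1 := by rw [h.mid.orient_swap] at hr'; omega
    have htt : t < t' := by
      have h1 := h.max_p r' (by omega)
      rw [htr, htr', hac, hrp]
      rcases h1.lt_or_eq with h2 | h2
      · linarith
      · exfalso
        rcases h.eq_of_modulus_eq hu (by omega) h2 with rfl | rfl <;> omega
    refine ⟨_, _, ?_, hdual, ?_, hv, ?_⟩
    · rw [h.mid.lineNormal_swap]
      intro he
      have h1 : (t + t') • lineNormal a.1 b.1 = 0 := by
        rw [add_smul, he]; simp
      rcases smul_eq_zero.mp h1 with h2 | h2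
      · linarith
      · exact h.lineNormal_ne_zero h2
    · -- the midpoint is `((t - t') / 2) • n`, on the other side of the origin since `t < t'`
      refine ⟨(t' - t) / (t + t'), 2 * t / (t + t'), div_pos (by linarith) (by linarith),
        by positivity, by field_simp; ring, ?_⟩
      rw [h.mid.lineNormal_swap, midpoint_eq_smul_add, smul_neg, ← sub_eq_add_neg, ← sub_smul,
        smul_smul, smul_smul, smul_smul, ← add_smul, smul_eq_zero]
      left
      field_simp
      rw [invOf_eq_inv]
      ring
    · by_cases hsr : (f r').1 = (f c).1
      · exact Or.inl (v2.1 hsr)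
      · exact Or.inr (v2.2 hsr)
  · right
    push Not at hneg
    refine ⟨t • lineNormal a.1 b.1, -lineNormal a.1 b.1, neg_ne_zero.mpr h.lineNormal_ne_zero, ?_,
      ⟨t, ht, by simp⟩, hv⟩
    ext w
    rw [h.mem_dualEdge_iff]
    constructor
    · rintro ⟨s, rfl, hs⟩
      have h1 := hs r
      rw [hr, ← htr] at h1
      push_cast at h1
      refine ⟨t - s, by linarith, ?_⟩
      rw [smul_neg, ← sub_eq_add_neg, ← sub_smul]
      congr 1
      ring
    · rintro ⟨s, hs, rfl⟩
      refine ⟨t - s, by rw [smul_neg, ← sub_eq_add_neg, ← sub_smul], fun z => ?_⟩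
      have h1 := hle z
      have h2 := hneg z
      rw [h.mid.orient_swap] at h2
      have h3 : (0 : ℝ) ≤ (orient a.1 b.1 z.1 : ℤ) := by exact_mod_cast (by omega)
      have h4 := mul_nonneg hs h3
      linarith

end IsLineConfiguration

/-! ### The classification -/

/-- No three of four points attaining the maximum are collinear: the fourth point would be the only
one off the line through them, or all four points would be collinear. -/
lemma orient_ne_zero_of_four (h𝒜 : IsPolygonSupport 𝒜) {f : RealTropicalPolynomial 𝒜}
    (hf : IsSingularAtZeroPlus f) (hu : HasSmallestCodimension (modulus f)) {x y z w : 𝒜}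
    (hU : ∀ v, v ∈ cell (modulus f) 0 ↔ v = x ∨ v = y ∨ v = z ∨ v = w)
    (hnd : [x, y, z, w].Nodup) : orient x.1 y.1 z.1 ≠ 0 := by
  intro h0
  have hw0 : orient x.1 y.1 w.1 = 0 := by
    refine hf.isSignBalanced.orient_eq_zero ((hU w).mpr (by simp)) fun v hv hvw => ?_
    rcases (hU v).mp hv with rfl | rfl | rfl | rfl
    exacts [orient_self_mid _ _, orient_self_right _ _, h0, absurd rfl hvw]
  exact false_of_four_collinear h𝒜 hf hu ((hU x).mpr (by simp)) ((hU y).mpr (by simp))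
    ((hU z).mpr (by simp)) ((hU w).mpr (by simp)) hnd h0 hw0

lemma eq_of_ne_of_ne {s t r : ℤˣ} (h : s ≠ t) (h' : r ≠ t) : r = s := by
  rcases Int.units_eq_one_or s with rfl | rfl <;> rcases Int.units_eq_one_or t with rfl | rfl <;>
    rcases Int.units_eq_one_or r with rfl | rfl <;> simp_all

/-- If one of four points has the opposite sign, then it is an interior point of the triangle formed
by the others. -/
lemma isolated_of_dependence {f : RealTropicalPolynomial 𝒜} {a b c d : 𝒜}
    (hQ : cell (modulus f) 0 = {a, b, c, d}) (hlat : IsLatticeConvex (cell (modulus f) 0))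
    (hb : (f b).1 = (f a).1) (hc : (f c).1 = (f a).1)
    (hd : (f d).1 ≠ (f a).1) {i j k l : ℤ} (hi : 0 < i) (hj : 0 < j) (hk : 0 < k)
    (h0 : i + j + k = l) (h1 : i * a.1.1 + j * b.1.1 + k * c.1.1 = l * d.1.1)
    (h2 : i * a.1.2 + j * b.1.2 + k * c.1.2 = l * d.1.2) (hne : orient a.1 b.1 c.1 ≠ 0) :
    IsChartVertex f (1, 1) 0 ∧ IsIsolatedInChart f (1, 1) 0 ∧
      HasTriangleMultiplicity (modulus f) 0 3 := by
  rw [← h0] at h1 h2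
  have hmem : ∀ x, x = a ∨ x = b ∨ x = c ∨ x = d → x ∈ cell (modulus f) 0 := by
    intro x hx; rw [hQ]; exact hx
  exact ⟨⟨not_collinear_toPlane (hmem a (by simp)) (hmem b (by simp)) (hmem c (by simp)) hne,
      hasBothSigns_one.mpr ⟨d, hmem d (by simp), a, hmem a (by simp), hd⟩⟩,
    isIsolatedInChart_of_dependence hQ hb hc hd hi hj hk h1 h2 hne,
    triangle_multiplicity_three hQ hlat hi hj hk h1 h2 hne⟩

lemma four_monomials (h𝒜 : IsPolygonSupport 𝒜) {f : RealTropicalPolynomial 𝒜}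
    (hf : IsSingularAtZeroPlus f) (hu : HasSmallestCodimension (modulus f))
    (hlat : IsLatticeConvex (cell (modulus f) 0)) {x y z w : 𝒜}
    (hU : cell (modulus f) 0 = {x, y, z, w}) (hnd : [x, y, z, w].Nodup)
    (hxy : (f x).1 ≠ (f y).1) :
    (IsChartVertexOfValence f (1, 1) 0 4 ∧
      ∀ E ∈ incidentEdges f (1, 1) 0, HasWeight E 1) ∨
    (IsChartVertex f (1, 1) 0 ∧ IsIsolatedInChart f (1, 1) 0 ∧
      HasTriangleMultiplicity (modulus f) 0 3) := by
  have hU' : ∀ v, v ∈ cell (modulus f) 0 ↔ v = x ∨ v = y ∨ v = z ∨ v = w := by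
    intro v; rw [hU]; rfl
  have hxyz := orient_ne_zero_of_four h𝒜 hf hu hU' hnd
  have hxyw : orient x.1 y.1 w.1 ≠ 0 := orient_ne_zero_of_four (w := z) h𝒜 hf hu
    (fun v => (hU' v).trans (by tauto)) (by simp_all [eq_comm])
  have hxzw : orient x.1 z.1 w.1 ≠ 0 := orient_ne_zero_of_four (w := y) h𝒜 hf hu
    (fun v => (hU' v).trans (by tauto)) (by simp_all [eq_comm])
  have hyzw : orient y.1 z.1 w.1 ≠ 0 := orient_ne_zero_of_four (w := x) h𝒜 hf hu
    (fun v => (hU' v).trans (by tauto)) (by simp_all [eq_comm])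
  have hbal := hf.isSignBalanced
  rw [hU] at hbal
  obtain ⟨i, j, k, l, hi, hj, hk, hl, h0, h1, h2⟩ := hbal.exists_dependence hxyz
  have hsy : ((f y).1 : ℤ) = -(f x).1 := by
    rcases Int.units_eq_one_or (f x).1 with e | e <;>
      rcases Int.units_eq_one_or (f y).1 with e' | e' <;> rw [e, e'] <;> simp_all
  have hperm : ∀ a b c d : 𝒜, (∀ v, (v = x ∨ v = y ∨ v = z ∨ v = w) ↔
      (v = a ∨ v = b ∨ v = c ∨ v = d)) → cell (modulus f) 0 = {a, b, c, d} := by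
    intro a b c d h
    ext v; rw [hU' v, h v]; rfl
  have hunit := int_units_mul_self (f x).1
  -- the dependence, multiplied by the sign of `x`
  by_cases hz : (f z).1 = (f x).1 <;> by_cases hw : (f w).1 = (f x).1
  · right
    rw [hsy, hz, hw] at h0 h1 h2
    exact isolated_of_dependence (hperm x z w y fun v => by tauto) hlat hz hw hxy.symm hi hk hl
      (l := j) (by linear_combination (f x).1 * h0 - (i - j + k + l) * hunit)
      (by linear_combination (f x).1 * h1 -
        (i * x.1.1 - j * y.1.1 + k * z.1.1 + l * w.1.1) * hunit)
      (by linear_combination (f x).1 * h2 -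
        (i * x.1.2 - j * y.1.2 + k * z.1.2 + l * w.1.2) * hunit) hxzw
  · have hwy : (f w).1 = (f y).1 := eq_of_ne_of_ne hxy.symm hw
    left
    rw [hwy, hsy, hz] at h0 h1 h2
    exact four_valent_of_dependence (hperm x y z w fun v => by tauto) hlat hz.symm hwy.symm hxy
      hi hk hj hl (by linear_combination (f x).1 * h0 - (i - j + k - l) * hunit)
      (by linear_combination (f x).1 * h1 -
        (i * x.1.1 - j * y.1.1 + k * z.1.1 - l * w.1.1) * hunit)
      (by linear_combination (f x).1 * h2 -
        (i * x.1.2 - j * y.1.2 + k * z.1.2 - l * w.1.2) * hunit) hxyz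
  · have hzy : (f z).1 = (f y).1 := eq_of_ne_of_ne hxy.symm hz
    left
    rw [hzy, hsy, hw] at h0 h1 h2
    exact four_valent_of_dependence (hperm x y w z fun v => by tauto) hlat hw.symm hzy.symm hxy
      hi hl hj hk (by linear_combination (f x).1 * h0 - (i - j - k + l) * hunit)
      (by linear_combination (f x).1 * h1 -
        (i * x.1.1 - j * y.1.1 - k * z.1.1 + l * w.1.1) * hunit)
      (by linear_combination (f x).1 * h2 -
        (i * x.1.2 - j * y.1.2 - k * z.1.2 + l * w.1.2) * hunit) hxyw
  · have hzy : (f z).1 = (f y).1 := eq_of_ne_of_ne hxy.symm hz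
    have hwy : (f w).1 = (f y).1 := eq_of_ne_of_ne hxy.symm hw
    right
    rw [hwy, hzy, hsy] at h0 h1 h2
    exact isolated_of_dependence (hperm y z w x fun v => by tauto) hlat hzy hwy hxy hj hk hl
      (l := i) (by linear_combination -(f x).1 * h0 + (i - j - k - l) * hunit)
      (by linear_combination -(f x).1 * h1 +
        (i * x.1.1 - j * y.1.1 - k * z.1.1 - l * w.1.1) * hunit)
      (by linear_combination -(f x).1 * h2 +
        (i * x.1.2 - j * y.1.2 - k * z.1.2 - l * w.1.2) * hunit) hyzw

lemma exists_lineConfiguration (h𝒜 : IsPolygonSupport 𝒜) {f : RealTropicalPolynomial 𝒜}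
    (hf : IsSingularAtZeroPlus f) (hlat : IsLatticeConvex (cell (modulus f) 0)) {x y z : 𝒜}
    (hU : cell (modulus f) 0 = {x, y, z}) (hxy : (f x).1 ≠ (f y).1) :
    ∃ a b c p q : 𝒜, IsLineConfiguration f a b c p q ∧ 0 < orient a.1 b.1 p.1 := by
  obtain ⟨a, b, c, hset, hac, hab⟩ : ∃ a b c : 𝒜, cell (modulus f) 0 = {b, a, c} ∧
      (f a).1 = (f c).1 ∧ (f a).1 ≠ (f b).1 := by
    by_cases hz : (f z).1 = (f x).1
    · refine ⟨x, y, z, ?_, hz.symm, hxy⟩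
      rw [hU]; ext v; simp only [Set.mem_insert_iff, Set.mem_singleton_iff]; tauto
    · exact ⟨y, x, z, hU, (eq_of_ne_of_ne hxy.symm hz).symm, hxy.symm⟩
  have hmid := hf.isSignBalanced.isMid hlat hset hac hab
  have hne : a ≠ b := by rintro rfl; exact hab rfl
  obtain ⟨p, q, h1, h2, h3, h4⟩ := hf.exists_off_line h𝒜 hne
  have h : IsLineConfiguration f a b c p q := by
    refine ⟨?_, hmid, hac, hab, mul_neg_of_pos_of_neg h1 h2, h3, h4⟩
    rw [hset]; ext v; simp only [Set.mem_insert_iff, Set.mem_singleton_iff]; tauto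
  rcases lt_or_gt_of_ne h.orient_p with hp | hp
  · exact ⟨c, b, a, p, q, h.swap_ac, by rw [hmid.orient_swap]; omega⟩
  · exact ⟨a, b, c, p, q, h, hp⟩

end RealTrop

theorem mainTheorem1 (𝒜 : Finset (ℤ × ℤ)) (h𝒜 : RealTrop.IsPolygonSupport 𝒜)
    (g : RealTrop.RealTropicalPolynomial 𝒜) (hg : RealTrop.IsMaximalDimensionalType g)
    (f : RealTrop.RealTropicalPolynomial 𝒜) (hf : f ∈ RealTrop.signedSecondaryClass g)
    (hsing : RealTrop.IsSingularAtZeroPlus f)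
    (hgen : RealTrop.HasSmallestCodimension (RealTrop.modulus f)) :
    -- a 4-valent vertex incident to 4 edges of weight one
    (RealTrop.IsChartVertexOfValence f (1, 1) 0 4 ∧
      ∀ E ∈ RealTrop.incidentEdges f (1, 1) 0, RealTrop.HasWeight E 1) ∨
    -- an isolated vertex of multiplicity 3
    (RealTrop.IsChartVertex f (1, 1) 0 ∧ RealTrop.IsIsolatedInChart f (1, 1) 0 ∧
      RealTrop.HasTriangleMultiplicity (RealTrop.modulus f) 0 3) ∨
    -- the midpoint of a bounded edge of weight 2, between two 1-valent or two 3-valent vertices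
    (∃ E ∈ RealTrop.chartEdges f (1, 1), ∃ p q : ℝ × ℝ, RealTrop.HasWeight E 2 ∧ p ≠ q ∧
      RealTrop.dualEdge (RealTrop.modulus f) E = segment ℝ p q ∧ midpoint ℝ p q = 0 ∧
      ((RealTrop.IsChartVertexOfValence f (1, 1) p 1 ∧
          RealTrop.IsChartVertexOfValence f (1, 1) q 1) ∨
        (RealTrop.IsChartVertexOfValence f (1, 1) p 3 ∧
          RealTrop.IsChartVertexOfValence f (1, 1) q 3))) ∨
    -- on a bounded edge of weight 2, strictly between a 3-valent vertex `p` and the midpoint,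
    -- the other vertex `q` being 1-valent or 3-valent
    (∃ E ∈ RealTrop.chartEdges f (1, 1), ∃ p q : ℝ × ℝ, RealTrop.HasWeight E 2 ∧ p ≠ q ∧
      RealTrop.dualEdge (RealTrop.modulus f) E = segment ℝ p q ∧
      (0 : ℝ × ℝ) ∈ openSegment ℝ p (midpoint ℝ p q) ∧
      RealTrop.IsChartVertexOfValence f (1, 1) p 3 ∧
      (RealTrop.IsChartVertexOfValence f (1, 1) q 1 ∨
        RealTrop.IsChartVertexOfValence f (1, 1) q 3)) ∨
    -- in the interior of an infinite edge of weight 2 whose endpoint is a 3-valent vertex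
    (∃ E ∈ RealTrop.chartEdges f (1, 1), ∃ p d : ℝ × ℝ, RealTrop.HasWeight E 2 ∧ d ≠ 0 ∧
      RealTrop.dualEdge (RealTrop.modulus f) E = {w | ∃ t : ℝ, 0 ≤ t ∧ w = p + t • d} ∧
      (∃ t : ℝ, 0 < t ∧ p + t • d = 0) ∧
      RealTrop.IsChartVertexOfValence f (1, 1) p 3) := by
  have hmarked : ∀ α : 𝒜, ∃ Q ∈ RealTrop.subdivision (RealTrop.modulus f), α ∈ Q := by
    rw [hf.2]; exact hg
  have hlat := RealTrop.isLatticeConvex_cell h𝒜 hmarked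
  have hbal := hsing.isSignBalanced
  have hne : (RealTrop.cell (RealTrop.modulus f) 0).Nonempty := by
    have hA : Nonempty 𝒜 := by
      by_contra hempty
      rw [not_nonempty_iff, Finset.isEmpty_coe_sort] at hempty
      exact h𝒜.1 (by rw [hempty]; simp [collinear_empty])
    obtain ⟨α, hα⟩ := Finite.exists_max (RealTrop.modulus f)
    exact ⟨α, RealTrop.mem_cell_zero.mpr hα⟩
  obtain ⟨x, hx, y, hy, hxy⟩ := hbal.exists_ne hne
  have hxy' : x ≠ y := by rintro rfl; exact hxy rfl
  obtain ⟨z, hz, hzx, hzy⟩ := hbal.exists_third hy hxy'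
  by_cases h3 : ∀ v ∈ RealTrop.cell (RealTrop.modulus f) 0, v = x ∨ v = y ∨ v = z
  · have hU : RealTrop.cell (RealTrop.modulus f) 0 = {x, y, z} :=
      Set.Subset.antisymm h3 (by rintro v (rfl | rfl | rfl) <;> assumption)
    obtain ⟨a, b, c, p, q, h, hp⟩ := RealTrop.exists_lineConfiguration h𝒜 hsing (hlat 0) hU hxy
    have hE := h.mem_chartEdges
    have hw := h.hasWeight_two (hlat 0)
    right; right
    rcases lt_or_gt_of_ne h.orient_q with hq | hq
    · obtain ⟨v, w, h1, h2, h4, h5⟩ := h.midpoint_of_opposite_sides hgen hlat hp hq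
      exact Or.inl ⟨_, hE, v, w, hw, h1, h2, h4, h5⟩
    · right
      rcases h.ray_or_segment_of_same_side hgen hlat hp hq with
        ⟨v, w, h1, h2, h4, h5, h6⟩ | ⟨v, d, h1, h2, h4, h5⟩
      · exact Or.inl ⟨_, hE, v, w, hw, h1, h2, h4, h5, h6⟩
      · exact Or.inr ⟨_, hE, v, d, hw, h1, h2, h4, h5⟩
  · push Not at h3
    obtain ⟨w, hw, hwx, hwy, hwz⟩ := h3
    have hU : RealTrop.cell (RealTrop.modulus f) 0 = {x, y, z, w} := by
      refine Set.Subset.antisymm (fun v hv => ?_)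
        (by rintro v (rfl | rfl | rfl | rfl) <;> assumption)
      by_contra hcon
      simp only [Set.mem_insert_iff, Set.mem_singleton_iff, not_or] at hcon
      exact hgen.false_of_five hx hy hz hw hv (by simp_all [eq_comm])
    rcases RealTrop.four_monomials h𝒜 hsing hgen (hlat 0) hU (by simp_all [eq_comm]) hxy with h | h
    · exact Or.inl h
    · exact Or.inr (Or.inl h)
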